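/- Let $d\ge 1$, $\alpha\in(d+1,2d+2)$, and let $l:(0,\infty)\to(0,\infty)$ be slowly varying at infinity and bounded on each compact subset. Let $\pi$ be a probability measure on $(0,\infty)$ with density $p(\lambda)=l(1/\lambda)\lambda^{\alpha-1}$. Let $W$ be a Lévy measure on $\mathbb{R}$ with $\int_{\mathbb{R}}x^2\,W(dx)<\infty$ whose Blumenthal–Getoor index $\beta_{BG}=\inf\{\gamma\ge0:\int_{|x|\le1}|x|^\gamma W(dx)<\infty\}$ satisfies $0<\beta_{BG}<\alpha/(d+1)$ and such that, for some $c^+,c^->0$, $$W([x,\infty))\sim c^+x^{-\beta_{BG}},\qquad W((-\infty,-x])\sim c^-x^{-\beta_{BG}},\qquad x\to0+.$$ Let $\Lambda$ be an independently scattered infinitely divisible random measure on $(0,\infty)\times\mathbb{R}^d$ (defined on the Borel sets $A$ of finite measure $\pi\times Leb$) such that $$\log E e^{is\Lambda(A)}=(\pi\times Leb)(A)\,\mathcal K(s),\qquad \mathcal K(s)=\int_{\mathbb{R}}(e^{isx}-1-isx)\,W(dx),\quad s\in\mathbb{R}$$ (in particular there is no Gaussian component). Let $X$ be a jointly measurable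 version of the supCAR random field $$X(t)=-\int_0^\infty\int_{\mathbb{R}^d}\frac1{2\lambda}e^{-\lambda\|t-u\|}\,\Lambda(du,d\lambda),\qquad t\in\mathbb{R}^d,$$ where the integral is a Rajput–Rosinski stochastic integral. Let $\Delta\subset\mathbb{R}^d$ be a bounded convex set containing the origin in its interior, $\Delta(T)=T\Delta$, and $X^*(T)=\int_{\Delta(T)}X(y)\,dy$ for $T\ge0$. Let $l^{\#}$ be a de Bruijn conjugate of $f(x)=l^{-1/d}(x^{d/\alpha})$, that is, a slowly varying function with $f(x)l^{\#}(xf(x))\to1$ and $l^{\#}(x)f(xl^{\#}(x))\to1$ as $x\to\infty$. Put $$c_7=\frac{\pi^{d/2}\,\Gamma(d)\,|\Delta|^{(d+1)/\alpha}}{\alpha^{(d+1)/\alpha}\,\Gamma(d/2)},\qquad \gamma=\frac{\alpha}{d+1}\in(1,2),\qquad c^-_\gamma=\int_{-\infty}^0|y|^\gamma W(dy),\qquad c^+_\gamma=\int_0^\infty|y|^\gamma W(dy)$$ (in the formula for $c_7$ the symbol $\pi$ is the number). Then $X$ is almost surely integrable over $\Delta(T)$ for each $T\ge0$, the constants $c^\pm_\gamma$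 are finite, and $$\frac{1}{c_7\,T^{d(d+1)/\alpha}\,l^{\#}(T)^{d(d+1)/\alpha}}\;X^*(t^{1/d}T)\ \longrightarrow\ L_\gamma(t),\qquad t\in[0,1],\quad T\to\infty,$$ in the sense of convergence of all finite-dimensional distributions, where $L_\gamma$ is the $\gamma$-stable Lévy process with $$\log Ee^{isL_\gamma(t)}=-t|s|^\gamma\,\frac{\Gamma(2-\gamma)}{1-\gamma}\Big((c^-_\gamma+c^+_\gamma)\cos\frac{\pi\gamma}{2}-i\,(c^-_\gamma-c^+_\gamma)\,\mathrm{sign}(s)\sin\frac{\pi\gamma}{2}\Big),\quad s\in\mathbb{R}.$$ -/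

import Mathlib

open MeasureTheory ProbabilityTheory Filter Topology Set Asymptotics
open scoped NNReal ENNReal Pointwise

noncomputable section

namespace SupCAR

/-! ### Slow variation -/

/-- Slow variation at infinity: measurable, eventually positive and
`l (c x) / l x → 1` as `x → ∞` for every `c > 0`. -/
structure IsSlowlyVarying (l : ℝ → ℝ) : Prop where
  measurable : Measurable l
  eventually_pos : ∀ᶠ x in atTop, 0 < l x
  tendsto_ratio : ∀ c : ℝ, 0 < c → Tendsto (fun x => l (c * x) / l x) atTop (𝓝 1)

/-- `g` is a de Bruijn conjugate of the slowly varying function `f` (such a `g` is unique up to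
asymptotic equivalence). -/
structure IsDeBruijnConjugate (f g : ℝ → ℝ) : Prop where
  slowlyVarying : IsSlowlyVarying g
  tendsto_left : Tendsto (fun x => f x * g (x * f x)) atTop (𝓝 1)
  tendsto_right : Tendsto (fun x => g x * f (x * g x)) atTop (𝓝 1)

/-! ### Lévy measures and cumulant functions -/

/-- Lévy measures on the line. -/
structure IsLevyMeasure (W : Measure ℝ) : Prop where
  zero : W {0} = 0
  lintegral_lt_top : ∫⁻ x, ENNReal.ofReal (min 1 (x ^ 2)) ∂W < ∞

/-- The Blumenthal–Getoor index of a Lévy measure. -/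
def blumenthalGetoorIndex (W : Measure ℝ) : ℝ :=
  sInf {γ : ℝ | 0 ≤ γ ∧ ∫⁻ x in {x : ℝ | |x| ≤ 1}, ENNReal.ofReal (|x| ^ γ) ∂W < ∞}

/-- The cumulant function of the centred infinitely divisible law without Gaussian component and
with Lévy measure `W`, where `∫ x ^ 2 dW < ∞`. -/
def jumpCumulant (W : Measure ℝ) (s : ℝ) : ℂ :=
  ∫ x : ℝ, (Complex.exp (Complex.I * s * x) - 1 - Complex.I * s * x) ∂W

/-- The function `ω(s; γ, c₁, c₂)` that describes the cumulant function
`-|s| ^ γ * ω(s; γ, c₁, c₂)` of a centred `γ`-stable random variable. -/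
def stableOmega (s γ c₁ c₂ : ℝ) : ℂ :=
  if γ = 1 then ((c₁ * Real.pi : ℝ) : ℂ)
  else ((Real.Gamma (2 - γ) / (1 - γ) : ℝ) : ℂ) *
    ((((c₁ + c₂) * Real.cos (Real.pi * γ / 2) : ℝ) : ℂ) -
      Complex.I * (((c₁ - c₂) * Real.sign s * Real.sin (Real.pi * γ / 2) : ℝ) : ℂ))

/-! ### Independently scattered random measures and the Rajput–Rosinski integral -/

section RandomMeasure

variable {α Ω : Type*} [MeasurableSpace α] [MeasurableSpace Ω]

/-- The sets on which the random measure is defined: measurable sets of finite control measure. -/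
def IsAdmissible (μ : Measure α) (A : Set α) : Prop := MeasurableSet A ∧ μ A < ∞

/-- `Λ` is an independently scattered infinitely divisible random measure with
`log E exp (i s Λ(A)) = μ(A) * K s` for all measurable `A` with `μ A < ∞`. The values of `Λ` at
other sets play no role. -/
structure IsScatteredRandomMeasure (μ : Measure α) (P : Measure Ω) (K : ℝ → ℂ)
    (Λ : Set α → Ω → ℝ) : Prop where
  measurable : ∀ A, IsAdmissible μ A → Measurable (Λ A)
  indep : ∀ A : ℕ → Set α, (∀ n, IsAdmissible μ (A n)) → Pairwise (Function.onFun Disjoint A) →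
    iIndepFun (fun n => Λ (A n)) P
  countably_additive : ∀ A : ℕ → Set α, (∀ n, IsAdmissible μ (A n)) →
    Pairwise (Function.onFun Disjoint A) → IsAdmissible μ (⋃ n, A n) →
    ∀ᵐ ω ∂P, Tendsto (fun N : ℕ => ∑ n ∈ Finset.range N, Λ (A n) ω) atTop (𝓝 (Λ (⋃ n, A n) ω))
  charFun_eq : ∀ A, IsAdmissible μ A → ∀ s : ℝ,
    charFun (P.map (Λ A)) s = Complex.exp ((μ.real A : ℂ) * K s)

/-- A simple function `∑ i, coeff i * 1_{set i}` over disjoint admissible sets. -/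
structure SimpleIntegrand (μ : Measure α) where
  size : ℕ
  coeff : Fin size → ℝ
  set : Fin size → Set α
  admissible : ∀ i, IsAdmissible μ (set i)
  disjoint : Pairwise (Function.onFun Disjoint set)

/-- The simple function as a function. -/
def SimpleIntegrand.eval {μ : Measure α} (f : SimpleIntegrand μ) (x : α) : ℝ :=
  ∑ i, (f.set i).indicator (fun _ => f.coeff i) x

/-- The integral over `A` of a simple function. -/
def SimpleIntegrand.integral {μ : Measure α} (f : SimpleIntegrand μ) (Λ : Set α → Ω → ℝ)
    (A : Set α) (ω : Ω) : ℝ :=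
  ∑ i, f.coeff i * Λ (f.set i ∩ A) ω

/-- `f` is `Λ`-integrable in the sense of Rajput and Rosinski, and the random variable `Z` is (a
version of) its integral over the whole space: there are simple functions `fₙ → f` almost
everywhere such that `∫_A fₙ dΛ` converges in probability for every measurable set `A`, and `Z` is
the limit for the whole space. -/
def IsRajputRosinskiIntegral (μ : Measure α) (P : Measure Ω) (Λ : Set α → Ω → ℝ) (f : α → ℝ)
    (Z : Ω → ℝ) : Prop :=
  ∃ F : ℕ → SimpleIntegrand μ,
    (∀ᵐ x ∂μ, Tendsto (fun n => (F n).eval x) atTop (𝓝 (f x))) ∧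
    (∀ A : Set α, MeasurableSet A →
      ∃ Y : Ω → ℝ, Measurable Y ∧ TendstoInMeasure P (fun n => (F n).integral Λ A) atTop Y) ∧
    TendstoInMeasure P (fun n => (F n).integral Λ univ) atTop Z

end RandomMeasure

/-! ### SupCAR fields -/

section SupCARField

variable {d : ℕ} {Ω : Type*} [MeasurableSpace Ω]

/-- The kernel `(λ, u) ↦ -(1 / (2 λ)) exp (-λ ‖t - u‖)`. -/
def supCARKernel (t : EuclideanSpace ℝ (Fin d)) (q : ℝ × EuclideanSpace ℝ (Fin d)) : ℝ :=
  -(1 / (2 * q.1)) * Real.exp (-q.1 * ‖t - q.2‖)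

/-- `X` is a supCAR field driven by `Λ`, a random measure with control measure `π × Lebesgue`:
each `X t` is the stochastic integral of the kernel. A jointly measurable version is taken, so that
the field can be integrated in space. -/
structure IsSupCARField (π : Measure ℝ) (P : Measure Ω)
    (Λ : Set (ℝ × EuclideanSpace ℝ (Fin d)) → Ω → ℝ)
    (X : EuclideanSpace ℝ (Fin d) → Ω → ℝ) : Prop where
  measurable_uncurry : Measurable (Function.uncurry X)
  integral_eq : ∀ t, IsRajputRosinskiIntegral (π.prod volume) P Λ (supCARKernel t) (X t)

/-- The integrated field `X*(T) = ∫_{Δ(T)} X(y) dy`, where `Δ(T) = T • Δ`. -/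
def integratedField (X : EuclideanSpace ℝ (Fin d) → Ω → ℝ) (Δ : Set (EuclideanSpace ℝ (Fin d)))
    (T : ℝ) (ω : Ω) : ℝ :=
  ∫ y in T • Δ, X y ω

end SupCARField

/-! ### Lévy processes -/

/-- Real Lévy processes on `[0, ∞)`: null at zero, with independent and stationary increments and
continuous in probability. -/
structure IsLevyProcess {Ω : Type*} [MeasurableSpace Ω] (P : Measure Ω) (L : ℝ≥0 → Ω → ℝ) :
    Prop where
  measurable : ∀ t, Measurable (L t)
  zero : ∀ᵐ ω ∂P, L 0 ω = 0
  indep_increments : HasIndepIncrements L P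
  stationary_increments : ∀ s t : ℝ≥0,
    P.map (fun ω => L (s + t) ω - L s ω) = P.map (L t)
  continuous_in_probability : ∀ t : ℝ≥0, TendstoInMeasure P L (𝓝 t) (L t)

/-- The constant `c₇ = π^{d/2} Γ(d) |Δ|^{(d+1)/α} / (α^{(d+1)/α} Γ(d/2))`. -/
def c7 (d : ℕ) (α : ℝ) (Δ : Set (EuclideanSpace ℝ (Fin d))) : ℝ :=
  Real.pi ^ ((d : ℝ) / 2) * Real.Gamma d * (volume.real Δ) ^ (((d : ℝ) + 1) / α) /
    (α ^ (((d : ℝ) + 1) / α) * Real.Gamma ((d : ℝ) / 2))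

end SupCAR

end

open SupCAR

/-! The limit is read off from characteristic functions. Write `K` for `jumpCumulant W` and let `φ =
∑ θ i · 1` over the dilates `(t i)^(1/d) • closure Δ`. A linear combination of the integrated fields
is a stochastic integral of a deterministic function, so its cumulant is the integral of `K` of that
function against `π × Lebesgue`. After `u = T v`, the spatial integral of the kernel at `(r, T v)`
is `-(1/2) r^(-(d+1)) smoothing φ (r T) v`: one power of `r` comes from the prefactor, `d` powers
from the mass of the exponential. As `r T → ∞` the smoothing tends to `φ v * expMass d`.

Put `Q = (T l#(T))^(d/α)`; the norming is `c7 Q^(d+1)`. Replacing `r` by `r / Q` absorbs `Q^(d+1)`,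
while `T^d` from `du` and the mixing density combine to `l#(T)^(-d) l(Q/r) r^(α-1)`, which tends to
`r^(α-1)` by the defining property of the conjugate. Since `d < α`, `T / Q → ∞`, so the smoothing
disappears in the limit. What remains is `∫∫ r^(α-1) K(-c r^(-(d+1)) φ v) dr dv`. A power
substitution turns the `r`-integral into `∫ K(-y v) v^(-γ-1) dv`, a Gamma integral that is
homogeneous of degree `γ` in `y`: the stable exponent. The dilates are nested with volumes `t i
|Δ|`, so the remaining spatial integral is a sum over shells, and summation by parts identifies it
with the exponent of the Lévy process.

All limits are by dominated convergence, resting on the bounds of `K` by `|s|^p` and by `s^2` with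
`max(1, β) < p < γ < 2` (`norm_jumpCumulant_le`) and on Potter's bounds
(`tendsto_mul_integral_mixing`, `tendsto_integral_window_cumulant`).

The cumulant formula needs a stochastic Fubini theorem. A bound of `K` by `|s|^p` with `p > 1`
controls first moments through the characteristic function (`lintegral_enorm_le_of_charFun`), so the
integral extends to a continuous linear map from `L^p` to `L¹` and commutes with Bochner integrals
(`stochastic_fubini`). A Rajput–Rosinski integral is defined by an arbitrary approximating sequence
with only almost everywhere convergence; a gliding hump argument shows that it agrees with this map
(`ae_eq_stochasticIntegral`). -/

/-! ### Slow variation: uniform convergence and Potter bounds -/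

/-- The uniform convergence theorem for slowly varying functions, in additive form. -/
lemma uniform_of_tendsto_increment {h : ℝ → ℝ} (hm : Measurable h)
    (hh : ∀ u, Tendsto (fun x => h (x + u) - h x) atTop (𝓝 0)) {ε : ℝ} (hε : 0 < ε) :
    ∃ X : ℝ, ∀ x, X ≤ x → ∀ u ∈ Icc (0 : ℝ) 1, |h (x + u) - h x| ≤ ε := by
  by_contra! H
  choose x hx u hu hxu using fun n : ℕ => H n
  have hxt : Tendsto x atTop atTop := tendsto_atTop_mono hx tendsto_natCast_atTop_atTop
  have hyt : Tendsto (fun n => x n + u n) atTop atTop :=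
    tendsto_atTop_mono (fun n => le_add_of_nonneg_right (hu n).1) hxt
  have key : ∀ y : ℕ → ℝ, Tendsto y atTop atTop →
      ∀ᶠ n in atTop, 3 / 2 <
        volume {s ∈ Icc (0 : ℝ) 2 | ∀ m ≥ n, |h (y m + s) - h (y m)| < ε / 2} := by
    intro y hy
    have hmono : Monotone fun n : ℕ =>
        {s ∈ Icc (0 : ℝ) 2 | ∀ m ≥ n, |h (y m + s) - h (y m)| < ε / 2} :=
      fun a b hab s hs => ⟨hs.1, fun m hm => hs.2 m (le_trans hab hm)⟩
    have hU : ⋃ n : ℕ, {s ∈ Icc (0 : ℝ) 2 | ∀ m ≥ n, |h (y m + s) - h (y m)| < ε / 2}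
        = Icc 0 2 := by
      ext s
      simp only [mem_iUnion, mem_ofPred_eq, exists_and_left, and_iff_left_iff_imp]
      intro _
      have := ((hh s).comp hy).abs
      rw [abs_zero] at this
      exact eventually_atTop.1 (this.eventually (gt_mem_nhds (half_pos hε)))
    have ht := tendsto_measure_iUnion_atTop (μ := volume) hmono
    rw [hU, Real.volume_Icc] at ht
    refine ht.eventually (lt_mem_nhds ?_)
    rw [show (3 / 2 : ℝ≥0∞) = ENNReal.ofReal (3 / 2) by
      rw [ENNReal.ofReal_div_of_pos (by norm_num)]; norm_num]
    exact (ENNReal.ofReal_lt_ofReal_iff (by norm_num)).2 (by norm_num)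
  -- The set `V` and the translate of `W` by `u n` both lie in `[0, 3]` and have measure above
  -- `3/2`, so they must meet. At a common point the two `ε/2` estimates share the value `h (x n +
  -- s)` and contradict `ε < |h (x n + u n) - h (x n)|`.
  obtain ⟨n, hV, hW⟩ := ((key x hxt).and (key _ hyt)).exists
  set V := {s ∈ Icc (0 : ℝ) 2 | ∀ m ≥ n, |h (x m + s) - h (x m)| < ε / 2} with hVdef
  set W := {s ∈ Icc (0 : ℝ) 2 | ∀ m ≥ n, |h (x m + u m + s) - h (x m + u m)| < ε / 2} with hWdef
  have hWm : MeasurableSet W := by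
    have : W = Icc 0 2 ∩
        ⋂ m : ℕ, ⋂ (_ : m ≥ n), {s | |h (x m + u m + s) - h (x m + u m)| < ε / 2} := by
      ext s; simp [hWdef]
    rw [this]
    refine measurableSet_Icc.inter (MeasurableSet.iInter fun m => MeasurableSet.iInter fun _ => ?_)
    exact measurableSet_lt (by fun_prop) measurable_const
  have hdisj : Disjoint V ((fun s => s + -u n) ⁻¹' W) := by
    rw [Set.disjoint_left]
    rintro s hs1 hs2
    have h1 := hs1.2 n le_rfl
    have h2 := hs2.2 n le_rfl
    rw [show x n + u n + (s + -u n) = x n + s by ring] at h2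
    have := hxu n
    rw [abs_lt] at h1 h2
    rw [lt_abs] at this
    rcases this with h3 | h3 <;> linarith [h1.1, h1.2, h2.1, h2.2]
  have h3 : volume (V ∪ ((fun s => s + -u n) ⁻¹' W)) ≤ volume (Icc (0 : ℝ) 3) := by
    refine measure_mono (union_subset (fun s hs => ⟨hs.1.1, by linarith [hs.1.2]⟩) ?_)
    rintro s hs
    have := hs.1
    simp only [mem_Icc] at this
    constructor <;> linarith [(hu n).1, (hu n).2]
  rw [measure_union hdisj (hWm.preimage (by fun_prop)), measure_preimage_add_right,
    Real.volume_Icc] at h3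
  have h4 := ENNReal.add_lt_add hV hW
  have h5 := h4.trans_le h3
  rw [ENNReal.div_add_div_same, ENNReal.ofReal_sub _ le_rfl] at h5
  norm_num at h5
  rw [ENNReal.div_lt_iff (by simp) (by simp)] at h5
  norm_num at h5

/-- Telescoping over `⌊v⌋` unit steps and one fractional step. Applied to the logarithm of `l ∘
exp`, linear growth becomes the power in Potter's bounds. -/
lemma abs_increment_le {h : ℝ → ℝ} {X ε : ℝ}
    (hX : ∀ x, X ≤ x → ∀ u ∈ Icc (0 : ℝ) 1, |h (x + u) - h x| ≤ ε) {x v : ℝ}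
    (hx : X ≤ x) (hv : 0 ≤ v) : |h (x + v) - h x| ≤ ε * (v + 1) := by
  have hε : 0 ≤ ε := (abs_nonneg _).trans (hX x hx 0 (by simp))
  have main : ∀ n : ℕ, |h (x + n) - h x| ≤ n * ε := by
    intro n
    induction n with
    | zero => simp
    | succ n ih =>
      have := hX (x + n) (by linarith [(Nat.cast_nonneg n : (0 : ℝ) ≤ n)]) 1 (by simp)
      have h2 := abs_add_le (h (x + n + 1) - h (x + n)) (h (x + n) - h x)
      push_cast
      rw [show x + (n + 1 : ℝ) = x + n + 1 by ring,
        show h (x + n + 1) - h x = h (x + n + 1) - h (x + n) + (h (x + n) - h x) by ring]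
      linarith
  have h1 := main ⌊v⌋₊
  have h2 := hX (x + ⌊v⌋₊) (by linarith [(Nat.cast_nonneg ⌊v⌋₊ : (0 : ℝ) ≤ ⌊v⌋₊)]) (v - ⌊v⌋₊)
    ⟨by linarith [Nat.floor_le hv], by linarith [Nat.lt_floor_add_one v]⟩
  have h3 := abs_add_le (h (x + v) - h (x + ⌊v⌋₊)) (h (x + ⌊v⌋₊) - h x)
  rw [show x + (⌊v⌋₊ : ℝ) + (v - ⌊v⌋₊) = x + v by ring] at h2
  rw [show h (x + v) - h x = h (x + v) - h (x + ⌊v⌋₊) + (h (x + ⌊v⌋₊) - h x) by ring]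
  have h4 : (⌊v⌋₊ : ℝ) * ε ≤ v * ε := mul_le_mul_of_nonneg_right (Nat.floor_le hv) hε
  nlinarith

/-- Potter bounds. -/
lemma SupCAR.IsSlowlyVarying.potter {l : ℝ → ℝ} (hl : IsSlowlyVarying l) {δ : ℝ} (hδ : 0 < δ) :
    ∃ X : ℝ, 1 ≤ X ∧ (∀ x, X ≤ x → 0 < l x) ∧ ∀ x y, X ≤ x → x ≤ y →
      l y ≤ Real.exp δ * (y / x) ^ δ * l x ∧ l x ≤ Real.exp δ * (y / x) ^ δ * l y := by
  obtain ⟨X₀, hX₀⟩ := eventually_atTop.1 hl.eventually_pos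
  have hinc : ∀ u, Tendsto (fun x => Real.log (l (Real.exp (x + u))) - Real.log (l (Real.exp x)))
      atTop (𝓝 0) := by
    intro u
    have h1 := (hl.tendsto_ratio (Real.exp u) (Real.exp_pos u)).comp Real.tendsto_exp_atTop
    have h2 := h1.log one_ne_zero
    rw [Real.log_one] at h2
    refine h2.congr' ?_
    have hpos := Real.tendsto_exp_atTop.eventually hl.eventually_pos
    have hpos' := (Real.tendsto_exp_atTop.comp
      (tendsto_atTop_add_const_right _ u tendsto_id)).eventually
      hl.eventually_pos
    filter_upwards [hpos, hpos'] with x hx hx'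
    simp only [Function.comp_apply, id] at hx' ⊢
    rw [mul_comm, ← Real.exp_add, Real.log_div hx'.ne' hx.ne']
  obtain ⟨X₁, hX₁⟩ := uniform_of_tendsto_increment
    (h := fun x => Real.log (l (Real.exp x)))
    (Real.measurable_log.comp (hl.measurable.comp Real.measurable_exp)) hinc hδ
  refine ⟨max 1 (max X₀ (Real.exp X₁)), le_max_left _ _, fun x hx => hX₀ x ?_, fun x y hx hxy => ?_⟩
  · exact (le_max_left _ _).trans ((le_max_right _ _).trans hx)
  have hx1 : 1 ≤ x := (le_max_left _ _).trans hx
  have hx0 : 0 < x := by linarith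
  have hy0 : 0 < y := by linarith
  have hxX : X₀ ≤ x := (le_max_left _ _).trans ((le_max_right _ _).trans hx)
  have hlx := hX₀ x hxX
  have hly := hX₀ y (hxX.trans hxy)
  have hlog : X₁ ≤ Real.log x :=
    (Real.le_log_iff_exp_le hx0).2 ((le_max_right _ _).trans ((le_max_right _ _).trans hx))
  have hv : 0 ≤ Real.log y - Real.log x := sub_nonneg.2 (Real.log_le_log hx0 hxy)
  have hb := abs_increment_le (h := fun x => Real.log (l (Real.exp x))) hX₁ hlog hv
  simp only [add_sub_cancel, Real.exp_log hx0, Real.exp_log hy0] at hb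
  -- The factor `exp δ` accounts for the `+ 1` of the last, fractional step.
  have he : Real.exp δ * (y / x) ^ δ = Real.exp (δ * (Real.log y - Real.log x + 1)) := by
    rw [Real.rpow_def_of_pos (div_pos hy0 hx0), Real.log_div hy0.ne' hx0.ne', ← Real.exp_add]
    congr 1; ring
  rw [he]
  rw [abs_le] at hb
  constructor
  · calc l y = Real.exp (Real.log (l y)) := (Real.exp_log hly).symm
      _ ≤ Real.exp (δ * (Real.log y - Real.log x + 1) + Real.log (l x)) :=
        Real.exp_le_exp.2 (by linarith)
      _ = _ := by rw [Real.exp_add, Real.exp_log hlx]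
  · calc l x = Real.exp (Real.log (l x)) := (Real.exp_log hlx).symm
      _ ≤ Real.exp (δ * (Real.log y - Real.log x + 1) + Real.log (l y)) :=
        Real.exp_le_exp.2 (by linarith)
      _ = _ := by rw [Real.exp_add, Real.exp_log hly]

/-- Potter's bounds with the smaller argument frozen at the threshold `X`; the constants collect `l
X` and `X ^ δ`. -/
lemma SupCAR.IsSlowlyVarying.exists_le_rpow {l : ℝ → ℝ} (hl : IsSlowlyVarying l) {δ : ℝ}
    (hδ : 0 < δ) : ∃ X C : ℝ, 1 ≤ X ∧ 0 < C ∧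
      ∀ x, X ≤ x → 0 < l x ∧ l x ≤ C * x ^ δ ∧ C⁻¹ * x ^ (-δ) ≤ l x := by
  obtain ⟨X, hX1, hpos, hX⟩ := hl.potter hδ
  have hX0 : 0 < X := by linarith
  have hlX := hpos X le_rfl
  have hXδ : 0 < X ^ δ := Real.rpow_pos_of_pos hX0 _
  set A := Real.exp δ * l X / X ^ δ with hA
  set B := Real.exp δ / (X ^ δ * l X) with hB
  have hA0 : 0 < A := by positivity
  have hB0 : 0 < B := by positivity
  refine ⟨X, max A B, hX1, lt_max_of_lt_left hA0, fun x hx => ⟨hpos x hx, ?_, ?_⟩⟩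
  · have hx0 : 0 < x := by linarith
    have h1 := (hX X x le_rfl hx).1
    rw [Real.div_rpow hx0.le hX0.le] at h1
    calc l x ≤ A * x ^ δ := by rw [hA]; convert h1 using 1; field_simp
      _ ≤ _ := by gcongr; exact le_max_left _ _
  · have hx0 : 0 < x := by linarith
    have hxδ : 0 < x ^ δ := Real.rpow_pos_of_pos hx0 _
    have h1 := (hX X x le_rfl hx).2
    rw [Real.div_rpow hx0.le hX0.le] at h1
    rw [Real.rpow_neg hx0.le, ← mul_inv, inv_le_iff_one_le_mul₀ (by positivity)]
    have h2 : 1 ≤ B * x ^ δ * l x := by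
      rw [hB]
      have : 1 ≤ Real.exp δ * (x ^ δ / X ^ δ) * l x / l X := (one_le_div hlX).2 h1
      convert this using 1; field_simp
    refine h2.trans ?_
    rw [mul_comm (l x)]
    have := (hpos x hx).le
    gcongr
    exact le_max_right _ _

lemma SupCAR.IsSlowlyVarying.tendsto_rpow_mul_atTop {l : ℝ → ℝ} (hl : IsSlowlyVarying l) {ε : ℝ}
    (hε : 0 < ε) : Tendsto (fun x => x ^ ε * l x) atTop atTop := by
  obtain ⟨X, C, hX1, hC, h⟩ := hl.exists_le_rpow (half_pos hε)
  have h0 : Tendsto (fun x : ℝ => C⁻¹ * x ^ (ε / 2)) atTop atTop :=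
    (tendsto_rpow_atTop (half_pos hε)).const_mul_atTop (inv_pos.2 hC)
  refine tendsto_atTop_mono' _ ?_ h0
  filter_upwards [eventually_ge_atTop X] with x hx
  have hx0 : 0 < x := by linarith
  calc C⁻¹ * x ^ (ε / 2) = x ^ ε * (C⁻¹ * x ^ (-(ε / 2))) := by
        rw [show ε / 2 = ε + -(ε / 2) by ring, Real.rpow_add hx0]; ring_nf
    _ ≤ _ := by gcongr; exact (h x hx).2.2

lemma SupCAR.IsSlowlyVarying.tendsto_rpow_neg_mul {l : ℝ → ℝ} (hl : IsSlowlyVarying l) {ε : ℝ}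
    (hε : 0 < ε) : Tendsto (fun x => x ^ (-ε) * l x) atTop (𝓝 0) := by
  obtain ⟨X, C, hX1, hC, h⟩ := hl.exists_le_rpow (half_pos hε)
  have h0 : Tendsto (fun x : ℝ => C * x ^ (-(ε / 2))) atTop (𝓝 0) := by
    simpa using (tendsto_rpow_neg_atTop (half_pos hε)).const_mul C
  refine tendsto_of_tendsto_of_tendsto_of_le_of_le' tendsto_const_nhds h0 ?_ ?_
  · filter_upwards [eventually_ge_atTop X] with x hx
    have hx0 : 0 < x := by linarith
    have := (h x hx).1
    positivity
  · filter_upwards [eventually_ge_atTop X] with x hx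
    have hx0 : 0 < x := by linarith
    calc x ^ (-ε) * l x ≤ x ^ (-ε) * (C * x ^ (ε / 2)) := by gcongr; exact (h x hx).2.1
      _ = _ := by
        rw [show -(ε / 2) = -ε + ε / 2 by ring, Real.rpow_add hx0]; ring

/-! ### The cumulant function of the jumps -/

/-- For `‖w‖ ≤ 1` the remainder is quadratic and `‖w‖ ^ 2 ≤ ‖w‖ ^ p`; for larger `w` the exponential
is bounded by `1` and everything is at most `3 ‖w‖`. The freedom in `p` supplies different powers
for small and large arguments. -/
lemma norm_exp_sub_one_sub_le {w : ℂ} (hw : w.re ≤ 0) {p : ℝ} (h1 : 1 ≤ p) (h2 : p ≤ 2) :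
    ‖Complex.exp w - 1 - w‖ ≤ 3 * ‖w‖ ^ p := by
  by_cases h : ‖w‖ ≤ 1
  · have h3 : ‖w‖ ^ 2 ≤ ‖w‖ ^ p := by
      rw [← Real.rpow_two]
      rcases (norm_nonneg w).eq_or_lt with h0 | h0
      · rw [← h0, Real.zero_rpow (by norm_num), Real.zero_rpow (by linarith)]
      · exact Real.rpow_le_rpow_of_exponent_ge h0 h h2
    have h4 := Complex.norm_exp_sub_one_sub_id_le h
    have : 0 ≤ ‖w‖ ^ p := by positivity
    linarith
  · push Not at h
    have h3 : ‖w‖ ≤ ‖w‖ ^ p := by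
      simpa using Real.rpow_le_rpow_of_exponent_le h.le h1
    have h4 : ‖Complex.exp w‖ ≤ 1 := by rw [Complex.norm_exp]; exact Real.exp_le_one_iff.2 hw
    have h5 : ‖Complex.exp w - 1 - w‖ ≤ ‖Complex.exp w‖ + 1 + ‖w‖ := by
      refine (norm_sub_le _ _).trans ?_
      gcongr
      refine (norm_sub_le _ _).trans ?_
      simp
    linarith

lemma norm_exp_sub_one_le_of_re_nonpos {w : ℂ} (hw : w.re ≤ 0) : ‖Complex.exp w - 1‖ ≤ 4 * ‖w‖ := by
  have := norm_exp_sub_one_sub_le hw le_rfl one_le_two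
  rw [Real.rpow_one] at this
  have h2 := norm_add_le (Complex.exp w - 1 - w) w
  rw [sub_add_cancel] at h2
  linarith

lemma norm_jump_integrand_le (s x : ℝ) {p : ℝ} (h1 : 1 ≤ p) (h2 : p ≤ 2) :
    ‖Complex.exp (Complex.I * s * x) - 1 - Complex.I * s * x‖ ≤ 3 * (|s| ^ p * |x| ^ p) := by
  have h := norm_exp_sub_one_sub_le (w := Complex.I * s * x) (by simp) h1 h2
  simpa [Real.mul_rpow] using h

section JumpCumulant

variable {W : Measure ℝ}

lemma integrable_jump_integrand {p : ℝ} (h1 : 1 ≤ p) (h2 : p ≤ 2)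
    (hp : Integrable (fun x : ℝ => |x| ^ p) W) (s : ℝ) :
    Integrable (fun x : ℝ => Complex.exp (Complex.I * s * x) - 1 - Complex.I * s * x) W :=
  ((hp.const_mul (|s| ^ p)).const_mul 3).mono' (by fun_prop)
    (ae_of_all _ fun x => norm_jump_integrand_le s x h1 h2)

lemma norm_jumpCumulant_le {p : ℝ} (h1 : 1 ≤ p) (h2 : p ≤ 2)
    (hp : Integrable (fun x : ℝ => |x| ^ p) W) (s : ℝ) :
    ‖jumpCumulant W s‖ ≤ 3 * (∫ x, |x| ^ p ∂W) * |s| ^ p := by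
  refine (norm_integral_le_of_norm_le ((hp.const_mul (|s| ^ p)).const_mul 3)
    (ae_of_all _ fun x => norm_jump_integrand_le s x h1 h2)).trans_eq ?_
  rw [integral_const_mul, integral_const_mul]; ring

lemma jumpCumulant_zero : jumpCumulant W 0 = 0 := by simp [jumpCumulant]

lemma re_jumpCumulant_nonpos {p : ℝ} (h1 : 1 ≤ p) (h2 : p ≤ 2)
    (hp : Integrable (fun x : ℝ => |x| ^ p) W) (s : ℝ) : (jumpCumulant W s).re ≤ 0 := by
  have h := integral_re (𝕜 := ℂ) (integrable_jump_integrand h1 h2 hp s)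
  have e : (jumpCumulant W s).re = RCLike.re (jumpCumulant W s) := rfl
  rw [e, jumpCumulant, ← h]
  refine integral_nonpos fun x => ?_
  have : Complex.exp (Complex.I * s * x) = Complex.exp ((s * x : ℝ) * Complex.I) := by
    push_cast; ring_nf
  simp [this, Complex.exp_ofReal_mul_I_re, Real.cos_le_one, -Complex.ofReal_mul]

lemma continuous_jumpCumulant {p : ℝ} (h1 : 1 ≤ p) (h2 : p ≤ 2)
    (hp : Integrable (fun x : ℝ => |x| ^ p) W) : Continuous (jumpCumulant W) := by
  refine continuous_iff_continuousAt.2 fun s => ?_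
  refine continuousAt_of_dominated (bound := fun x => 3 * ((|s| + 1) ^ p * |x| ^ p))
    (Eventually.of_forall fun s => by fun_prop) ?_ ((hp.const_mul _).const_mul 3)
    (ae_of_all _ fun x => by fun_prop)
  filter_upwards [Metric.ball_mem_nhds s one_pos] with r hr
  refine ae_of_all _ fun x => (norm_jump_integrand_le r x h1 h2).trans ?_
  have : |r| ≤ |s| + 1 := by
    rw [Metric.mem_ball, Real.dist_eq] at hr
    have := abs_sub_abs_le_abs_sub r s
    linarith
  gcongr

/-- Near zero `|x| ^ p` is below `|x| ^ q` for an admissible exponent `q < p`; away from zero it is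
below `x ^ 2`. -/
lemma integrable_rpow_of_blumenthalGetoorIndex_lt {p : ℝ}
    (hW₂ : ∫⁻ x, ENNReal.ofReal (x ^ 2) ∂W < ∞) (h0 : 0 < blumenthalGetoorIndex W)
    (hp : blumenthalGetoorIndex W < p) (h2 : p ≤ 2) : Integrable (fun x : ℝ => |x| ^ p) W := by
  have hne : {γ : ℝ | 0 ≤ γ ∧
      ∫⁻ x in {x : ℝ | |x| ≤ 1}, ENNReal.ofReal (|x| ^ γ) ∂W < ∞}.Nonempty := by
    -- The infimum of the empty set is `0` by convention, so a positive index forces the set of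
    -- exponents to be nonempty.
    by_contra h
    rw [not_nonempty_iff_eq_empty] at h
    rw [blumenthalGetoorIndex, h, Real.sInf_empty] at h0
    exact lt_irrefl _ h0
  obtain ⟨q, ⟨hq0, hq⟩, hqp⟩ := exists_lt_of_csInf_lt hne hp
  have hp0 : 0 < p := hq0.trans_lt hqp
  have hm : Measurable fun x : ℝ => |x| ^ p := by fun_prop
  refine ⟨hm.aestronglyMeasurable, ?_⟩
  rw [hasFiniteIntegral_iff_ofReal (ae_of_all _ fun x => by positivity)]
  have hS : MeasurableSet {x : ℝ | |x| ≤ 1} := measurableSet_le (by fun_prop) measurable_const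
  rw [← lintegral_add_compl _ hS]
  refine ENNReal.add_lt_top.2 ⟨lt_of_le_of_lt ?_ hq, lt_of_le_of_lt ?_ hW₂⟩
  · refine setLIntegral_mono (by fun_prop) fun x hx => ENNReal.ofReal_le_ofReal ?_
    rcases (abs_nonneg x).eq_or_lt with h | h
    · rw [← h, Real.zero_rpow hp0.ne']; positivity
    · exact Real.rpow_le_rpow_of_exponent_ge h hx hqp.le
  · refine (setLIntegral_mono (g := fun x => ENNReal.ofReal (x ^ 2)) (by fun_prop)
      fun x hx => ENNReal.ofReal_le_ofReal ?_).trans (setLIntegral_le_lintegral _ _)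
    rw [← sq_abs, ← Real.rpow_two]
    simp only [mem_compl_iff, mem_ofPred_eq, not_le] at hx
    exact Real.rpow_le_rpow_of_exponent_le hx.le h2

/-- Without an atom at zero, `W` has the finite density `x ^ (-2)` with respect to the finite
measure `x ^ 2 dW`. This makes Fubini available for `W`. -/
lemma sigmaFinite_of_lintegral_sq_lt_top (h0 : W {0} = 0)
    (hW₂ : ∫⁻ x, ENNReal.ofReal (x ^ 2) ∂W < ∞) : SigmaFinite W := by
  have hf : Measurable fun x : ℝ => ENNReal.ofReal (x ^ 2) := by fun_prop
  have : IsFiniteMeasure (W.withDensity fun x => ENNReal.ofReal (x ^ 2)) :=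
    isFiniteMeasure_withDensity hW₂.ne
  have hne : ∀ᵐ x ∂W, ENNReal.ofReal (x ^ 2) ≠ 0 := by
    have : ∀ᵐ x ∂W, x ≠ 0 := by
      rw [ae_iff]; simpa using h0
    filter_upwards [this] with x hx
    rw [ne_eq, ENNReal.ofReal_eq_zero, not_le]; positivity
  have hmain := withDensity_inv_same hf hne (ae_of_all _ fun x => ENNReal.ofReal_ne_top)
  rw [← hmain]
  refine SigmaFinite.withDensity_of_ne_top ?_
  refine (withDensity_absolutelyContinuous W _).ae_le ?_
  filter_upwards [hne] with x hx
  simpa using hx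

end JumpCumulant

/-! ### An oscillatory Gamma integral -/

lemma integrableOn_Ioi_of_le_rpow {E : Type*} [NormedAddCommGroup E] {F : ℝ → E} {a b A B : ℝ}
    (hF : AEStronglyMeasurable F (volume.restrict (Ioi 0))) (ha : -1 < a) (hb : b < -1)
    (hA : ∀ v, 0 < v → ‖F v‖ ≤ A * v ^ a) (hB : ∀ v, 0 < v → ‖F v‖ ≤ B * v ^ b) :
    IntegrableOn F (Ioi 0) := by
  rw [← Ioc_union_Ioi_eq_Ioi zero_le_one] at hF ⊢
  rw [integrableOn_union]
  constructor
  · have h : IntegrableOn (fun v : ℝ => A * v ^ a) (Ioc 0 1) :=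
      (intervalIntegral.intervalIntegrable_rpow' (a := 0) (b := 1) ha).1.const_mul _
    exact Integrable.mono' h (hF.mono_measure (Measure.restrict_mono subset_union_left le_rfl))
      ((ae_restrict_iff' measurableSet_Ioc).2 (ae_of_all _ fun v hv => hA v hv.1))
  · have h : IntegrableOn (fun v : ℝ => B * v ^ b) (Ioi 1) :=
      (integrableOn_Ioi_rpow_of_lt hb one_pos).const_mul _
    exact Integrable.mono' h (hF.mono_measure (Measure.restrict_mono subset_union_right le_rfl))
      ((ae_restrict_iff' measurableSet_Ioi).2
        (ae_of_all _ fun v hv => hB v (one_pos.trans hv)))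

section GammaIntegral

variable {γ : ℝ}

lemma norm_exp_remainder_mul_rpow_le {z : ℂ} (hz : 0 ≤ z.re) {p v : ℝ} (h1 : 1 ≤ p) (h2 : p ≤ 2)
    (hv : 0 < v) (b : ℝ) :
    ‖(Complex.exp (-z * v) - 1 - -z * v) * ((v ^ b : ℝ) : ℂ)‖ ≤ 3 * ‖z‖ ^ p * v ^ (b + p) := by
  have h := norm_exp_sub_one_sub_le (w := -z * v)
    (by simpa using mul_nonneg hz hv.le) h1 h2
  rw [norm_mul, norm_neg, Complex.norm_real, Real.norm_of_nonneg hv.le,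
    Real.mul_rpow (norm_nonneg _) hv.le] at h
  rw [norm_mul, Complex.norm_real, Real.norm_of_nonneg (by positivity), add_comm b p,
    Real.rpow_add hv]
  calc _ ≤ 3 * (‖z‖ ^ p * v ^ p) * v ^ b := by gcongr
    _ = _ := by ring

lemma continuousOn_ofReal_rpow (b : ℝ) : ContinuousOn (fun v : ℝ => ((v ^ b : ℝ) : ℂ)) (Ioi 0) :=
  Complex.continuous_ofReal.comp_continuousOn fun v hv =>
    (Real.continuousAt_rpow_const v b (Or.inl (ne_of_gt hv))).continuousWithinAt

lemma integrableOn_exp_remainder_mul_rpow (h1 : 1 < γ) (h2 : γ < 2) {z : ℂ} (hz : 0 ≤ z.re) :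
    IntegrableOn (fun v : ℝ => (Complex.exp (-z * v) - 1 - -z * v) * ((v ^ (-γ - 1) : ℝ) : ℂ))
      (Ioi 0) :=
  integrableOn_Ioi_of_le_rpow (a := -γ - 1 + 2) (b := -γ - 1 + 1)
    ((ContinuousOn.mul (by fun_prop) (continuousOn_ofReal_rpow _)).aestronglyMeasurable
      measurableSet_Ioi) (by linarith) (by linarith)
    (fun v hv => norm_exp_remainder_mul_rpow_le hz one_le_two le_rfl hv _)
    (fun v hv => norm_exp_remainder_mul_rpow_le hz le_rfl one_le_two hv _)

lemma hasDerivAt_ofReal_rpow {b v : ℝ} (hv : 0 < v) :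
    HasDerivAt (fun v : ℝ => ((v ^ b : ℝ) : ℂ)) (((b * v ^ (b - 1) : ℝ)) : ℂ) v :=
  (Real.hasDerivAt_rpow_const (Or.inl hv.ne')).ofReal_comp

lemma hasDerivAt_exp_neg_mul (z : ℂ) (v : ℝ) :
    HasDerivAt (fun v : ℝ => Complex.exp (-z * v)) (Complex.exp (-z * v) * -z) v := by
  have h : HasDerivAt (fun v : ℝ => -z * (v : ℂ)) (-z) v := by
    simpa using (Complex.ofRealCLM.hasDerivAt (x := v)).const_mul (-z)
  exact h.cexp

lemma norm_one_sub_exp_mul_rpow_le {z : ℂ} (hz : 0 ≤ z.re) {v : ℝ} (hv : 0 < v) (b : ℝ) :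
    ‖(Complex.exp (-z * v) - 1) * ((v ^ b : ℝ) : ℂ)‖ ≤ 4 * ‖z‖ * v ^ (b + 1) ∧
    ‖(Complex.exp (-z * v) - 1) * ((v ^ b : ℝ) : ℂ)‖ ≤ 2 * v ^ b := by
  have hre : (-z * v).re ≤ 0 := by simpa using mul_nonneg hz hv.le
  have h := norm_exp_sub_one_le_of_re_nonpos hre
  have h' : ‖Complex.exp (-z * v) - 1‖ ≤ 2 := by
    refine (norm_sub_le _ _).trans ?_
    rw [Complex.norm_exp, norm_one]
    linarith [Real.exp_le_one_iff.2 hre]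
  rw [norm_mul, norm_neg, Complex.norm_real, Real.norm_of_nonneg hv.le] at h
  rw [norm_mul, Complex.norm_real, Real.norm_of_nonneg (by positivity), Real.rpow_add hv,
    Real.rpow_one]
  constructor
  · calc _ ≤ 4 * (‖z‖ * v) * v ^ b := by gcongr
      _ = _ := by ring
  · gcongr

lemma tendsto_zero_of_le_rpow {l : Filter ℝ} {F : ℝ → ℂ} {A a : ℝ} (hl : ∀ᶠ v in l, 0 < v)
    (ha : Tendsto (fun v : ℝ => v ^ a) l (𝓝 0)) (hA : ∀ v, 0 < v → ‖F v‖ ≤ A * v ^ a) :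
    Tendsto F l (𝓝 0) :=
  squeeze_zero_norm' (hl.mono fun v hv => hA v hv) (by simpa using ha.const_mul A)

lemma tendsto_rpow_nhdsGT_zero {a : ℝ} (ha : 0 < a) :
    Tendsto (fun v : ℝ => v ^ a) (𝓝[>] 0) (𝓝 0) := by
  have := (Real.continuousAt_rpow_const 0 a (Or.inr ha.le)).tendsto
  rw [Real.zero_rpow ha.ne'] at this
  exact this.mono_left nhdsWithin_le_nhds

lemma tendsto_rpow_atTop_zero {a : ℝ} (ha : a < 0) :
    Tendsto (fun v : ℝ => v ^ a) atTop (𝓝 0) := by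
  simpa using tendsto_rpow_neg_atTop (neg_pos.2 ha)

/-- On the ball of radius `z.re / 2` around `z` the differentiated integrand is dominated by `v ^ (b
+ 1) exp (-(z.re / 2) v)`. Holomorphy is what the identity theorem needs to leave the real axis. -/
lemma differentiableAt_integral_rpow_mul_exp {b : ℝ} (hb : -1 < b) {z : ℂ} (hz : 0 < z.re) :
    DifferentiableAt ℂ
      (fun z : ℂ => ∫ v in Ioi (0 : ℝ), ((v ^ b : ℝ) : ℂ) * Complex.exp (-z * v)) z := by
  have hI : ∀ c : ℝ, -1 < c → ∀ r : ℝ, 0 < r →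
      IntegrableOn (fun v : ℝ => v ^ c * Real.exp (-r * v)) (Ioi 0) := fun c hc r hr => by
    simpa using integrableOn_rpow_mul_exp_neg_mul_rpow (p := 1) hc one_pos hr
  have hnorm : ∀ c : ℝ, ∀ w : ℂ, ∀ v : ℝ, 0 < v → ‖((v ^ c : ℝ) : ℂ) * Complex.exp (-w * v)‖ =
      v ^ c * Real.exp (-w.re * v) := by
    intro c w v hv
    rw [norm_mul, Complex.norm_real, Real.norm_of_nonneg (by positivity), Complex.norm_exp]
    simp
  have hm : ∀ c : ℝ, ∀ w : ℂ, AEStronglyMeasurable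
      (fun v : ℝ => ((v ^ c : ℝ) : ℂ) * Complex.exp (-w * v)) (volume.restrict (Ioi 0)) :=
    fun c w => ((continuousOn_ofReal_rpow c).mul (by fun_prop)).aestronglyMeasurable
      measurableSet_Ioi
  refine (hasDerivAt_integral_of_dominated_loc_of_deriv_le
    (F' := fun w v => -(((v ^ (b + 1) : ℝ) : ℂ) * Complex.exp (-w * v)))
    (bound := fun v => v ^ (b + 1) * Real.exp (-(z.re / 2) * v))
    (Metric.ball_mem_nhds z (half_pos hz)) (Eventually.of_forall fun w => hm b w) ?_
    (hm _ z).neg ?_ (hI _ (by linarith) _ (half_pos hz)) ?_).2.differentiableAt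
  · refine (hI b hb z.re hz).mono' (hm b z) ?_
    exact (ae_restrict_iff' measurableSet_Ioi).2 (ae_of_all _ fun v hv => (hnorm b z v hv).le)
  · refine (ae_restrict_iff' measurableSet_Ioi).2 (ae_of_all _ fun v hv w hw => ?_)
    have hv0 : 0 < v := hv
    rw [norm_neg, hnorm _ _ _ hv]
    have h1 : z.re / 2 ≤ w.re := by
      have h2 := (Complex.abs_re_le_norm (w - z)).trans_lt (mem_ball_iff_norm.1 hw)
      rw [Complex.sub_re, abs_lt] at h2
      linarith [h2.1]
    gcongr
  · refine (ae_restrict_iff' measurableSet_Ioi).2 (ae_of_all _ fun v hv w _ => ?_)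
    have hv0 : 0 < v := hv
    have h1 : HasDerivAt (fun w : ℂ => -w * (v : ℂ)) (-(v : ℂ)) w := by
      simpa using ((hasDerivAt_id w).neg.mul_const (v : ℂ))
    convert! h1.cexp.const_mul ((v ^ b : ℝ) : ℂ) using 1
    rw [Real.rpow_add hv0, Real.rpow_one]; push_cast; ring

/-- Both sides are analytic on the right half-plane and agree on the positive reals, in particular
along `1 + 1/(n+1) → 1`, so the identity theorem applies. -/
lemma integral_rpow_mul_exp {b : ℝ} (hb : -1 < b) {z : ℂ} (hz : 0 < z.re) :
    ∫ v in Ioi (0 : ℝ), ((v ^ b : ℝ) : ℂ) * Complex.exp (-z * v) =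
      z ^ (-(b + 1) : ℂ) * Complex.Gamma (b + 1) := by
  have hopen : IsOpen {z : ℂ | 0 < z.re} := isOpen_lt continuous_const Complex.continuous_re
  have h1 : AnalyticOnNhd ℂ
      (fun z : ℂ => ∫ v in Ioi (0 : ℝ), ((v ^ b : ℝ) : ℂ) * Complex.exp (-z * v))
      {z : ℂ | 0 < z.re} :=
    DifferentiableOn.analyticOnNhd (fun w hw =>
      (differentiableAt_integral_rpow_mul_exp hb hw).differentiableWithinAt) hopen
  have h2 : AnalyticOnNhd ℂ (fun z : ℂ => z ^ (-(b + 1) : ℂ) * Complex.Gamma (b + 1))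
      {z : ℂ | 0 < z.re} :=
    DifferentiableOn.analyticOnNhd (fun w hw =>
      ((differentiableAt_id.cpow_const (Or.inl hw)).mul_const _).differentiableWithinAt) hopen
  have hconn : IsPreconnected {z : ℂ | 0 < z.re} :=
    (convex_halfSpace_re_gt 0).isPreconnected
  refine h1.eqOn_of_preconnected_of_frequently_eq h2 hconn (z₀ := 1) (by simp) ?_ hz
  have hreal : ∀ x : ℝ, 0 < x → ∫ v in Ioi (0 : ℝ), ((v ^ b : ℝ) : ℂ) * Complex.exp (-(x : ℂ) * v) =
      (x : ℂ) ^ (-(b + 1) : ℂ) * Complex.Gamma (b + 1) := by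
    intro x hx
    have h := Complex.integral_cpow_mul_exp_neg_mul_Ioi (a := b + 1) (r := x)
      (by simp; linarith) hx
    rw [one_div, Complex.inv_cpow, ← Complex.cpow_neg] at h
    · rw [← h]
      refine setIntegral_congr_fun measurableSet_Ioi fun v hv => ?_
      rw [Complex.ofReal_cpow (le_of_lt hv)]
      simp
    · rw [Complex.arg_ofReal_of_nonneg hx.le]; exact Real.pi_pos.ne
  have ht : Tendsto (fun n : ℕ => ((1 + 1 / ((n : ℝ) + 1) : ℝ) : ℂ)) atTop (𝓝[≠] 1) := by
    refine tendsto_nhdsWithin_iff.2 ⟨?_, Eventually.of_forall fun n => ?_⟩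
    · have := (tendsto_one_div_add_atTop_nhds_zero_nat (𝕜 := ℝ)).const_add 1
      rw [add_zero] at this
      exact (Complex.continuous_ofReal.tendsto 1).comp this
    · have : (0 : ℝ) < 1 / ((n : ℝ) + 1) := by positivity
      simp only [mem_compl_iff, mem_singleton_iff]
      exact_mod_cast (by linarith : (1 + 1 / ((n : ℝ) + 1) : ℝ) ≠ 1)
  refine ht.frequently (Frequently.of_forall fun n => hreal _ (by positivity))

/-- Integration by parts against `v ^ (1 - γ) / (1 - γ)` leaves the Gamma integral with exponent `1
- γ > -1`. The boundary terms vanish because `1 < γ < 2`. -/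
lemma integral_one_sub_exp_mul_rpow (h1 : 1 < γ) (h2 : γ < 2) {z : ℂ} (hz : 0 < z.re) :
    ∫ v in Ioi (0 : ℝ), (Complex.exp (-z * v) - 1) * ((v ^ (-γ) : ℝ) : ℂ) =
      -(z / (γ - 1)) * (z ^ (γ - 2 : ℂ) * Complex.Gamma (2 - γ)) := by
  have hγ : (γ : ℂ) - 1 ≠ 0 := by
    rw [sub_ne_zero]; exact_mod_cast h1.ne'
  have hG := integral_rpow_mul_exp (b := 1 - γ) (by linarith) hz
  rw [show (-(((1 - γ : ℝ) : ℂ) + 1) : ℂ) = γ - 2 by push_cast; ring,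
    show (((1 - γ : ℝ) : ℂ) + 1 : ℂ) = 2 - γ by push_cast; ring] at hG
  have hI := integral_Ioi_mul_deriv_eq_deriv_mul (a := 0) (a' := (0 : ℂ)) (b' := (0 : ℂ))
    (u := fun v : ℝ => Complex.exp (-z * v) - 1) (u' := fun v : ℝ => Complex.exp (-z * v) * -z)
    (v := fun v : ℝ => ((v ^ (1 - γ) : ℝ) : ℂ) / (1 - γ))
    (v' := fun v : ℝ => ((v ^ (-γ) : ℝ) : ℂ))
    (fun v _ => (hasDerivAt_exp_neg_mul z v).sub_const 1)
    (fun v hv => by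
      convert! (hasDerivAt_ofReal_rpow (b := 1 - γ) hv).div_const (1 - γ : ℂ) using 1
      have : (1 : ℂ) - γ ≠ 0 := by rw [← neg_sub]; exact neg_ne_zero.2 hγ
      rw [show 1 - γ - 1 = -γ by ring]; push_cast; field_simp) ?_ ?_ ?_ ?_
  · rw [hI, sub_zero, zero_sub, ← hG, ← integral_const_mul, ← integral_neg]
    refine setIntegral_congr_fun measurableSet_Ioi fun v hv => ?_
    have : (1 : ℂ) - γ ≠ 0 := by rw [← neg_sub]; exact neg_ne_zero.2 hγ
    rw [show (γ : ℂ) - 1 = -(1 - γ) by ring]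
    field_simp
  · exact integrableOn_Ioi_of_le_rpow (a := -γ + 1) (b := -γ)
      ((ContinuousOn.mul (by fun_prop) (continuousOn_ofReal_rpow _)).aestronglyMeasurable
        measurableSet_Ioi) (by linarith) (by linarith)
      (fun v hv => (norm_one_sub_exp_mul_rpow_le hz.le hv _).1)
      (fun v hv => (norm_one_sub_exp_mul_rpow_le hz.le hv _).2)
  -- A non-integrable function has integral `0` by convention, so the nonzero value just computed
  -- already proves integrability.
  · have hne : ∫ v in Ioi (0 : ℝ), ((v ^ (1 - γ) : ℝ) : ℂ) * Complex.exp (-z * v) ≠ 0 := by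
      rw [hG]
      refine mul_ne_zero ?_ (Complex.Gamma_ne_zero_of_re_pos (by simpa using h2))
      rw [Complex.cpow_def_of_ne_zero (fun h => by simp [h] at hz)]
      exact Complex.exp_ne_zero _
    have hint : IntegrableOn (fun v : ℝ => ((v ^ (1 - γ) : ℝ) : ℂ) * Complex.exp (-z * v))
        (Ioi 0) := by
      by_contra h
      exact hne (integral_undef h)
    refine (hint.const_mul (-z / (1 - γ))).congr ?_
    refine (ae_restrict_iff' measurableSet_Ioi).2 (ae_of_all _ fun v hv => ?_)
    simp only [Pi.mul_apply]
    ring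
  · refine tendsto_zero_of_le_rpow (A := 4 * ‖z‖ / ‖(1 - γ : ℂ)‖) (a := 1 - γ + 1)
      self_mem_nhdsWithin (tendsto_rpow_nhdsGT_zero (by linarith)) fun v hv => ?_
    have := (norm_one_sub_exp_mul_rpow_le hz.le hv (1 - γ)).1
    rw [Pi.mul_apply, ← mul_div_assoc, norm_div]
    calc _ ≤ 4 * ‖z‖ * v ^ (1 - γ + 1) / ‖(1 - γ : ℂ)‖ := by gcongr
      _ = _ := by ring
  · refine tendsto_zero_of_le_rpow (A := 2 / ‖(1 - γ : ℂ)‖) (a := 1 - γ)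
      (eventually_gt_atTop 0) (tendsto_rpow_atTop_zero (by linarith)) fun v hv => ?_
    have := (norm_one_sub_exp_mul_rpow_le hz.le hv (1 - γ)).2
    rw [Pi.mul_apply, ← mul_div_assoc, norm_div]
    calc _ ≤ 2 * v ^ (1 - γ) / ‖(1 - γ : ℂ)‖ := by gcongr
      _ = _ := by ring

/-- A further integration by parts lowers the order of the Taylor remainder by one and raises `v ^
(-γ - 1)` to `v ^ (-γ)`. -/
lemma integral_exp_remainder_mul_rpow_of_re_pos (h1 : 1 < γ) (h2 : γ < 2) {z : ℂ} (hz : 0 < z.re) :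
    ∫ v in Ioi (0 : ℝ), (Complex.exp (-z * v) - 1 - -z * v) * ((v ^ (-γ - 1) : ℝ) : ℂ) =
      Complex.Gamma (2 - γ) / (γ * (γ - 1)) * z ^ (γ : ℂ) := by
  have hγ0 : (γ : ℂ) ≠ 0 := by exact_mod_cast (by linarith : γ ≠ 0)
  have hγ : (γ : ℂ) - 1 ≠ 0 := by
    rw [sub_ne_zero]; exact_mod_cast h1.ne'
  have hz0 : z ≠ 0 := fun h => by simp [h] at hz
  have hI := integral_Ioi_mul_deriv_eq_deriv_mul (a := 0) (a' := (0 : ℂ)) (b' := (0 : ℂ))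
    (u := fun v : ℝ => Complex.exp (-z * v) - 1 - -z * v)
    (u' := fun v : ℝ => (Complex.exp (-z * v) - 1) * -z)
    (v := fun v : ℝ => ((v ^ (-γ) : ℝ) : ℂ) / (-γ))
    (v' := fun v : ℝ => ((v ^ (-γ - 1) : ℝ) : ℂ))
    (fun v _ => by
      have h : HasDerivAt (fun v : ℝ => -z * (v : ℂ)) (-z) v := by
        simpa using (Complex.ofRealCLM.hasDerivAt (x := v)).const_mul (-z)
      convert! ((hasDerivAt_exp_neg_mul z v).sub_const 1).sub h using 1
      ring)
    (fun v hv => by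
      convert! (hasDerivAt_ofReal_rpow (b := -γ) hv).div_const (-γ : ℂ) using 1
      push_cast; field_simp)
    (integrableOn_exp_remainder_mul_rpow h1 h2 hz.le) ?_ ?_ ?_
  · rw [hI, sub_zero, zero_sub]
    have e : ∀ v : ℝ, (Complex.exp (-z * v) - 1) * -z * (((v ^ (-γ) : ℝ) : ℂ) / (-γ)) =
        z / γ * ((Complex.exp (-z * v) - 1) * ((v ^ (-γ) : ℝ) : ℂ)) := by
      intro v; field_simp
    simp_rw [e]
    rw [integral_const_mul, integral_one_sub_exp_mul_rpow h1 h2 hz, Complex.cpow_sub _ _ hz0]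
    have : z ^ (2 : ℂ) = z ^ 2 := by exact_mod_cast Complex.cpow_natCast z 2
    rw [this]
    field_simp
  · have : IntegrableOn (fun v : ℝ => (Complex.exp (-z * v) - 1) * ((v ^ (-γ) : ℝ) : ℂ)) (Ioi 0) :=
      integrableOn_Ioi_of_le_rpow (a := -γ + 1) (b := -γ)
      ((ContinuousOn.mul (by fun_prop) (continuousOn_ofReal_rpow _)).aestronglyMeasurable
        measurableSet_Ioi) (by linarith) (by linarith)
      (fun v hv => (norm_one_sub_exp_mul_rpow_le hz.le hv _).1)
      (fun v hv => (norm_one_sub_exp_mul_rpow_le hz.le hv _).2)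
    refine (this.const_mul (-z / -γ)).congr (ae_of_all _ fun v => ?_)
    simp only [Pi.mul_apply]
    ring
  · refine tendsto_zero_of_le_rpow (A := 3 * ‖z‖ ^ (2 : ℝ) / ‖(-γ : ℂ)‖) (a := -γ + 2)
      self_mem_nhdsWithin (tendsto_rpow_nhdsGT_zero (by linarith)) fun v hv => ?_
    have := norm_exp_remainder_mul_rpow_le hz.le one_le_two le_rfl hv (-γ)
    rw [Pi.mul_apply, ← mul_div_assoc, norm_div]
    calc _ ≤ 3 * ‖z‖ ^ (2 : ℝ) * v ^ (-γ + 2) / ‖(-γ : ℂ)‖ := by gcongr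
      _ = _ := by ring
  · refine tendsto_zero_of_le_rpow (A := 3 * ‖z‖ ^ (1 : ℝ) / ‖(-γ : ℂ)‖) (a := -γ + 1)
      (eventually_gt_atTop 0) (tendsto_rpow_atTop_zero (by linarith)) fun v hv => ?_
    have := norm_exp_remainder_mul_rpow_le hz.le le_rfl one_le_two hv (-γ)
    rw [Pi.mul_apply, ← mul_div_assoc, norm_div]
    calc _ ≤ 3 * ‖z‖ ^ (1 : ℝ) * v ^ (-γ + 1) / ‖(-γ : ℂ)‖ := by gcongr
      _ = _ := by ring

/-- The imaginary axis is reached as the limit of `z + ε`, `ε ↓ 0`. The minimum of two powers of `v`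
dominates uniformly for `ε < 1`, and the right side is continuous on the slit plane. -/
lemma integral_exp_remainder_mul_rpow (h1 : 1 < γ) (h2 : γ < 2) {z : ℂ} (hz : 0 ≤ z.re)
    (hz0 : z ∈ Complex.slitPlane) :
    ∫ v in Ioi (0 : ℝ), (Complex.exp (-z * v) - 1 - -z * v) * ((v ^ (-γ - 1) : ℝ) : ℂ) =
      Complex.Gamma (2 - γ) / (γ * (γ - 1)) * z ^ (γ : ℂ) := by
  have hzt : Tendsto (fun ε : ℝ => z + ε) (𝓝[>] 0) (𝓝 z) := by
    have : ContinuousAt (fun ε : ℝ => z + ε) 0 := by fun_prop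
    simpa using this.tendsto.mono_left nhdsWithin_le_nhds
  have hR : Tendsto (fun ε : ℝ => Complex.Gamma (2 - γ) / (γ * (γ - 1)) * (z + ε) ^ (γ : ℂ))
      (𝓝[>] 0) (𝓝 (Complex.Gamma (2 - γ) / (γ * (γ - 1)) * z ^ (γ : ℂ))) :=
    ((continuousAt_cpow_const hz0).tendsto.comp hzt).const_mul _
  refine tendsto_nhds_unique ?_ (hR.congr' ?_)
    (f := fun ε : ℝ => ∫ v in Ioi (0 : ℝ),
      (Complex.exp (-(z + ε) * v) - 1 - -(z + ε) * v) * ((v ^ (-γ - 1) : ℝ) : ℂ))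
    (l := 𝓝[>] 0)
  · set M : ℝ := ‖z‖ + 1
    have hM : 0 ≤ M := by positivity
    refine tendsto_integral_filter_of_dominated_convergence
      (fun v => min (3 * M ^ (2 : ℝ) * v ^ (-γ - 1 + 2)) (3 * M ^ (1 : ℝ) * v ^ (-γ - 1 + 1)))
      ?_ ?_ ?_ ?_
    · exact Eventually.of_forall fun ε =>
        (ContinuousOn.mul (by fun_prop) (continuousOn_ofReal_rpow _)).aestronglyMeasurable
        measurableSet_Ioi
    · filter_upwards [self_mem_nhdsWithin, nhdsWithin_le_nhds (Iio_mem_nhds (one_pos : (0:ℝ) < 1))]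
        with ε hε hε1
      have hε0 : 0 < ε := hε
      have hre : 0 ≤ (z + ε).re := by simpa using add_nonneg hz hε0.le
      have hn : ‖z + ε‖ ≤ M := by
        refine (norm_add_le _ _).trans ?_
        rw [Complex.norm_real, Real.norm_of_nonneg hε0.le]
        have : ε < 1 := hε1
        simp only [M]; linarith
      refine (ae_restrict_iff' measurableSet_Ioi).2 (ae_of_all _ fun v hv => le_min ?_ ?_)
      · refine (norm_exp_remainder_mul_rpow_le hre one_le_two le_rfl hv _).trans ?_
        have hv0 : 0 < v := hv
        gcongr
      · refine (norm_exp_remainder_mul_rpow_le hre le_rfl one_le_two hv _).trans ?_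
        have hv0 : 0 < v := hv
        gcongr
    · refine integrableOn_Ioi_of_le_rpow (a := -γ - 1 + 2) (b := -γ - 1 + 1)
        (A := 3 * M ^ (2 : ℝ)) (B := 3 * M ^ (1 : ℝ)) (by fun_prop)
        (by linarith) (by linarith) (fun v hv => ?_) (fun v hv => ?_)
      · rw [Real.norm_of_nonneg (by positivity)]; exact min_le_left _ _
      · rw [Real.norm_of_nonneg (by positivity)]; exact min_le_right _ _
    · refine ae_of_all _ fun v => Tendsto.mul_const _ ?_
      have : Continuous fun w : ℂ => Complex.exp (-w * v) - 1 - -w * v := by fun_prop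
      exact (this.tendsto z).comp hzt
  · filter_upwards [self_mem_nhdsWithin] with ε hε
    have hε0 : 0 < ε := hε
    exact (integral_exp_remainder_mul_rpow_of_re_pos h1 h2
      (by simpa using add_pos_of_nonneg_of_pos hz hε0)).symm

/-- The scale function of the `γ`-stable cumulant. -/
lemma integral_exp_I_remainder_mul_rpow (h1 : 1 < γ) (h2 : γ < 2) (y : ℝ) :
    ∫ v in Ioi (0 : ℝ), (Complex.exp (Complex.I * y * v) - 1 - Complex.I * y * v) *
        ((v ^ (-γ - 1) : ℝ) : ℂ) =
      ((Real.Gamma (2 - γ) / (γ * (γ - 1)) * |y| ^ γ : ℝ) : ℂ) *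
        ((Real.cos (Real.pi * γ / 2) : ℝ) -
          Complex.I * ((Real.sign y * Real.sin (Real.pi * γ / 2) : ℝ) : ℂ)) := by
  have hγ0 : γ ≠ 0 := by linarith
  -- The argument of `-(I * y)` is `-(π / 2) sign y`, so its principal `γ`-th power has angle `-(π γ
  -- / 2) sign y`.
  have key : ∀ y : ℝ, y ≠ 0 → (-(Complex.I * y)) ^ (γ : ℂ) = ((|y| ^ γ : ℝ) : ℂ) *
      ((Real.cos (Real.pi * γ / 2) : ℝ) -
          Complex.I * ((Real.sign y * Real.sin (Real.pi * γ / 2) : ℝ) : ℂ)) := by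
    intro y hy
    have h0 : -(Complex.I * y) = (|y| : ℝ) * (-(Complex.I * Real.sign y)) := by
      rcases hy.lt_or_gt with h | h
      · rw [Real.sign_of_neg h, abs_of_neg h]; push_cast; ring
      · rw [Real.sign_of_pos h, abs_of_pos h]; push_cast; ring
    have hlog : Complex.log (-(Complex.I * Real.sign y)) =
        -(Real.pi / 2 * Real.sign y) * Complex.I := by
      rcases hy.lt_or_gt with h | h
      · rw [Real.sign_of_neg h]; simp [Complex.log_I]
      · rw [Real.sign_of_pos h]; simp [Complex.log_neg_I]
    have hne : -(Complex.I * (Real.sign y : ℂ)) ≠ 0 := by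
      simpa using hy
    have habs : 0 < |y| := abs_pos.2 hy
    rw [Complex.cpow_def_of_ne_zero (neg_ne_zero.2 (mul_ne_zero Complex.I_ne_zero
      (by exact_mod_cast hy))),
      h0, Complex.log_ofReal_mul habs hne, hlog, add_mul, Complex.exp_add]
    congr 1
    · rw [Real.rpow_def_of_pos habs]; push_cast; ring_nf
    · have : -(Real.pi / 2 * Real.sign y : ℂ) * Complex.I * γ =
          ((-(Real.sign y * (Real.pi * γ / 2)) : ℝ) : ℂ) * Complex.I := by push_cast; ring
      rw [this, Complex.exp_mul_I, ← Complex.ofReal_cos, ← Complex.ofReal_sin]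
      rcases hy.lt_or_gt with h | h
      · rw [Real.sign_of_neg h]; simp; ring
      · rw [Real.sign_of_pos h]; simp; ring
  rcases eq_or_ne y 0 with rfl | hy
  · simp [Real.zero_rpow hγ0]
  · have := integral_exp_remainder_mul_rpow h1 h2 (z := -(Complex.I * y)) (by simp)
      (Or.inr (by simpa using hy))
    rw [key y hy] at this
    simp only [neg_neg] at this
    rw [this, ← mul_assoc]
    congr 1
    rw [show (2 - γ : ℂ) = ((2 - γ : ℝ) : ℂ) by push_cast; ring, Complex.Gamma_ofReal]
    push_cast; ring

end GammaIntegral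

/-! ### A moment bound from the characteristic function -/

/-- For `|s z| ≤ π`, `1 - cos (s z) ≥ (2 / π²) (s z)²`, so the integrand is at least `z² / π` on an
interval of length `π / |z|`. The factor `π / 2` makes the product exactly `|z|`. -/
lemma enorm_le_lintegral_one_sub_cos (z : ℝ) :
    ‖z‖ₑ ≤ ∫⁻ s in Ioi (0 : ℝ),
      ENNReal.ofReal (Real.pi / 2 / s ^ 2) * ENNReal.ofReal (1 - Real.cos (s * z)) := by
  rcases eq_or_ne z 0 with rfl | hz
  · simp
  have hz' : 0 < |z| := abs_pos.2 hz
  have hle : ∀ s ∈ Ioc (0 : ℝ) (Real.pi / |z|), ENNReal.ofReal (z ^ 2 / Real.pi) ≤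
      ENNReal.ofReal (Real.pi / 2 / s ^ 2) * ENNReal.ofReal (1 - Real.cos (s * z)) := by
    intro s hs
    have hs0 : 0 < s := hs.1
    rw [← ENNReal.ofReal_mul (by positivity)]
    refine ENNReal.ofReal_le_ofReal ?_
    have h1 : |s * z| ≤ Real.pi := by
      rw [abs_mul, abs_of_pos hs0]; exact (le_div_iff₀ hz').1 hs.2
    have h2 := Real.cos_le_one_sub_mul_cos_sq h1
    calc z ^ 2 / Real.pi = Real.pi / 2 / s ^ 2 * (2 / Real.pi ^ 2 * (s * z) ^ 2) := by
          field_simp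
      _ ≤ _ := by gcongr; linarith
  calc ‖z‖ₑ = ENNReal.ofReal (z ^ 2 / Real.pi) * volume (Ioc (0 : ℝ) (Real.pi / |z|)) := by
        rw [Real.volume_Ioc, ← ENNReal.ofReal_mul (by positivity), Real.enorm_eq_ofReal_abs]
        congr 1
        rw [sub_zero, ← sq_abs z]; field_simp
    _ = ∫⁻ s in Ioc (0 : ℝ) (Real.pi / |z|), ENNReal.ofReal (z ^ 2 / Real.pi) := by
        rw [setLIntegral_const]
    _ ≤ ∫⁻ s in Ioc (0 : ℝ) (Real.pi / |z|),
        ENNReal.ofReal (Real.pi / 2 / s ^ 2) * ENNReal.ofReal (1 - Real.cos (s * z)) :=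
        setLIntegral_mono' measurableSet_Ioc hle
    _ ≤ _ := lintegral_mono_set Ioc_subset_Ioi_self

lemma norm_one_sub_exp_le {w : ℂ} (hw : w.re ≤ 0) : ‖1 - Complex.exp w‖ ≤ min 2 (4 * ‖w‖) := by
  rw [norm_sub_rev]
  refine le_min ?_ (norm_exp_sub_one_le_of_re_nonpos hw)
  refine (norm_sub_le _ _).trans ?_
  rw [Complex.norm_exp, norm_one]
  linarith [Real.exp_le_one_iff.2 hw]

/-- Split at `s = 1 / N`: below it the power term leaves `s ^ (p - 2)`, integrable because `p > 1`;
above it the constant leaves `s ^ (-2)`. Both pieces scale linearly in `N`, which later yields a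
genuine operator norm bound. -/
lemma lintegral_min_rpow_le {p C N : ℝ} (hp : 1 < p) (hC : 0 ≤ C) (hN : 0 ≤ N) :
    ∫⁻ s in Ioi (0 : ℝ), ENNReal.ofReal (Real.pi / 2 / s ^ 2) *
      ENNReal.ofReal (min 2 (4 * (C * s ^ p * N ^ p))) ≤
      ENNReal.ofReal (Real.pi * (2 * C / (p - 1) + 1) * N) := by
  rcases hN.eq_or_lt with rfl | hN
  · simp [Real.zero_rpow (by linarith : p ≠ 0)]
  have hN' : 0 < N⁻¹ := inv_pos.2 hN
  have hp1 : 0 < p - 1 := by linarith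
  rw [← Ioc_union_Ioi_eq_Ioi hN'.le, lintegral_union measurableSet_Ioi (Ioc_disjoint_Ioi le_rfl)]
  have h1 : ∫⁻ s in Ioc 0 N⁻¹, ENNReal.ofReal (Real.pi / 2 / s ^ 2) *
      ENNReal.ofReal (min 2 (4 * (C * s ^ p * N ^ p))) ≤
      ENNReal.ofReal (Real.pi * (2 * C / (p - 1)) * N) := by
    calc _ ≤ ∫⁻ s in Ioc 0 N⁻¹, ENNReal.ofReal (2 * Real.pi * C * N ^ p * s ^ (p - 2)) := by
          refine setLIntegral_mono' measurableSet_Ioc fun s hs => ?_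
          have hs0 : 0 < s := hs.1
          rw [← ENNReal.ofReal_mul (by positivity)]
          refine ENNReal.ofReal_le_ofReal ?_
          calc _ ≤ Real.pi / 2 / s ^ 2 * (4 * (C * s ^ p * N ^ p)) := by
                gcongr; exact min_le_right _ _
            _ = _ := by
              rw [Real.rpow_sub hs0, Real.rpow_two]; field_simp; ring
      _ = ENNReal.ofReal (∫ s in Ioc 0 N⁻¹, 2 * Real.pi * C * N ^ p * s ^ (p - 2)) := by
          rw [ofReal_integral_eq_lintegral_ofReal]
          · exact (intervalIntegral.intervalIntegrable_rpow' (a := 0) (b := N⁻¹)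
              (r := p - 2) (by linarith)).1.const_mul _
          · refine (ae_restrict_iff' measurableSet_Ioc).2 (ae_of_all _ fun s hs => ?_)
            have hs0 : 0 < s := hs.1
            simp only [Pi.zero_apply]
            positivity
      _ = _ := by
          congr 1
          rw [integral_const_mul, ← intervalIntegral.integral_of_le hN'.le,
            integral_rpow (Or.inl (by linarith)), show p - 2 + 1 = p - 1 by ring,
            Real.zero_rpow hp1.ne', Real.inv_rpow hN.le, Real.rpow_sub hN, Real.rpow_one]
          have : N ^ p ≠ 0 := (Real.rpow_pos_of_pos hN p).ne'
          field_simp; ring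
  have h2 : ∫⁻ s in Ioi N⁻¹, ENNReal.ofReal (Real.pi / 2 / s ^ 2) *
      ENNReal.ofReal (min 2 (4 * (C * s ^ p * N ^ p))) ≤ ENNReal.ofReal (Real.pi * N) := by
    calc _ ≤ ∫⁻ s in Ioi N⁻¹, ENNReal.ofReal (Real.pi * s ^ (-2 : ℝ)) := by
          refine setLIntegral_mono' measurableSet_Ioi fun s hs => ?_
          have hs0 : 0 < s := hN'.trans hs
          rw [← ENNReal.ofReal_mul (by positivity)]
          refine ENNReal.ofReal_le_ofReal ?_
          calc _ ≤ Real.pi / 2 / s ^ 2 * 2 := by gcongr; exact min_le_left _ _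
            _ = _ := by rw [Real.rpow_neg hs0.le, Real.rpow_two]; field_simp
      _ = ENNReal.ofReal (∫ s in Ioi N⁻¹, Real.pi * s ^ (-2 : ℝ)) := by
          rw [ofReal_integral_eq_lintegral_ofReal]
          · exact (integrableOn_Ioi_rpow_of_lt (by norm_num) hN').const_mul _
          · refine (ae_restrict_iff' measurableSet_Ioi).2 (ae_of_all _ fun s hs => ?_)
            have hs0 : 0 < s := hN'.trans hs
            simp only [Pi.zero_apply]
            positivity
      _ = _ := by
          congr 1
          rw [integral_const_mul, integral_Ioi_rpow_of_lt (by norm_num) hN']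
          norm_num
          rw [Real.rpow_neg_one, inv_inv]
  refine (add_le_add h1 h2).trans_eq ?_
  rw [← ENNReal.ofReal_add (by positivity) (by positivity)]
  congr 1; ring

/-- A bound on the cumulant function near zero controls the first moment. -/
lemma lintegral_enorm_le_of_charFun {Ω : Type*} [MeasurableSpace Ω] {P : Measure Ω}
    [IsProbabilityMeasure P] {Z : Ω → ℝ} (hZ : AEMeasurable Z P) {ψ : ℝ → ℂ}
    {p C N : ℝ} (hp : 1 < p)
    (hC : 0 ≤ C) (hN : 0 ≤ N)
    (hφ : ∀ s, charFun (P.map Z) s = Complex.exp (ψ s)) (hre : ∀ s, (ψ s).re ≤ 0)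
    (hψ : ∀ s, ‖ψ s‖ ≤ C * |s| ^ p * N ^ p) :
    ∫⁻ ω, ‖Z ω‖ₑ ∂P ≤ ENNReal.ofReal (Real.pi * (2 * C / (p - 1) + 1) * N) := by
  have hcos : ∀ s, ∫⁻ ω, ENNReal.ofReal (1 - Real.cos (s * Z ω)) ∂P ≤
      ENNReal.ofReal (min 2 (4 * (C * |s| ^ p * N ^ p))) := by
    intro s
    have hi : Integrable (fun ω => Real.cos (s * Z ω)) P :=
      Integrable.of_bound (by fun_prop) 1 (ae_of_all _ fun ω => Real.abs_cos_le_one _)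
    have hi1 : Integrable (fun ω => 1 - Real.cos (s * Z ω)) P := (integrable_const 1).sub hi
    rw [← ofReal_integral_eq_lintegral_ofReal hi1
      (ae_of_all _ fun ω => by simp [Real.cos_le_one])]
    refine ENNReal.ofReal_le_ofReal ?_
    have h1 : ∫ ω, (1 - Real.cos (s * Z ω)) ∂P = (1 - charFun (P.map Z) s).re := by
      rw [integral_sub (integrable_const 1) hi, charFun_apply_real,
        integral_map hZ (by fun_prop)]
      have hi' : Integrable (fun ω => Complex.exp (s * Z ω * Complex.I)) P :=
        Integrable.of_bound (by fun_prop) 1 (ae_of_all _ fun ω => by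
          rw [← Complex.ofReal_mul, Complex.norm_exp_ofReal_mul_I])
      have h2 := integral_re (𝕜 := ℂ) hi'
      have h3 : (∫ ω, Complex.exp (s * Z ω * Complex.I) ∂P).re = ∫ ω, Real.cos (s * Z ω) ∂P := by
        refine Eq.trans h2.symm (integral_congr_ae (ae_of_all _ fun ω => ?_))
        simp only
        rw [← Complex.ofReal_mul]
        exact Complex.exp_ofReal_mul_I_re _
      simp [h3]
    rw [h1, hφ]
    refine (Complex.re_le_norm _).trans ((norm_one_sub_exp_le (hre s)).trans ?_)
    gcongr
    exact hψ s
  calc ∫⁻ ω, ‖Z ω‖ₑ ∂P ≤ ∫⁻ ω, (∫⁻ s in Ioi (0 : ℝ), ENNReal.ofReal (Real.pi / 2 / s ^ 2) *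
        ENNReal.ofReal (1 - Real.cos (s * Z ω))) ∂P :=
        lintegral_mono fun ω => enorm_le_lintegral_one_sub_cos _
    _ = ∫⁻ s in Ioi (0 : ℝ), ∫⁻ ω, ENNReal.ofReal (Real.pi / 2 / s ^ 2) *
        ENNReal.ofReal (1 - Real.cos (s * Z ω)) ∂P := by
        refine lintegral_lintegral_swap ?_
        have h1 : AEMeasurable (fun x : Ω × ℝ => Z x.1) (P.prod (volume.restrict (Ioi 0))) :=
          hZ.comp_fst
        simp only [Function.uncurry_def]
        fun_prop
    _ = ∫⁻ s in Ioi (0 : ℝ), ENNReal.ofReal (Real.pi / 2 / s ^ 2) *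
        ∫⁻ ω, ENNReal.ofReal (1 - Real.cos (s * Z ω)) ∂P := by
        congr with s
        rw [lintegral_const_mul' _ _ ENNReal.ofReal_ne_top]
    _ ≤ ∫⁻ s in Ioi (0 : ℝ), ENNReal.ofReal (Real.pi / 2 / s ^ 2) *
        ENNReal.ofReal (min 2 (4 * (C * s ^ p * N ^ p))) := by
        refine setLIntegral_mono' measurableSet_Ioi fun s hs => ?_
        have := hcos s
        rw [abs_of_pos hs] at this
        gcongr
    _ ≤ _ := lintegral_min_rpow_le hp hC hN

/-! ### Random measures: null sets, additivity, joint law -/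

section RandomMeasure

variable {α Ω : Type*} [MeasurableSpace α] [MeasurableSpace Ω] {μ : Measure α} {P : Measure Ω}
  {K : ℝ → ℂ} {Λ : Set α → Ω → ℝ}

lemma isAdmissible_empty : IsAdmissible μ ∅ := ⟨MeasurableSet.empty, by simp⟩

namespace SupCAR.IsScatteredRandomMeasure

/-- The index set is encoded into `ℕ`, and unused indices receive the empty set, which is admissible
and disjoint from everything. -/
lemma iIndepFun_of_countable (hΛ : IsScatteredRandomMeasure μ P K Λ) {ι : Type*} [Countable ι]
    {A : ι → Set α}
    (hA : ∀ i, IsAdmissible μ (A i)) (hd : Pairwise (Function.onFun Disjoint A)) :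
    iIndepFun (fun i => Λ (A i)) P := by
  have := Encodable.ofCountable ι
  let S : ℕ → Set α := fun n => match Encodable.decode₂ ι n with
    | some i => A i
    | none => ∅
  have hSe : ∀ i, S (Encodable.encode i) = A i := by
    intro i; simp [S]
  have hS : ∀ n, IsAdmissible μ (S n) := by
    intro n; simp only [S]; split
    · exact hA _
    · exact isAdmissible_empty
  have hSd : Pairwise (Function.onFun Disjoint S) := by
    intro m n hmn
    simp only [Function.onFun, S]
    split <;> [split; simp]
    · rename_i i hi _ j hj
      refine hd fun hij => hmn ?_
      rw [Encodable.decode₂_eq_some] at hi hj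
      rw [← hi, ← hj, hij]
    · simp
  have h := (hΛ.indep S hS hSd).precomp (Encodable.encode_injective (α := ι))
  simpa [Function.comp_def, hSe] using h

lemma charFun_sum (hΛ : IsScatteredRandomMeasure μ P K Λ) {ι : Type*} [Fintype ι]
    {A : ι → Set α} (c : ι → ℝ)
    (hA : ∀ i, IsAdmissible μ (A i)) (hd : Pairwise (Function.onFun Disjoint A)) (s : ℝ) :
    charFun (P.map fun ω => ∑ i, c i * Λ (A i) ω) s =
      Complex.exp (∑ i, (μ.real (A i) : ℂ) * K (c i * s)) := by
  have hind := hΛ.iIndepFun_of_countable hA hd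
  have hind2 : iIndepFun (fun i ω => c i * Λ (A i) ω) P :=
    hind.comp (fun i x => c i * x) fun i => by fun_prop
  have h := hind2.charFun_map_fun_sum_eq_prod
    (fun i => ((hΛ.measurable _ (hA i)).const_mul (c i)).aemeasurable)
  rw [h, Finset.prod_apply, Complex.exp_sum]
  refine Finset.prod_congr rfl fun i _ => ?_
  rw [charFun_map_mul_comp (hΛ.measurable _ (hA i)).aemeasurable, hΛ.charFun_eq _ (hA i)]

variable [IsProbabilityMeasure P]

/-- The characteristic function is identically `1`, so the law is the point mass at zero. -/
lemma ae_eq_zero_of_null (hΛ : IsScatteredRandomMeasure μ P K Λ) {A : Set α}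
    (hA : MeasurableSet A) (h0 : μ A = 0) :
    ∀ᵐ ω ∂P, Λ A ω = 0 := by
  have hadm : IsAdmissible μ A := ⟨hA, by simp [h0]⟩
  have hm := hΛ.measurable A hadm
  have := Measure.isProbabilityMeasure_map hm.aemeasurable (μ := P)
  have hd : P.map (Λ A) = Measure.dirac 0 := by
    refine Measure.ext_of_charFun (funext fun s => ?_)
    rw [hΛ.charFun_eq A hadm, charFun_dirac]
    simp [measureReal_def, h0]
  have h1 : ∀ᵐ x ∂(P.map (Λ A)), x = 0 := by rw [hd]; simp [ae_dirac_eq]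
  exact ae_of_ae_map hm.aemeasurable h1

/-- Countable additivity for the sequence `A, B, ∅, ∅, …`, whose partial sums are constant from the
second term on since the empty set has value zero almost surely. -/
lemma ae_union (hΛ : IsScatteredRandomMeasure μ P K Λ) {A B : Set α} (hA : IsAdmissible μ A)
    (hB : IsAdmissible μ B) (hAB : Disjoint A B) :
    ∀ᵐ ω ∂P, Λ (A ∪ B) ω = Λ A ω + Λ B ω := by
  let S : ℕ → Set α := fun n => if n = 0 then A else if n = 1 then B else ∅
  have hS : ∀ n, IsAdmissible μ (S n) := by
    intro n; simp only [S]; split_ifs <;> [exact hA; exact hB; exact isAdmissible_empty]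
  have hd : Pairwise (Function.onFun Disjoint S) := by
    intro i j hij
    simp only [Function.onFun, S]
    split_ifs <;> simp_all [disjoint_comm]
  have hU : ⋃ n, S n = A ∪ B := by
    apply Subset.antisymm
    · refine iUnion_subset fun n => ?_
      simp only [S]; split_ifs <;> simp
    · refine union_subset ?_ ?_
      · exact (subset_iUnion S 0)
      · exact (subset_iUnion S 1)
  have hUA : IsAdmissible μ (⋃ n, S n) := by
    rw [hU]
    exact ⟨hA.1.union hB.1, (measure_union_le _ _).trans_lt (ENNReal.add_lt_top.2 ⟨hA.2, hB.2⟩)⟩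
  have h := hΛ.countably_additive S hS hd hUA
  rw [hU] at h
  filter_upwards [h, hΛ.ae_eq_zero_of_null MeasurableSet.empty measure_empty] with ω h1 h2
  refine tendsto_nhds_unique h1 (tendsto_const_nhds.congr' ?_)
  filter_upwards [eventually_ge_atTop 2] with N hN
  rw [← Finset.sum_range_add_sum_Ico _ hN, Finset.sum_range_succ, Finset.sum_range_one,
    Finset.sum_eq_zero (s := Finset.Ico 2 N), add_zero]
  · simp [S]
  · intro n hn
    have := (Finset.mem_Ico.1 hn).1
    simp only [S]
    rw [if_neg (by omega), if_neg (by omega), h2]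

end SupCAR.IsScatteredRandomMeasure

end RandomMeasure

/-! ### The stochastic integral on `L^q` -/

/-- `K` is continuous, has non-positive real part and is bounded by a multiple of `|s| ^ q`,
where `1 < q`. -/
structure IsCumulantOfOrder (K : ℝ → ℂ) (q : ℝ≥0∞) (C : ℝ) : Prop where
  one_lt : 1 < q.toReal
  nonneg : 0 ≤ C
  continuous : Continuous K
  re_nonpos : ∀ s, (K s).re ≤ 0
  norm_le : ∀ s, ‖K s‖ ≤ C * |s| ^ q.toReal

namespace IsCumulantOfOrder

variable {α : Type*} [MeasurableSpace α] {μ : Measure α} {K : ℝ → ℂ} {q : ℝ≥0∞} {C : ℝ}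

lemma pos (hK : IsCumulantOfOrder K q C) : 0 < q.toReal := one_pos.trans hK.one_lt

lemma ne_zero (hK : IsCumulantOfOrder K q C) : q ≠ 0 := fun h => by
  have := hK.pos; simp [h] at this

lemma ne_top (hK : IsCumulantOfOrder K q C) : q ≠ ∞ := fun h => by
  have := hK.pos; simp [h] at this

lemma map_zero (hK : IsCumulantOfOrder K q C) : K 0 = 0 := by
  have := hK.norm_le 0
  rw [abs_zero, Real.zero_rpow hK.pos.ne', mul_zero] at this
  exact norm_le_zero_iff.1 this

lemma norm_mul_le (hK : IsCumulantOfOrder K q C) (s x : ℝ) :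
    ‖K (s * x)‖ ≤ C * |s| ^ q.toReal * ‖x‖ ^ q.toReal := by
  refine (hK.norm_le _).trans_eq ?_
  rw [abs_mul, Real.mul_rpow (abs_nonneg _) (abs_nonneg _), Real.norm_eq_abs, mul_assoc]

lemma integrable (hK : IsCumulantOfOrder K q C) {f : α → ℝ} (hf : MemLp f q μ) (s : ℝ) :
    Integrable (fun x => K (s * f x)) μ :=
  ((hf.integrable_norm_rpow hK.ne_zero hK.ne_top).const_mul (C * |s| ^ q.toReal)).mono'
    (hK.continuous.comp_aestronglyMeasurable (hf.1.const_mul s))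
    (ae_of_all _ fun _ => hK.norm_mul_le _ _)

lemma re_integral_nonpos (hK : IsCumulantOfOrder K q C) {f : α → ℝ} (hf : MemLp f q μ) (s : ℝ) :
    (∫ x, K (s * f x) ∂μ).re ≤ 0 := by
  have h := integral_re (𝕜 := ℂ) (hK.integrable hf s)
  refine (Eq.trans_le h.symm (integral_nonpos fun x => hK.re_nonpos _))

lemma norm_integral_le (hK : IsCumulantOfOrder K q C) {f : α → ℝ} (hf : MemLp f q μ) (s : ℝ) :
    ‖∫ x, K (s * f x) ∂μ‖ ≤ C * |s| ^ q.toReal * (eLpNorm f q μ).toReal ^ q.toReal := by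
  refine (norm_integral_le_of_norm_le
    ((hf.integrable_norm_rpow hK.ne_zero hK.ne_top).const_mul (C * |s| ^ q.toReal))
    (ae_of_all _ fun _ => hK.norm_mul_le _ _)).trans_eq ?_
  have h0 : 0 ≤ ∫ x, ‖f x‖ ^ q.toReal ∂μ := integral_nonneg fun x => by positivity
  rw [integral_const_mul, hf.eLpNorm_eq_integral_rpow_norm hK.ne_zero hK.ne_top,
    ENNReal.toReal_ofReal (by positivity), Real.rpow_inv_rpow h0 hK.pos.ne']

end IsCumulantOfOrder

open Classical in
/-- The values of the random measure as a vector measure in `L¹`. -/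
noncomputable def vectorValue {α Ω : Type*} [MeasurableSpace Ω] (Λ : Set α → Ω → ℝ)
    (P : Measure Ω) (A : Set α) : ℝ →L[ℝ] Lp ℝ 1 P :=
  if h : MemLp (Λ A) 1 P then ContinuousLinearMap.toSpanSingleton ℝ (h.toLp (Λ A)) else 0

lemma vectorValue_apply {α Ω : Type*} [MeasurableSpace Ω] {Λ : Set α → Ω → ℝ} {P : Measure Ω}
    {A : Set α} (h : MemLp (Λ A) 1 P) (x : ℝ) :
    vectorValue Λ P A x = x • h.toLp (Λ A) := by
  simp [vectorValue, h]

section Integral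

variable {α Ω : Type*} [MeasurableSpace α] [MeasurableSpace Ω] {μ : Measure α} {P : Measure Ω}
  [IsProbabilityMeasure P] {K : ℝ → ℂ} {Λ : Set α → Ω → ℝ} {q : ℝ≥0∞} {C : ℝ}

namespace SupCAR.IsScatteredRandomMeasure

lemma memLp_one (hΛ : IsScatteredRandomMeasure μ P K Λ) (hK : IsCumulantOfOrder K q C)
    {A : Set α} (hA : IsAdmissible μ A) : MemLp (Λ A) 1 P := by
  have hm := hΛ.measurable A hA
  refine memLp_one_iff_integrable.2 ⟨hm.aestronglyMeasurable, ?_⟩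
  refine (lintegral_enorm_le_of_charFun hm.aemeasurable (ψ := fun s => (μ.real A : ℂ) * K s)
    (C := μ.real A * C) (N := 1) hK.one_lt (mul_nonneg measureReal_nonneg hK.nonneg) zero_le_one
    (hΛ.charFun_eq A hA) (fun s => ?_) fun s => ?_).trans_lt ENNReal.ofReal_lt_top
  · simpa using mul_nonpos_of_nonneg_of_nonpos measureReal_nonneg (hK.re_nonpos s)
  · rw [norm_mul, Complex.norm_real, Real.norm_of_nonneg measureReal_nonneg, Real.one_rpow, mul_one,
      mul_assoc]
    exact mul_le_mul_of_nonneg_left (hK.norm_le s) measureReal_nonneg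

lemma finMeasAdditive (hΛ : IsScatteredRandomMeasure μ P K Λ) (hK : IsCumulantOfOrder K q C) :
    FinMeasAdditive μ (vectorValue Λ P) := by
  intro A B hA hB hμA hμB hAB
  have hA' : IsAdmissible μ A := ⟨hA, hμA.lt_top⟩
  have hB' : IsAdmissible μ B := ⟨hB, hμB.lt_top⟩
  have hU : IsAdmissible μ (A ∪ B) := ⟨hA.union hB,
    (measure_union_le _ _).trans_lt (ENNReal.add_lt_top.2 ⟨hA'.2, hB'.2⟩)⟩
  ext1
  rw [add_apply, vectorValue_apply (hΛ.memLp_one hK hU),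
    vectorValue_apply (hΛ.memLp_one hK hA'), vectorValue_apply (hΛ.memLp_one hK hB'), ← smul_add,
    ← MemLp.toLp_add]
  congr 1
  refine MemLp.toLp_congr _ _ ?_
  filter_upwards [hΛ.ae_union hA' hB' hAB] with ω h using h

lemma vectorValue_null (hΛ : IsScatteredRandomMeasure μ P K Λ) (hK : IsCumulantOfOrder K q C)
    {A : Set α} (hA : MeasurableSet A) (h0 : μ A = 0) : vectorValue Λ P A = 0 := by
  have hA' : IsAdmissible μ A := ⟨hA, by simp [h0]⟩
  ext1
  rw [vectorValue_apply (hΛ.memLp_one hK hA')]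
  have : (hΛ.memLp_one hK hA').toLp (Λ A) = 0 := by
    rw [← Lp.toLp_coeFn (0 : Lp ℝ 1 P) (Lp.memLp _)]
    refine MemLp.toLp_congr _ _ ?_
    refine EventuallyEq.trans ?_ (Lp.coeFn_zero ℝ 1 P).symm
    filter_upwards [hΛ.ae_eq_zero_of_null hA h0] with ω h using h
  simp [this]

lemma isAdmissible_fiber {f : SimpleFunc α ℝ} (hf : Integrable f μ) {x : ℝ} (hx : x ≠ 0) :
    IsAdmissible μ (f ⁻¹' {x}) :=
  ⟨f.measurableSet_fiber x, SimpleFunc.integrable_iff.1 hf x hx⟩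

lemma setToSimpleFunc_ae_eq (hΛ : IsScatteredRandomMeasure μ P K Λ)
    (hK : IsCumulantOfOrder K q C) {f : SimpleFunc α ℝ} (hf : Integrable f μ) :
    (f.setToSimpleFunc (vectorValue Λ P) : Lp ℝ 1 P) =ᵐ[P]
      fun ω => ∑ x : {x // x ∈ f.range.filter (· ≠ 0)}, (x : ℝ) * Λ (f ⁻¹' {(x : ℝ)}) ω := by
  rw [SimpleFunc.setToSimpleFunc_eq_sum_filter, ← Finset.sum_coe_sort]
  refine (Lp.coeFn_finsetSum _ _).trans ?_
  have : ∀ x : {x // x ∈ f.range.filter (· ≠ 0)}, vectorValue Λ P (f ⁻¹' {(x : ℝ)}) x =ᵐ[P]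
      fun ω => (x : ℝ) * Λ (f ⁻¹' {(x : ℝ)}) ω := by
    intro x
    have hx := isAdmissible_fiber hf (Finset.mem_filter.1 x.2).2
    rw [vectorValue_apply (hΛ.memLp_one hK hx)]
    filter_upwards [Lp.coeFn_smul (x : ℝ) ((hΛ.memLp_one hK hx).toLp _),
      (hΛ.memLp_one hK hx).coeFn_toLp] with ω h1 h2
    rw [h1, Pi.smul_apply, h2, smul_eq_mul]
  filter_upwards [ae_all_iff.2 this] with ω h
  simp [h]

/-- The fibres over nonzero values are disjoint and of finite measure, hence independent. The fibre
over `0` may have infinite measure; it is dropped, which costs nothing because `K 0 = 0`. -/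
lemma charFun_setToSimpleFunc (hΛ : IsScatteredRandomMeasure μ P K Λ)
    (hK : IsCumulantOfOrder K q C) {f : SimpleFunc α ℝ} (hf : Integrable f μ) (s : ℝ) :
    charFun (P.map (f.setToSimpleFunc (vectorValue Λ P) : Lp ℝ 1 P)) s =
      Complex.exp (∫ x, K (s * f x) ∂μ) := by
  rw [Measure.map_congr (hΛ.setToSimpleFunc_ae_eq hK hf), hΛ.charFun_sum]
  · congr 1
    have h1 : ∫ x, K (s * f x) ∂μ = (f.map fun y => K (s * y)).integral μ := by
      rw [SimpleFunc.integral_eq_integral]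
      · rfl
      · exact hK.integrable (q := q) ((SimpleFunc.memLp_iff_integrable hK.ne_zero hK.ne_top).2 hf) s
    rw [h1, SimpleFunc.map_integral f _ hf (by simp [hK.map_zero]),
      Finset.sum_coe_sort (f.range.filter (· ≠ 0))
        (fun x => (μ.real (f ⁻¹' {x}) : ℂ) * K (x * s)), Finset.sum_filter]
    refine Finset.sum_congr rfl fun x _ => ?_
    split_ifs with hx
    · rw [mul_comm x s, Complex.real_smul]
    · rw [not_not] at hx
      simp [hx, hK.map_zero]
  · exact fun x => isAdmissible_fiber hf (Finset.mem_filter.1 x.2).2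
  · intro x y hxy
    exact Disjoint.preimage _ (by simpa using fun h => hxy (Subtype.ext h))

/-- The cumulant of the integral is bounded by `C |s| ^ q ‖f‖ ^ q`, so the moment bound with `N =
‖f‖` gives continuity from `L^q` to `L¹` and hence the extension by density. -/
lemma norm_setToSimpleFunc_le (hΛ : IsScatteredRandomMeasure μ P K Λ)
    (hK : IsCumulantOfOrder K q C) {f : SimpleFunc α ℝ} (hf : MemLp f q μ) :
    ‖f.setToSimpleFunc (vectorValue Λ P)‖ ≤
      Real.pi * (2 * C / (q.toReal - 1) + 1) * (eLpNorm f q μ).toReal := by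
  have hfi := (SimpleFunc.memLp_iff_integrable hK.ne_zero hK.ne_top).1 hf
  have h := lintegral_enorm_le_of_charFun (N := (eLpNorm f q μ).toReal)
    (Lp.aestronglyMeasurable (f.setToSimpleFunc (vectorValue Λ P))).aemeasurable
    hK.one_lt hK.nonneg ENNReal.toReal_nonneg (hΛ.charFun_setToSimpleFunc hK hfi)
    (fun s => hK.re_integral_nonpos hf s) (fun s => hK.norm_integral_le hf s)
  rw [Lp.norm_def, eLpNorm_one_eq_lintegral_enorm]
  have hC := hK.nonneg
  have hq := hK.one_lt
  have hq' : 0 < q.toReal - 1 := by linarith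
  exact ENNReal.toReal_le_of_le_ofReal (by positivity) h

variable [Fact (1 ≤ q)]

attribute [local instance] Lp.simpleFunc.module

/-- The stochastic integral on simple functions in `L^q`. -/
noncomputable def simpleIntegral (hΛ : IsScatteredRandomMeasure μ P K Λ)
    (hK : IsCumulantOfOrder K q C) :
    Lp.simpleFunc ℝ q μ →ₗ[ℝ] Lp ℝ 1 P where
  toFun f := (Lp.simpleFunc.toSimpleFunc f).setToSimpleFunc (vectorValue Λ P)
  map_add' f g := by
    have hi : ∀ f : Lp.simpleFunc ℝ q μ, Integrable (Lp.simpleFunc.toSimpleFunc f) μ := fun f =>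
      (SimpleFunc.memLp_iff_integrable hK.ne_zero hK.ne_top).1 (Lp.simpleFunc.memLp f)
    rw [← SimpleFunc.setToSimpleFunc_add _ (hΛ.finMeasAdditive hK) (hi f) (hi g)]
    exact SimpleFunc.setToSimpleFunc_congr _ (fun s => hΛ.vectorValue_null hK)
      (hΛ.finMeasAdditive hK) (hi _) (Lp.simpleFunc.add_toSimpleFunc f g)
  map_smul' c f := by
    have hi : ∀ f : Lp.simpleFunc ℝ q μ, Integrable (Lp.simpleFunc.toSimpleFunc f) μ := fun f =>
      (SimpleFunc.memLp_iff_integrable hK.ne_zero hK.ne_top).1 (Lp.simpleFunc.memLp f)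
    rw [RingHom.id_apply, ← SimpleFunc.setToSimpleFunc_smul_real _ (hΛ.finMeasAdditive hK) c (hi f)]
    exact SimpleFunc.setToSimpleFunc_congr _ (fun s => hΛ.vectorValue_null hK)
      (hΛ.finMeasAdditive hK) (hi _) (Lp.simpleFunc.smul_toSimpleFunc c f)

/-- The stochastic integral as a continuous linear map from `L^q` to `L¹`. -/
noncomputable def stochasticIntegral (hΛ : IsScatteredRandomMeasure μ P K Λ)
    (hK : IsCumulantOfOrder K q C) :
    Lp ℝ q μ →L[ℝ] Lp ℝ 1 P :=
  (hΛ.simpleIntegral hK).extendOfNorm (Lp.simpleFunc.coeToLp α ℝ ℝ (p := q) (μ := μ)).toLinearMap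

lemma stochasticIntegral_toLp (hΛ : IsScatteredRandomMeasure μ P K Λ)
    (hK : IsCumulantOfOrder K q C) {f : SimpleFunc α ℝ} (hf : MemLp f q μ) :
    hΛ.stochasticIntegral hK (hf.toLp f) = f.setToSimpleFunc (vectorValue Λ P) := by
  have h := LinearMap.extendOfNorm_eq (f := hΛ.simpleIntegral hK)
    (e := (Lp.simpleFunc.coeToLp α ℝ ℝ (p := q) (μ := μ)).toLinearMap)
    (Lp.simpleFunc.denseRange hK.ne_top)
    ⟨_, fun g => by
      refine (hΛ.norm_setToSimpleFunc_le hK (Lp.simpleFunc.memLp g)).trans_eq ?_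
      rw [← Lp.simpleFunc.norm_toSimpleFunc g]
      rfl⟩ (f.toLp hf)
  refine Eq.trans h ?_
  exact SimpleFunc.setToSimpleFunc_congr _ (fun s => hΛ.vectorValue_null hK)
      (hΛ.finMeasAdditive hK) ((SimpleFunc.memLp_iff_integrable hK.ne_zero hK.ne_top).1
        (Lp.simpleFunc.memLp _)) (Lp.simpleFunc.toSimpleFunc_toLp f hf)

/-- Both sides pass to the limit along simple approximations: the left because characteristic
functions are Lipschitz in the `L¹` distance, the right by dominated convergence with a multiple of
`(2 ‖f‖) ^ q`. -/
lemma charFun_stochasticIntegral (hΛ : IsScatteredRandomMeasure μ P K Λ)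
    (hK : IsCumulantOfOrder K q C) {f : α → ℝ} (hfm : Measurable f) (hf : MemLp f q μ) (s : ℝ) :
    charFun (P.map (hΛ.stochasticIntegral hK (hf.toLp f))) s =
      Complex.exp (∫ x, K (s * f x) ∂μ) := by
  set F : ℕ → SimpleFunc α ℝ := fun n => SimpleFunc.approxOn f hfm (range f ∪ {0}) 0 (by simp) n
    with hF
  have hFm : ∀ n, MemLp (F n) q μ := fun n => SimpleFunc.memLp_approxOn_range hfm hf n
  have hlim : Tendsto (fun n => (hFm n).toLp (F n)) atTop (𝓝 (hf.toLp f)) :=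
    SimpleFunc.tendsto_approxOn_range_Lp hK.ne_top hfm hf
  have hlim2 := ((hΛ.stochasticIntegral hK).continuous.tendsto _).comp hlim
  have hL : Tendsto (fun n => charFun (P.map (hΛ.stochasticIntegral hK ((hFm n).toLp (F n)))) s)
      atTop (𝓝 (charFun (P.map (hΛ.stochasticIntegral hK (hf.toLp f))) s)) := by
    have hmeas : ∀ Z : Lp ℝ 1 P, charFun (P.map Z) s = ∫ ω, Complex.exp (s * Z ω * Complex.I) ∂P := by
      intro Z
      rw [charFun_apply_real, integral_map (Lp.aestronglyMeasurable Z).aemeasurable (by fun_prop)]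
    have hint : ∀ Z : Lp ℝ 1 P, Integrable (fun ω => Complex.exp (s * Z ω * Complex.I)) P := by
      intro Z
      have := (Lp.aestronglyMeasurable Z).aemeasurable
      exact Integrable.of_bound (by fun_prop) 1 (ae_of_all _ fun ω => by
          rw [← Complex.ofReal_mul, Complex.norm_exp_ofReal_mul_I])
    rw [tendsto_iff_norm_sub_tendsto_zero] at hlim2 ⊢
    refine squeeze_zero (fun n => norm_nonneg _) (fun n => ?_)
      (by simpa using hlim2.const_mul |s|)
    rw [hmeas, hmeas, ← integral_sub (hint _) (hint _)]
    set Z₁ := hΛ.stochasticIntegral hK ((hFm n).toLp (F n))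
    set Z₂ := hΛ.stochasticIntegral hK (hf.toLp f)
    rw [L1.norm_eq_integral_norm, ← integral_const_mul]
    refine norm_integral_le_of_norm_le ((L1.integrable_coeFn _).norm.const_mul _) ?_
    filter_upwards [Lp.coeFn_sub Z₁ Z₂] with ω hω
    rw [hω, Pi.sub_apply]
    have e : Complex.exp (s * Z₁ ω * Complex.I) - Complex.exp (s * Z₂ ω * Complex.I) =
        Complex.exp ((s * Z₂ ω : ℝ) * Complex.I) *
          (Complex.exp (Complex.I * ((s * (Z₁ ω - Z₂ ω) : ℝ) : ℂ)) - 1) := by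
      rw [mul_sub, ← Complex.exp_add]; push_cast; ring_nf
    rw [e, norm_mul, Complex.norm_exp_ofReal_mul_I, one_mul]
    refine Real.norm_exp_I_mul_ofReal_sub_one_le.trans_eq ?_
    rw [norm_mul]; rfl
  have hR : Tendsto (fun n => Complex.exp (∫ x, K (s * F n x) ∂μ)) atTop
      (𝓝 (Complex.exp (∫ x, K (s * f x) ∂μ))) := by
    refine (Complex.continuous_exp.tendsto _).comp ?_
    refine tendsto_integral_of_dominated_convergence
      (fun x => C * |s| ^ q.toReal * (2 * ‖f x‖) ^ q.toReal)
      (fun n => (hK.integrable (hFm n) s).1) ?_ ?_ ?_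
    · have := (hf.integrable_norm_rpow hK.ne_zero hK.ne_top).const_mul
        (C * |s| ^ q.toReal * 2 ^ q.toReal)
      refine this.congr (ae_of_all _ fun x => ?_)
      beta_reduce
      rw [Real.mul_rpow two_pos.le (norm_nonneg _), mul_assoc]
    · refine fun n => ae_of_all _ fun x => (hK.norm_mul_le _ _).trans ?_
      have hC := hK.nonneg
      have hq := hK.pos
      gcongr
      rw [two_mul]
      exact SimpleFunc.norm_approxOn_zero_le hfm (by simp) x n
    · refine ae_of_all _ fun x => (hK.continuous.tendsto _).comp (Tendsto.const_mul s ?_)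
      exact SimpleFunc.tendsto_approxOn hfm (by simp) (subset_closure (by simp))
  refine tendsto_nhds_unique hL (hR.congr fun n => ?_)
  rw [hΛ.stochasticIntegral_toLp hK (hFm n), hΛ.charFun_setToSimpleFunc hK
    ((SimpleFunc.memLp_iff_integrable hK.ne_zero hK.ne_top).1 (hFm n))]

end SupCAR.IsScatteredRandomMeasure

end Integral

/-! ### Dominated convergence in `L^q` -/

section DominatedLp

variable {α : Type*} [MeasurableSpace α] {μ : Measure α} {q : ℝ≥0∞}

lemma toLp_eq_indicator_add {f : α → ℝ} (hf : MemLp f q μ) {A : Set α}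
    (h₁ : MemLp (A.indicator f) q μ) (h₂ : MemLp (Aᶜ.indicator f) q μ) :
    hf.toLp f = h₁.toLp _ + h₂.toLp _ := by
  rw [← MemLp.toLp_add]
  exact MemLp.toLp_congr _ _ (ae_of_all _ fun x => (congrFun (indicator_self_add_compl A f) x).symm)

lemma tendsto_eLpNorm_of_dominated {ι : Type*} {l : Filter ι} [l.IsCountablyGenerated]
    (h0 : q ≠ 0) (ht : q ≠ ∞) {g : ι → α → ℝ} {f h : α → ℝ}
    (hg : ∀ᶠ n in l, AEStronglyMeasurable (g n) μ) (hf : AEStronglyMeasurable f μ)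
    (hh : MemLp h q μ) (hgh : ∀ᶠ n in l, ∀ᵐ x ∂μ, ‖g n x‖ ≤ h x) (hfh : ∀ᵐ x ∂μ, ‖f x‖ ≤ h x)
    (hlim : ∀ᵐ x ∂μ, Tendsto (fun n => g n x) l (𝓝 (f x))) :
    Tendsto (fun n => eLpNorm (g n - f) q μ) l (𝓝 0) := by
  have hq : 0 < q.toReal := ENNReal.toReal_pos h0 ht
  simp_rw [eLpNorm_eq_lintegral_rpow_enorm_toReal h0 ht]
  have key : Tendsto (fun n => ∫⁻ x, ‖(g n - f) x‖ₑ ^ q.toReal ∂μ) l (𝓝 (∫⁻ x, 0 ∂μ)) := by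
    refine tendsto_lintegral_filter_of_dominated_convergence' (fun x => (2 * ‖h x‖ₑ) ^ q.toReal)
      ?_ ?_ ?_ ?_
    · filter_upwards [hg] with n hn
      exact (hn.sub hf).enorm.pow_const _
    · filter_upwards [hgh] with n hn
      filter_upwards [hn, hfh] with x h1 h2
      gcongr
      rw [two_mul]
      refine (enorm_sub_le).trans (add_le_add ?_ ?_)
      · exact enorm_le_iff_norm_le.2 (h1.trans (le_abs_self _))
      · exact enorm_le_iff_norm_le.2 (h2.trans (le_abs_self _))
    · simp_rw [ENNReal.mul_rpow_of_nonneg _ _ hq.le]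
      rw [lintegral_const_mul' _ _ (by simp)]
      refine ENNReal.mul_ne_top (by simp) ?_
      exact (lintegral_rpow_enorm_lt_top_of_eLpNorm_lt_top h0 ht hh.2).ne
    · filter_upwards [hlim] with x hx
      have h1 : Tendsto (fun n => ‖(g n - f) x‖ₑ) l (𝓝 0) := by
        have := (hx.sub_const (f x)).enorm
        simpa using this
      simpa [hq] using h1.ennrpow_const q.toReal
  rw [lintegral_zero] at key
  have := key.ennrpow_const (1 / q.toReal)
  simpa [hq] using this

end DominatedLp

lemma tendstoInMeasure_comp {Ω : Type*} [MeasurableSpace Ω] {P : Measure Ω} {G : ℕ → Ω → ℝ}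
    {Y : Ω → ℝ} (h : TendstoInMeasure P G atTop Y) {c : ℕ → ℕ} (hc : Tendsto c atTop atTop) :
    TendstoInMeasure P (fun n => G (c n)) atTop Y :=
  fun ε hε => (h ε hε).comp hc

/-! ### Rajput–Rosinski integrals of functions in `L^q` -/

section RajputRosinski

variable {α Ω : Type*} [MeasurableSpace α] [MeasurableSpace Ω] {μ : Measure α} {P : Measure Ω}
  [IsProbabilityMeasure P] {K : ℝ → ℂ} {Λ : Set α → Ω → ℝ} {q : ℝ≥0∞} {C : ℝ}

namespace SupCAR.SimpleIntegrand

lemma measurable_eval (F : SimpleIntegrand μ) : Measurable F.eval := by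
  unfold SimpleIntegrand.eval
  exact Finset.measurable_sum _ fun i _ => measurable_const.indicator (F.admissible i).1

lemma indicator_eval (F : SimpleIntegrand μ) (A : Set α) :
    A.indicator F.eval = fun x => ∑ i, (F.set i ∩ A).indicator (fun _ => F.coeff i) x := by
  ext x
  by_cases hx : x ∈ A
  · rw [indicator_of_mem hx, SimpleIntegrand.eval]
    refine Finset.sum_congr rfl fun i _ => ?_
    by_cases hi : x ∈ F.set i <;> simp [hi, hx]
  · rw [indicator_of_notMem hx, Finset.sum_eq_zero]
    intro i _
    simp [hx]

lemma memLp_indicator (F : SimpleIntegrand μ) {A : Set α} (hA : MeasurableSet A) :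
    MemLp (A.indicator F.eval) q μ := by
  rw [indicator_eval]
  refine memLp_finsetSum _ fun i _ => ?_
  refine memLp_indicator_const q ((F.admissible i).1.inter hA) _ (Or.inr ?_)
  exact ((measure_mono inter_subset_left).trans_lt (F.admissible i).2).ne

end SupCAR.SimpleIntegrand

namespace SupCAR.IsScatteredRandomMeasure

variable [Fact (1 ≤ q)]

lemma stochasticIntegral_indicator (hΛ : IsScatteredRandomMeasure μ P K Λ)
    (hK : IsCumulantOfOrder K q C) {B : Set α} (hB : IsAdmissible μ B) (c : ℝ)
    (h : MemLp (B.indicator fun _ => c) q μ) :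
    hΛ.stochasticIntegral hK (h.toLp _) =ᵐ[P] fun ω => c * Λ B ω := by
  have e : (SimpleFunc.piecewise B hB.1 (SimpleFunc.const α c) (SimpleFunc.const α 0) : α → ℝ) =
      B.indicator fun _ => c := by
    ext x; by_cases hx : x ∈ B <;> simp [hx]
  have h' : MemLp (SimpleFunc.piecewise B hB.1 (SimpleFunc.const α c) (SimpleFunc.const α 0)) q μ := by
    rw [e]; exact h
  have e2 : h.toLp _ = h'.toLp _ := MemLp.toLp_congr _ _ (by rw [e])
  rw [e2, hΛ.stochasticIntegral_toLp hK h', SimpleFunc.setToSimpleFunc_indicator _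
    (hΛ.finMeasAdditive hK).map_empty_eq_zero, vectorValue_apply (hΛ.memLp_one hK hB)]
  filter_upwards [Lp.coeFn_smul c ((hΛ.memLp_one hK hB).toLp _),
      (hΛ.memLp_one hK hB).coeFn_toLp] with ω h1 h2
  rw [h1, Pi.smul_apply, h2, smul_eq_mul]

lemma stochasticIntegral_simpleIntegrand (hΛ : IsScatteredRandomMeasure μ P K Λ)
    (hK : IsCumulantOfOrder K q C) (F : SimpleIntegrand μ) {A : Set α} (hA : MeasurableSet A) :
    hΛ.stochasticIntegral hK ((F.memLp_indicator hA).toLp _) =ᵐ[P] F.integral Λ A := by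
  have hadm : ∀ i, IsAdmissible μ (F.set i ∩ A) := fun i =>
    ⟨(F.admissible i).1.inter hA, (measure_mono inter_subset_left).trans_lt (F.admissible i).2⟩
  have hmem : ∀ i, MemLp ((F.set i ∩ A).indicator fun _ => F.coeff i) q μ := fun i =>
    memLp_indicator_const q (hadm i).1 _ (Or.inr (hadm i).2.ne)
  have hsum : (F.memLp_indicator hA).toLp _ = ∑ i, (hmem i).toLp _ := by
    refine Lp.ext ?_
    have h1 := Lp.coeFn_finsetSum Finset.univ fun i => (hmem i).toLp _
    filter_upwards [(F.memLp_indicator (q := q) hA).coeFn_toLp, h1,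
      ae_all_iff.2 fun i => (hmem i).coeFn_toLp] with x h2 h3 h4
    rw [h2, h3, F.indicator_eval]
    simp [h4]
  rw [hsum, map_sum]
  have h1 := Lp.coeFn_finsetSum Finset.univ fun i => hΛ.stochasticIntegral hK ((hmem i).toLp _)
  filter_upwards [h1, ae_all_iff.2 fun i =>
    hΛ.stochasticIntegral_indicator hK (hadm i) (F.coeff i) (hmem i)] with ω h2 h3
  rw [h2]
  simp [h3, SimpleIntegrand.integral]

/-- If simple functions converge to `f` in `L^q` over `A` along a sequence, then the limit in
probability of their integrals over `A` is the stochastic integral of `f` over `A`. -/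
lemma ae_eq_stochasticIntegral_of_tendsto_eLpNorm (hΛ : IsScatteredRandomMeasure μ P K Λ)
    (hK : IsCumulantOfOrder K q C) {F : ℕ → SimpleIntegrand μ} {A : Set α} (hA : MeasurableSet A)
    {f : α → ℝ} (hf : MemLp (A.indicator f) q μ)
    (hlim : Tendsto (fun n => eLpNorm (A.indicator (F n).eval - A.indicator f) q μ) atTop (𝓝 0))
    {Y : Ω → ℝ} (hY : TendstoInMeasure P (fun n => (F n).integral Λ A) atTop Y) :
    Y =ᵐ[P] hΛ.stochasticIntegral hK (hf.toLp _) := by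
  have h1 : Tendsto (fun n => ((F n).memLp_indicator (q := q) hA).toLp _) atTop
      (𝓝 (hf.toLp _)) :=
    (Lp.tendsto_Lp_iff_tendsto_eLpNorm'' _ _ _ _).2 hlim
  have h2 := tendstoInMeasure_of_tendsto_Lp
    (((hΛ.stochasticIntegral hK).continuous.tendsto _).comp h1)
  exact tendstoInMeasure_ae_unique hY
    (h2.congr (fun n => hΛ.stochasticIntegral_simpleIntegrand hK (F n) hA) EventuallyEq.rfl)

/-- Gliding hump: along a subsequence, and after splitting the space into two parts, the simple
functions converge in `L^q` on the parts. -/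
lemma exists_split_tendsto_eLpNorm [SigmaFinite μ] (h0 : q ≠ 0) (ht : q ≠ ∞)
    {F : ℕ → SimpleIntegrand μ} {f : α → ℝ} (hfm : Measurable f) (hf : MemLp f q μ)
    (hF : ∀ᵐ x ∂μ, Tendsto (fun n => (F n).eval x) atTop (𝓝 (f x))) :
    ∃ (A : Set α) (a b : ℕ → ℕ), MeasurableSet A ∧ Tendsto a atTop atTop ∧ Tendsto b atTop atTop ∧
      Tendsto (fun n => eLpNorm (A.indicator (F (a n)).eval - A.indicator f) q μ) atTop (𝓝 0) ∧
      Tendsto (fun n => eLpNorm (Aᶜ.indicator (F (b n)).eval - Aᶜ.indicator f) q μ) atTop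
        (𝓝 0) := by
  have hFm : ∀ n, Measurable (F n).eval := fun n => (F n).measurable_eval
  have hFq : ∀ n, MemLp (F n).eval q μ := fun n => by
    simpa using (F n).memLp_indicator (q := q) MeasurableSet.univ
  -- exhausting sets on which the sequence is bounded
  let S : ℕ → Set α := fun k => (spanningSets μ k) ∩ {x | ∀ n, |(F n).eval x| ≤ k} ∩ {x | |f x| ≤ k}
  have hSm : ∀ k, MeasurableSet (S k) := by
    intro k
    refine ((measurableSet_spanningSets μ k).inter ?_).inter
      (measurableSet_le hfm.abs measurable_const)
    have : {x | ∀ n, |(F n).eval x| ≤ k} = ⋂ n, {x | |(F n).eval x| ≤ k} := by ext; simp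
    rw [this]
    exact MeasurableSet.iInter fun n => measurableSet_le (hFm n).abs measurable_const
  have hSmono : Monotone S := by
    intro j k hjk x hx
    have hc : (j : ℝ) ≤ k := by exact_mod_cast hjk
    exact ⟨⟨monotone_spanningSets μ hjk hx.1.1, fun n => (hx.1.2 n).trans hc⟩, hx.2.trans hc⟩
  have hSfull : ∀ᵐ x ∂μ, ∀ᶠ k in atTop, x ∈ S k := by
    filter_upwards [hF] with x hx
    obtain ⟨M, hM⟩ := (hx.abs.bddAbove_range)
    have hM' : ∀ n, |(F n).eval x| ≤ M := fun n => hM ⟨n, rfl⟩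
    have h1 : x ∈ ⋃ k, spanningSets μ k := by rw [iUnion_spanningSets]; trivial
    obtain ⟨k₀, hk₀⟩ := mem_iUnion.1 h1
    filter_upwards [eventually_ge_atTop k₀, eventually_ge_atTop ⌈M⌉₊,
      eventually_ge_atTop ⌈|f x|⌉₊] with k h1 h2 h3
    exact ⟨⟨monotone_spanningSets μ h1 hk₀, fun n => (hM' n).trans (Nat.ceil_le.1 h2)⟩,
      Nat.ceil_le.1 h3⟩
  have hin : ∀ k, Tendsto (fun n => eLpNorm ((S k).indicator (F n).eval - (S k).indicator f) q μ)
      atTop (𝓝 0) := by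
    intro k
    have hmem : MemLp ((S k).indicator fun _ => (k : ℝ)) q μ := by
      refine memLp_indicator_const q (hSm k) _ (Or.inr ?_)
      exact ((measure_mono fun x hx => hx.1.1).trans_lt (measure_spanningSets_lt_top μ k)).ne
    refine tendsto_eLpNorm_of_dominated h0 ht
      (Eventually.of_forall fun n => ((hFm n).indicator (hSm k)).aestronglyMeasurable)
      (hfm.indicator (hSm k)).aestronglyMeasurable hmem
      (Eventually.of_forall fun n => ae_of_all _ fun x => ?_) (ae_of_all _ fun x => ?_) ?_
    · by_cases hx : x ∈ S k
      · simpa [hx] using hx.1.2 n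
      · simp [hx]
    · by_cases hx : x ∈ S k
      · simpa [hx] using hx.2
      · simp [hx]
    · filter_upwards [hF] with x hx
      by_cases hxS : x ∈ S k
      · simpa [hxS] using hx
      · simp [hxS]
  have hout : ∀ g : α → ℝ, Measurable g → MemLp g q μ →
      Tendsto (fun k => eLpNorm ((S k)ᶜ.indicator g) q μ) atTop (𝓝 0) := by
    intro g hgm hg
    have h := tendsto_eLpNorm_of_dominated (l := atTop) h0 ht (g := fun k => (S k)ᶜ.indicator g)
      (f := fun _ => 0) (h := fun x => ‖g x‖)
      (Eventually.of_forall fun k => (hgm.indicator (hSm k).compl).aestronglyMeasurable)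
      aestronglyMeasurable_const hg.norm
      (Eventually.of_forall fun k => ae_of_all _ fun x => norm_indicator_le_norm_self _ _)
      (ae_of_all _ fun x => by simp) ?_
    · refine h.congr fun k => ?_
      congr 1
      ext x; simp
    · filter_upwards [hSfull] with x hx
      refine tendsto_const_nhds.congr' ?_
      filter_upwards [hx] with k hk
      simp [hk]
  -- the hump indices
  have hN : ∀ k j : ℕ, ∃ n, j ≤ n ∧
      eLpNorm ((S k).indicator (F n).eval - (S k).indicator f) q μ ≤ (j : ℝ≥0∞)⁻¹ := by
    intro k j
    have hj : (0 : ℝ≥0∞) < (j : ℝ≥0∞)⁻¹ := by simp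
    obtain ⟨n, hn1, hn2⟩ := (((hin k).eventually (gt_mem_nhds hj)).and (eventually_ge_atTop j)).exists
    exact ⟨n, hn2, hn1.le⟩
  choose N hNj hN using hN
  have hκ : ∀ n k j : ℕ, ∃ k', k < k' ∧
      eLpNorm ((S k')ᶜ.indicator (F n).eval) q μ ≤ (j : ℝ≥0∞)⁻¹ := by
    intro n k j
    have hj : (0 : ℝ≥0∞) < (j : ℝ≥0∞)⁻¹ := by simp
    obtain ⟨k', hk1, hk2⟩ := (((hout _ (hFm n) (hFq n)).eventually (gt_mem_nhds hj)).and
      (eventually_gt_atTop k)).exists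
    exact ⟨k', hk2, hk1.le⟩
  choose κ hκk hκ using hκ
  -- Alternating choice: given `κs j`, take an index `N (κs j) j` for which the simple function is
  -- close to `f` on `S (κs j)`, then take `κs (j + 1)` so large that this simple function is
  -- negligible outside `S (κs (j + 1))`. Any lack of closeness can then survive only on the shell
  -- between the two sets.
  obtain ⟨κs, hκs⟩ : ∃ κs : ℕ → ℕ, ∀ j, κs (j + 1) = κ (N (κs j) j) (κs j) j :=
    ⟨fun j => Nat.rec 0 (fun j k => κ (N k j) k j) j, fun j => rfl⟩
  have hκmono : StrictMono κs := strictMono_nat_of_lt_succ fun j => by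
    rw [hκs]; exact hκk _ _ _
  let m : ℕ → ℕ := fun j => N (κs j) j
  have hm : Tendsto m atTop atTop := tendsto_atTop_mono (fun j => hNj _ _) tendsto_id
  let B : ℕ → Set α := fun j => S (κs (j + 1)) \ S (κs j)
  -- `A` collects the even shells: it avoids the bad shell of every odd index, and its complement
  -- avoids that of every even index.
  let A : Set α := ⋃ j, B (2 * j)
  have hAm : MeasurableSet A := MeasurableSet.iUnion fun j => (hSm _).diff (hSm _)
  have hBdisj : ∀ i j x, x ∈ B i → x ∈ B j → i = j := by
    have haux : ∀ i j x, x ∈ B i → x ∈ B j → ¬ i < j := by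
      intro i j x hi hj hij
      exact hj.2 (hSmono (hκmono.monotone hij) hi.1)
    intro i j x hi hj
    exact le_antisymm (not_lt.1 (haux j i x hj hi)) (not_lt.1 (haux i j x hi hj))
  have hbound : ∀ (D : Set α) (j : ℕ), MeasurableSet D → Disjoint D (B j) →
      eLpNorm (D.indicator (F (m j)).eval - D.indicator f) q μ ≤
        (j : ℝ≥0∞)⁻¹ + (j : ℝ≥0∞)⁻¹ + eLpNorm ((S (κs (j + 1)))ᶜ.indicator f) q μ := by
    intro D j hD hDB
    have h1q : 1 ≤ q := Fact.out
    have hpt : ∀ x, ‖(D.indicator (F (m j)).eval - D.indicator f) x‖ ≤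
        ‖((S (κs j)).indicator (F (m j)).eval - (S (κs j)).indicator f) x‖ +
        ‖(S (κs (j + 1)))ᶜ.indicator (F (m j)).eval x‖ +
        ‖(S (κs (j + 1)))ᶜ.indicator f x‖ := by
      intro x
      by_cases hxD : x ∈ D
      · by_cases hx1 : x ∈ S (κs j)
        · simp only [Pi.sub_apply, hxD, indicator_of_mem, hx1]
          have : 0 ≤ ‖(S (κs (j + 1)))ᶜ.indicator (F (m j)).eval x‖ := norm_nonneg _
          have : 0 ≤ ‖(S (κs (j + 1)))ᶜ.indicator f x‖ := norm_nonneg _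
          linarith
        · have hx2 : x ∉ S (κs (j + 1)) := fun h => Set.disjoint_left.1 hDB hxD ⟨h, hx1⟩
          simp only [Pi.sub_apply, hxD, indicator_of_mem, hx1, indicator_of_notMem, not_false_eq_true,
            mem_compl_iff, hx2, sub_self, norm_zero, zero_add]
          exact norm_sub_le _ _
      · simp only [Pi.sub_apply, hxD, not_false_eq_true, indicator_of_notMem, sub_self, norm_zero]
        positivity
    refine (eLpNorm_mono_real hpt).trans ?_
    have hm1 : AEStronglyMeasurable
        (fun x => ‖((S (κs j)).indicator (F (m j)).eval - (S (κs j)).indicator f) x‖) μ :=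
      (((hFm _).indicator (hSm _)).sub (hfm.indicator (hSm _))).norm.aestronglyMeasurable
    have hm2 : AEStronglyMeasurable
        (fun x => ‖(S (κs (j + 1)))ᶜ.indicator (F (m j)).eval x‖) μ :=
      ((hFm _).indicator (hSm _).compl).norm.aestronglyMeasurable
    have hm3 : AEStronglyMeasurable (fun x => ‖(S (κs (j + 1)))ᶜ.indicator f x‖) μ :=
      (hfm.indicator (hSm _).compl).norm.aestronglyMeasurable
    refine (eLpNorm_add_le (hm1.add hm2) hm3 h1q).trans ?_
    rw [eLpNorm_norm]
    gcongr
    refine (eLpNorm_add_le hm1 hm2 h1q).trans ?_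
    rw [eLpNorm_norm, eLpNorm_norm]
    rw [hκs]
    exact add_le_add (hN _ _) (hκ _ _ _)
  have hlim : Tendsto (fun j : ℕ => (j : ℝ≥0∞)⁻¹ + (j : ℝ≥0∞)⁻¹ +
      eLpNorm ((S (κs (j + 1)))ᶜ.indicator f) q μ) atTop (𝓝 0) := by
    have h1 := ENNReal.tendsto_inv_nat_nhds_zero
    have h2 := (hout f hfm hf).comp (hκmono.tendsto_atTop.comp (tendsto_add_atTop_nat 1))
    simpa using (h1.add h1).add h2
  have h2n : Tendsto (fun n : ℕ => 2 * n) atTop atTop :=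
    tendsto_atTop_mono (fun n => by simp only [id]; omega) tendsto_id
  have h2n1 : Tendsto (fun n : ℕ => 2 * n + 1) atTop atTop :=
    tendsto_atTop_mono (fun n => by simp only [id]; omega) tendsto_id
  refine ⟨A, fun n => m (2 * n + 1), fun n => m (2 * n), hAm, hm.comp h2n1, hm.comp h2n, ?_, ?_⟩
  · refine tendsto_of_tendsto_of_tendsto_of_le_of_le tendsto_const_nhds (hlim.comp h2n1)
      (fun n => zero_le) (fun n => hbound A (2 * n + 1) hAm ?_)
    rw [Set.disjoint_left]
    intro x hx hxB
    obtain ⟨i, hi⟩ := mem_iUnion.1 hx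
    have := hBdisj _ _ x hi hxB
    omega
  · refine tendsto_of_tendsto_of_tendsto_of_le_of_le tendsto_const_nhds (hlim.comp h2n)
      (fun n => zero_le) (fun n => hbound Aᶜ (2 * n) hAm.compl ?_)
    rw [Set.disjoint_left]
    intro x hx hxB
    exact hx (mem_iUnion.2 ⟨n, hxB⟩)

lemma simpleIntegral_univ_ae_eq (hΛ : IsScatteredRandomMeasure μ P K Λ)
    (hK : IsCumulantOfOrder K q C) (F : SimpleIntegrand μ) {A : Set α} (hA : MeasurableSet A) :
    F.integral Λ univ =ᵐ[P] F.integral Λ A + F.integral Λ Aᶜ := by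
  have h1 := hΛ.stochasticIntegral_simpleIntegrand hK F hA
  have h2 := hΛ.stochasticIntegral_simpleIntegrand hK F hA.compl
  have h3 := hΛ.stochasticIntegral_simpleIntegrand hK F MeasurableSet.univ
  have h0 : MemLp F.eval q μ := by simpa using F.memLp_indicator (q := q) MeasurableSet.univ
  have h4 : (F.memLp_indicator (q := q) MeasurableSet.univ).toLp _ = h0.toLp _ :=
    MemLp.toLp_congr _ _ (by rw [indicator_univ])
  rw [h4, toLp_eq_indicator_add h0 (F.memLp_indicator hA) (F.memLp_indicator hA.compl),
    map_add] at h3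
  have h5 := Lp.coeFn_add (hΛ.stochasticIntegral hK ((F.memLp_indicator hA).toLp _))
    (hΛ.stochasticIntegral hK ((F.memLp_indicator hA.compl).toLp _))
  filter_upwards [h1, h2, h3, h5] with ω g1 g2 g3 g5
  rw [← g3, g5, Pi.add_apply, Pi.add_apply, g1, g2]

/-- A Rajput–Rosinski integral of a function in `L^q` is its stochastic integral. -/
theorem ae_eq_stochasticIntegral [SigmaFinite μ] (hΛ : IsScatteredRandomMeasure μ P K Λ)
    (hK : IsCumulantOfOrder K q C) {f : α → ℝ} (hfm : Measurable f) (hf : MemLp f q μ)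
    {Z : Ω → ℝ} (hZ : IsRajputRosinskiIntegral μ P Λ f Z) :
    Z =ᵐ[P] hΛ.stochasticIntegral hK (hf.toLp f) := by
  obtain ⟨F, hF, hY, hFZ⟩ := hZ
  obtain ⟨A, a, b, hA, ha, hb, hlimA, hlimA'⟩ :=
    exists_split_tendsto_eLpNorm hK.ne_zero hK.ne_top hfm hf hF
  have hfA := hf.indicator hA
  have hfA' := hf.indicator hA.compl
  obtain ⟨Y₁, -, hY₁⟩ := hY A hA
  obtain ⟨Y₂, -, hY₂⟩ := hY Aᶜ hA.compl
  -- The definition provides limits in probability over `A` and over `Aᶜ` along the full sequence,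
  -- so each limit may be identified along its own subsequence, `a` or `b`.
  have e₁ := hΛ.ae_eq_stochasticIntegral_of_tendsto_eLpNorm hK (F := fun n => F (a n)) hA hfA hlimA
    (tendstoInMeasure_comp hY₁ ha)
  have e₂ := hΛ.ae_eq_stochasticIntegral_of_tendsto_eLpNorm hK (F := fun n => F (b n)) hA.compl
    hfA' hlimA' (tendstoInMeasure_comp hY₂ hb)
  have hadd := toLp_eq_indicator_add hf hfA hfA'
  -- Three nested extractions give one subsequence with almost sure convergence over `A`, over `Aᶜ`
  -- and over the whole space, where additivity can be passed to the limit.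
  obtain ⟨n₁, hn₁, h₁⟩ := hY₁.exists_seq_tendsto_ae
  obtain ⟨n₂, hn₂, h₂⟩ := (tendstoInMeasure_comp hY₂ hn₁.tendsto_atTop).exists_seq_tendsto_ae
  obtain ⟨n₃, hn₃, h₃⟩ :=
    (tendstoInMeasure_comp hFZ (hn₁.tendsto_atTop.comp hn₂.tendsto_atTop)).exists_seq_tendsto_ae
  rw [hadd, map_add]
  filter_upwards [h₁, h₂, h₃, e₁, e₂, ae_all_iff.2 fun n => hΛ.simpleIntegral_univ_ae_eq hK (F n) hA,
    Lp.coeFn_add (hΛ.stochasticIntegral hK (hfA.toLp _)) (hΛ.stochasticIntegral hK (hfA'.toLp _))]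
    with ω l₁ l₂ l₃ e₁ e₂ hsum hadd'
  rw [hadd', Pi.add_apply, ← e₁, ← e₂]
  refine tendsto_nhds_unique l₃ ?_
  have l₁' := (l₁.comp hn₂.tendsto_atTop).comp hn₃.tendsto_atTop
  have l₂' := l₂.comp hn₃.tendsto_atTop
  refine (l₁'.add l₂').congr fun n => ?_
  simp only [Function.comp_apply]
  rw [hsum, Pi.add_apply]

end SupCAR.IsScatteredRandomMeasure

end RajputRosinski

/-! ### Bochner integrals in `L^q` are pointwise integrals -/

section BochnerLp

variable {Y Z : Type*} [MeasurableSpace Y] [MeasurableSpace Z] {ν : Measure Y} {μ : Measure Z}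
  {q : ℝ≥0∞} [Fact (1 ≤ q)]

lemma integrableOn_Lp (g : Lp ℝ q μ) {S : Set Z} (hS : μ S < ∞) : IntegrableOn g S μ := by
  have : IsFiniteMeasure (μ.restrict S) := ⟨by simpa using hS⟩
  exact ((Lp.memLp g).restrict S).integrable Fact.out

lemma exists_setIntegral_norm_le (μ : Measure Z) (q : ℝ≥0∞) [Fact (1 ≤ q)] {S : Set Z}
    (hS : μ S < ∞) : ∃ c : ℝ, ∀ g : Lp ℝ q μ, ∫ z in S, ‖g z‖ ∂μ ≤ c * ‖g‖ := by
  have : IsFiniteMeasure (μ.restrict S) := ⟨by simpa using hS⟩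
  have h1 : 1 ≤ q := Fact.out
  refine ⟨(μ S ^ (1 / (1 : ℝ≥0∞).toReal - 1 / q.toReal)).toReal, fun g => ?_⟩
  have hpow : μ S ^ (1 / (1 : ℝ≥0∞).toReal - 1 / q.toReal) ≠ ∞ := by
    refine ENNReal.rpow_ne_top_of_nonneg ?_ hS.ne
    rcases eq_or_ne q ∞ with rfl | h
    · simp
    · have : 1 ≤ q.toReal := by
        simpa using (ENNReal.toReal_le_toReal (by simp) h).2 h1
      simpa using inv_le_one_of_one_le₀ this
  have hm := (Lp.aestronglyMeasurable g).restrict (s := S)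
  rw [integral_norm_eq_lintegral_enorm hm, ← eLpNorm_one_eq_lintegral_enorm, Lp.norm_def, mul_comm,
    ← ENNReal.toReal_mul]
  refine ENNReal.toReal_mono (ENNReal.mul_ne_top (Lp.eLpNorm_ne_top g) hpow) ?_
  refine (eLpNorm_le_eLpNorm_mul_rpow_measure_univ h1 hm).trans ?_
  rw [Measure.restrict_apply_univ]
  gcongr
  exact Measure.restrict_le_self

lemma exists_setIntegralCLM (μ : Measure Z) (q : ℝ≥0∞) [Fact (1 ≤ q)] {S : Set Z}
    (hS : μ S < ∞) : ∃ φ : Lp ℝ q μ →L[ℝ] ℝ, ∀ g, φ g = ∫ z in S, g z ∂μ := by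
  obtain ⟨c, hc⟩ := exists_setIntegral_norm_le μ q hS
  refine ⟨LinearMap.mkContinuous
    { toFun := fun g => ∫ z in S, g z ∂μ
      map_add' := fun f g => ?_
      map_smul' := fun a g => ?_ } c fun g => ?_, fun g => rfl⟩
  · rw [← integral_add (integrableOn_Lp f hS) (integrableOn_Lp g hS)]
    exact integral_congr_ae (ae_restrict_of_ae (Lp.coeFn_add f g))
  · rw [RingHom.id_apply, smul_eq_mul, ← integral_const_mul]
    exact integral_congr_ae (ae_restrict_of_ae (Lp.coeFn_smul a g))
  · exact (norm_integral_le_integral_norm _).trans (hc g)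

lemma integrable_uncurry_of_integrable_Lp [SFinite ν] [SigmaFinite μ] {X : Y → Z → ℝ}
    (hX : Measurable (Function.uncurry X)) {G : Y → Lp ℝ q μ} (hG : Integrable G ν)
    (hGX : ∀ᵐ y ∂ν, G y =ᵐ[μ] X y) {S : Set Z} (hS : μ S < ∞) :
    Integrable (Function.uncurry X) (ν.prod (μ.restrict S)) := by
  obtain ⟨c, hc⟩ := exists_setIntegral_norm_le μ q hS
  refine (integrable_prod_iff hX.aestronglyMeasurable).2 ⟨?_, ?_⟩
  · filter_upwards [hGX] with y hy
    exact (integrableOn_Lp (G y) hS).congr (ae_restrict_of_ae hy)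
  · refine (hG.norm.const_mul c).mono' ?_ ?_
    · exact hX.norm.stronglyMeasurable.integral_prod_right'.aestronglyMeasurable
    · filter_upwards [hGX] with y hy
      rw [Real.norm_of_nonneg (integral_nonneg fun z => norm_nonneg _)]
      refine le_trans (le_of_eq (integral_congr_ae ?_)) (hc (G y))
      filter_upwards [ae_restrict_of_ae (s := S) hy] with z hz
      rw [hz]; rfl

/-- It suffices to compare integrals over sets `S` of finite measure. Integration over `S` is a
continuous functional on `L^q`, so it commutes with the Bochner integral; on the pointwise side
Fubini performs the same exchange. -/
lemma integral_Lp_ae_eq [SFinite ν] [SigmaFinite μ] {X : Y → Z → ℝ}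
    (hX : Measurable (Function.uncurry X)) {G : Y → Lp ℝ q μ} (hG : Integrable G ν)
    (hGX : ∀ᵐ y ∂ν, G y =ᵐ[μ] X y) :
    ((∫ y, G y ∂ν : Lp ℝ q μ) : Z → ℝ) =ᵐ[μ] fun z => ∫ y, X y z ∂ν := by
  have hi : ∀ S, μ S < ∞ → Integrable (Function.uncurry X) (ν.prod (μ.restrict S)) := fun S hS =>
    integrable_uncurry_of_integrable_Lp hX hG hGX hS
  refine ae_eq_of_forall_setIntegral_eq_of_sigmaFinite (fun S _ hS => integrableOn_Lp _ hS)
    (fun S _ hS => (hi S hS).integral_prod_right) fun S _ hS => ?_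
  obtain ⟨φ, hφ⟩ := exists_setIntegralCLM μ q hS
  rw [← hφ, ← φ.integral_comp_comm hG, ← integral_integral_swap (hi S hS)]
  refine integral_congr_ae ?_
  filter_upwards [hGX] with y hy
  rw [hφ]
  exact integral_congr_ae (ae_restrict_of_ae hy)

end BochnerLp

/-! ### Stochastic Fubini -/

section StochasticFubini

variable {α Ω Y : Type*} [MeasurableSpace α] [MeasurableSpace Ω] [MeasurableSpace Y]
  {μ : Measure α} {P : Measure Ω} {ν : Measure Y}
  [IsProbabilityMeasure P] {K : ℝ → ℂ} {Λ : Set α → Ω → ℝ} {q : ℝ≥0∞} {C : ℝ}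
  [Fact (1 ≤ q)] [SigmaFinite μ] [SFinite ν]

/-- Fubini's theorem for stochastic integrals of a measurable family of integrands which is Bochner
integrable in `L^q`. -/
theorem SupCAR.IsScatteredRandomMeasure.stochastic_fubini (hΛ : IsScatteredRandomMeasure μ P K Λ)
    (hK : IsCumulantOfOrder K q C) {f : Y → α → ℝ} (hf : Measurable (Function.uncurry f))
    (hfq : ∀ y, MemLp (f y) q μ) (hint : Integrable (fun y => (hfq y).toLp (f y)) ν)
    {X : Y → Ω → ℝ} (hX : Measurable (Function.uncurry X))
    (hXf : ∀ y, IsRajputRosinskiIntegral μ P Λ (f y) (X y)) :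
    (∀ᵐ ω ∂P, Integrable (fun y => X y ω) ν) ∧
    ∃ hg : MemLp (fun x => ∫ y, f y x ∂ν) q μ,
      (fun ω => ∫ y, X y ω ∂ν) =ᵐ[P] hΛ.stochasticIntegral hK (hg.toLp _) := by
  set I := hΛ.stochasticIntegral hK with hI
  have hIint : Integrable (fun y => I ((hfq y).toLp (f y))) ν := I.integrable_comp hint
  have hIX : ∀ᵐ y ∂ν, I ((hfq y).toLp (f y)) =ᵐ[P] X y := ae_of_all _ fun y =>
    (hΛ.ae_eq_stochasticIntegral hK (hf.comp measurable_prodMk_left) (hfq y) (hXf y)).symm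
  -- Bochner and pointwise integrals are identified twice, in `L^q(μ)` for the integrands and in
  -- `L¹(P)` for the field; the continuous map `I` links the two.
  have h1 := integral_Lp_ae_eq hf hint (ae_of_all _ fun y => (hfq y).coeFn_toLp)
  have h2 := integral_Lp_ae_eq hX hIint hIX
  have h3 := integrable_uncurry_of_integrable_Lp hX hIint hIX (measure_lt_top P univ)
  rw [Measure.restrict_univ] at h3
  have hg : MemLp (fun x => ∫ y, f y x ∂ν) q μ := (memLp_congr_ae h1).1 (Lp.memLp _)
  refine ⟨h3.prod_left_ae, hg, ?_⟩
  have h4 : hg.toLp _ = ∫ y, (hfq y).toLp (f y) ∂ν :=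
    Lp.ext (hg.coeFn_toLp.trans h1.symm)
  rw [h4, ← I.integral_comp_comm hint]
  exact h2.symm

end StochasticFubini

/-! ### The supCAR kernel in `L^q` -/

section Kernel

variable {d : ℕ}

/-- The mass of `exp (-‖·‖)` on `ℝ^d`. -/
noncomputable def expMass (d : ℕ) : ℝ := ∫ u : EuclideanSpace ℝ (Fin d), Real.exp (-‖u‖)

lemma expMass_nonneg : 0 ≤ expMass d := integral_nonneg fun _ => (Real.exp_pos _).le

lemma integral_exp_neg_mul_norm {c : ℝ} (hc : 0 < c) :
    ∫ u : EuclideanSpace ℝ (Fin d), Real.exp (-c * ‖u‖) = (c ^ d)⁻¹ * expMass d := by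
  have h := Measure.integral_comp_smul (volume : Measure (EuclideanSpace ℝ (Fin d)))
    (fun u => Real.exp (-‖u‖)) c
  rw [finrank_euclideanSpace_fin, abs_of_pos (by positivity), smul_eq_mul] at h
  rw [expMass, ← h]
  simp [norm_smul, abs_of_pos hc]

lemma integral_exp_neg_mul_norm_sub {c : ℝ} (hc : 0 < c) (t : EuclideanSpace ℝ (Fin d)) :
    ∫ u : EuclideanSpace ℝ (Fin d), Real.exp (-c * ‖t - u‖) = (c ^ d)⁻¹ * expMass d := by
  rw [← integral_exp_neg_mul_norm hc]
  exact integral_sub_left_eq_self (fun u : EuclideanSpace ℝ (Fin d) => Real.exp (-c * ‖u‖)) volume t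

/-- A function that dominates the kernels `supCARKernel t` for `t` in a unit ball. -/
noncomputable def kernelBound (t₀ : EuclideanSpace ℝ (Fin d)) (x : ℝ × EuclideanSpace ℝ (Fin d)) :
    ℝ :=
  1 / (2 * x.1) * (Metric.closedBall t₀ 2).indicator (fun _ => 1) x.2 +
    1 / (2 * x.1) * Real.exp (-(x.1 / 2) * ‖t₀ - x.2‖)

lemma measurable_uncurry_supCARKernel : Measurable (Function.uncurry (supCARKernel (d := d))) := by
  simp only [Function.uncurry_def, supCARKernel]
  fun_prop

lemma measurable_supCARKernel (t : EuclideanSpace ℝ (Fin d)) : Measurable (supCARKernel t) :=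
  measurable_uncurry_supCARKernel.comp measurable_prodMk_left

/-- If `‖t₀ - u‖ ≤ 2` the exponential is bounded by `1`; otherwise `‖t - u‖ ≥ ‖t₀ - u‖ - 1 ≥ ‖t₀ -
u‖ / 2`. -/
lemma norm_supCARKernel_le {t t₀ : EuclideanSpace ℝ (Fin d)} (h : ‖t - t₀‖ ≤ 1) {r : ℝ}
    (hr : 0 < r) (u : EuclideanSpace ℝ (Fin d)) :
    ‖supCARKernel t (r, u)‖ ≤ kernelBound t₀ (r, u) := by
  have e : ‖supCARKernel t (r, u)‖ = 1 / (2 * r) * Real.exp (-r * ‖t - u‖) := by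
    rw [supCARKernel, norm_mul, norm_neg, Real.norm_of_nonneg (by positivity),
      Real.norm_of_nonneg (Real.exp_pos _).le]
  rw [e, kernelBound, ← mul_add]
  refine mul_le_mul_of_nonneg_left ?_ (by positivity)
  by_cases hu : u ∈ Metric.closedBall t₀ 2
  · rw [indicator_of_mem hu]
    have h1 : Real.exp (-r * ‖t - u‖) ≤ 1 := Real.exp_le_one_iff.2 (by
      have := mul_nonneg hr.le (norm_nonneg (t - u)); linarith)
    have h3 := Real.exp_pos (-(r / 2) * ‖t₀ - u‖)
    linarith
  · rw [indicator_of_notMem hu, zero_add]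
    refine Real.exp_le_exp.2 ?_
    rw [Metric.mem_closedBall, not_le, dist_eq_norm, norm_sub_rev] at hu
    have h1 : ‖t₀ - u‖ ≤ ‖t - u‖ + 1 := by
      calc ‖t₀ - u‖ = ‖(t - u) - (t - t₀)‖ := by congr 1; abel
        _ ≤ ‖t - u‖ + ‖t - t₀‖ := norm_sub_le _ _
        _ ≤ _ := by linarith
    simp only
    nlinarith

variable [NeZero d]

lemma integrable_exp_neg_mul_norm {c : ℝ} (hc : 0 < c) :
    Integrable fun u : EuclideanSpace ℝ (Fin d) => Real.exp (-c * ‖u‖) := by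
  refine (integrable_fun_norm_addHaar (μ := (volume : Measure (EuclideanSpace ℝ (Fin d))))
    (f := fun r => Real.exp (-c * r))).2 ?_
  have h : IntegrableOn (fun x : ℝ => x ^ ((d - 1 : ℕ) : ℝ) * Real.exp (-c * x)) (Ioi 0) := by
    have h0 : (-1 : ℝ) < ((d - 1 : ℕ) : ℝ) := lt_of_lt_of_le (by norm_num) (Nat.cast_nonneg _)
    simpa using integrableOn_rpow_mul_exp_neg_mul_rpow (p := 1) h0 one_pos hc
  refine h.congr_fun (fun x _ => ?_) measurableSet_Ioi
  simp

lemma integrable_exp_neg_norm :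
    Integrable fun u : EuclideanSpace ℝ (Fin d) => Real.exp (-‖u‖) := by
  simpa using integrable_exp_neg_mul_norm (d := d) one_pos

/-- Polar coordinates: `d` times the volume of the unit ball times `Γ(d)`. This is where the Gamma
factors of `c7` originate. -/
lemma expMass_eq : expMass d =
    2 * (Real.pi ^ ((d : ℝ) / 2) * Real.Gamma d / Real.Gamma ((d : ℝ) / 2)) := by
  have hd : 0 < d := Nat.pos_of_ne_zero (NeZero.ne d)
  have hd' : (0 : ℝ) < d := by exact_mod_cast hd
  rw [expMass, integral_fun_norm_addHaar (volume : Measure (EuclideanSpace ℝ (Fin d)))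
    (fun r => Real.exp (-r)), finrank_euclideanSpace_fin, measureReal_def,
    EuclideanSpace.volume_ball, Real.Gamma_eq_integral hd']
  have e : ∫ y in Ioi (0 : ℝ), y ^ (d - 1) • Real.exp (-y) =
      ∫ x in Ioi (0 : ℝ), Real.exp (-x) * x ^ ((d : ℝ) - 1) := by
    refine setIntegral_congr_fun measurableSet_Ioi fun x _ => ?_
    have : ((d : ℝ) - 1) = ((d - 1 : ℕ) : ℝ) := by rw [Nat.cast_sub hd]; simp
    simp only [smul_eq_mul]
    rw [this, Real.rpow_natCast, mul_comm]
  rw [e]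
  have hG : Real.Gamma ((d : ℝ) / 2 + 1) = d / 2 * Real.Gamma ((d : ℝ) / 2) :=
    Real.Gamma_add_one (by positivity)
  have hGpos : 0 < Real.Gamma ((d : ℝ) / 2) := Real.Gamma_pos_of_pos (by positivity)
  have hs : √Real.pi ^ d = Real.pi ^ ((d : ℝ) / 2) := by
    rw [Real.sqrt_eq_rpow, ← Real.rpow_natCast, ← Real.rpow_mul Real.pi_pos.le]
    congr 1; ring
  rw [Fintype.card_fin, ENNReal.ofReal_one, one_pow, one_mul, ENNReal.toReal_ofReal
    (by rw [hG]; positivity), hG, hs]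
  simp only [nsmul_eq_mul, smul_eq_mul]
  field_simp

lemma integrable_exp_neg_mul_norm_sub {c : ℝ} (hc : 0 < c) (t : EuclideanSpace ℝ (Fin d)) :
    Integrable fun u : EuclideanSpace ℝ (Fin d) => Real.exp (-c * ‖t - u‖) :=
  (integrable_exp_neg_mul_norm hc).comp_sub_left t

variable {π : Measure ℝ} [IsFiniteMeasure π] {q : ℝ≥0∞}

/-- Integrating out `u`, the `q`-th power of the exponential term is a multiple of `r ^ (-(q + d))`
and that of the ball term a multiple of `r ^ (-q)`, which is at most `1 + r ^ (-(q + d))`. -/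
lemma memLp_kernelBound (h0 : q ≠ 0) (ht : q ≠ ∞) (hpos : ∀ᵐ r ∂π, 0 < r)
    (hint : Integrable (fun r : ℝ => r ^ (-(q.toReal + d))) π) (t₀ : EuclideanSpace ℝ (Fin d)) :
    MemLp (kernelBound t₀) q (π.prod volume) := by
  have hq : 0 < q.toReal := ENNReal.toReal_pos h0 ht
  have hd : (0 : ℝ) ≤ d := Nat.cast_nonneg d
  have hint' : Integrable (fun r : ℝ => r ^ (-q.toReal)) π := by
    refine ((integrable_const (1 : ℝ)).add hint).mono' (by fun_prop) ?_
    filter_upwards [hpos] with r hr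
    rw [Real.norm_of_nonneg (by positivity)]
    simp only [Pi.add_apply]
    rcases le_total 1 r with h | h
    · have := Real.rpow_le_one_of_one_le_of_nonpos h (neg_nonpos.2 hq.le)
      have : 0 ≤ r ^ (-(q.toReal + d)) := by positivity
      linarith
    · have := Real.rpow_le_rpow_of_exponent_ge hr h (by linarith : -(q.toReal + d) ≤ -q.toReal)
      linarith
  refine MemLp.add ?_ ?_
  · have hm : AEStronglyMeasurable (fun x : ℝ × EuclideanSpace ℝ (Fin d) =>
        1 / (2 * x.1) * (Metric.closedBall t₀ 2).indicator (fun _ => (1 : ℝ)) x.2)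
        (π.prod volume) := by
      refine Measurable.aestronglyMeasurable (Measurable.mul (by fun_prop) ?_)
      exact (measurable_const.indicator measurableSet_closedBall).comp measurable_snd
    refine (integrable_norm_rpow_iff hm h0 ht).1 ?_
    have h1 : Integrable ((Metric.closedBall t₀ 2).indicator fun _ => (1 : ℝ)) volume :=
      (integrable_indicator_iff measurableSet_closedBall).2
        (integrableOn_const measure_closedBall_lt_top.ne)
    refine ((hint'.const_mul ((1 / 2) ^ q.toReal)).mul_prod h1).congr ?_
    have hpos' : ∀ᵐ x ∂(π.prod (volume : Measure (EuclideanSpace ℝ (Fin d)))), 0 < x.1 :=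
      Measure.quasiMeasurePreserving_fst.ae hpos
    filter_upwards [hpos'] with x hx
    by_cases hu : x.2 ∈ Metric.closedBall t₀ 2
    · rw [indicator_of_mem hu, mul_one, mul_one, Real.norm_of_nonneg (by positivity),
        Real.rpow_neg hx.le, ← Real.inv_rpow hx.le, ← Real.mul_rpow (by norm_num) (by positivity)]
      congr 1; field_simp
    · rw [indicator_of_notMem hu, mul_zero, mul_zero, norm_zero, Real.zero_rpow hq.ne']
  · have hm : AEStronglyMeasurable (fun x : ℝ × EuclideanSpace ℝ (Fin d) =>
        1 / (2 * x.1) * Real.exp (-(x.1 / 2) * ‖t₀ - x.2‖)) (π.prod volume) := by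
      refine Measurable.aestronglyMeasurable (by fun_prop)
    refine (integrable_norm_rpow_iff hm h0 ht).1 ?_
    have e : ∀ r : ℝ, 0 < r → ∀ u : EuclideanSpace ℝ (Fin d),
        ‖1 / (2 * r) * Real.exp (-(r / 2) * ‖t₀ - u‖)‖ ^ q.toReal =
          (1 / 2) ^ q.toReal * r ^ (-q.toReal) * Real.exp (-(q.toReal * r / 2) * ‖t₀ - u‖) := by
      intro r hr u
      rw [Real.norm_of_nonneg (by positivity), Real.mul_rpow (by positivity) (Real.exp_pos _).le,
        ← Real.exp_mul, Real.rpow_neg hr.le, ← Real.inv_rpow hr.le,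
        ← Real.mul_rpow (by norm_num) (by positivity)]
      congr 2
      · field_simp
      · ring
    refine (integrable_prod_iff (hm.norm.aemeasurable.pow_const _).aestronglyMeasurable).2 ⟨?_, ?_⟩
    · filter_upwards [hpos] with r hr
      simp_rw [e r hr]
      exact (integrable_exp_neg_mul_norm_sub (by positivity) t₀).const_mul _
    · refine (hint.const_mul ((1 / 2) ^ q.toReal * ((q.toReal / 2) ^ d)⁻¹ * expMass d)).congr ?_
      filter_upwards [hpos] with r hr
      have e2 : ∀ u : EuclideanSpace ℝ (Fin d),
          ‖‖1 / (2 * r) * Real.exp (-(r / 2) * ‖t₀ - u‖)‖ ^ q.toReal‖ =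
          (1 / 2) ^ q.toReal * r ^ (-q.toReal) * Real.exp (-(q.toReal * r / 2) * ‖t₀ - u‖) := by
        intro u
        rw [Real.norm_of_nonneg (by positivity), e r hr]
      simp_rw [e2]
      rw [integral_const_mul, integral_exp_neg_mul_norm_sub (by positivity), neg_add,
        Real.rpow_add hr, Real.rpow_neg hr.le d, Real.rpow_natCast, mul_div_right_comm, mul_pow,
        mul_inv]
      ring

lemma memLp_supCARKernel (h0 : q ≠ 0) (ht : q ≠ ∞) (hpos : ∀ᵐ r ∂π, 0 < r)
    (hint : Integrable (fun r : ℝ => r ^ (-(q.toReal + d))) π) (t : EuclideanSpace ℝ (Fin d)) :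
    MemLp (supCARKernel t) q (π.prod volume) := by
  refine (memLp_kernelBound h0 ht hpos hint t).mono'
    (measurable_supCARKernel t).aestronglyMeasurable ?_
  have hpos' : ∀ᵐ x ∂(π.prod (volume : Measure (EuclideanSpace ℝ (Fin d)))), 0 < x.1 :=
    Measure.quasiMeasurePreserving_fst.ae hpos
  filter_upwards [hpos'] with x hx
  exact norm_supCARKernel_le (by simp) hx x.2

/-- Continuity into `L^q` makes the family of kernels Bochner integrable over compact sets, as the
stochastic Fubini theorem requires. -/
lemma continuous_toLp_supCARKernel [Fact (1 ≤ q)] (h0 : q ≠ 0) (ht : q ≠ ∞) (hpos : ∀ᵐ r ∂π, 0 < r)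
    (hint : Integrable (fun r : ℝ => r ^ (-(q.toReal + d))) π) :
    Continuous fun t : EuclideanSpace ℝ (Fin d) =>
      (memLp_supCARKernel h0 ht hpos hint t).toLp (supCARKernel t) := by
  refine continuous_iff_continuousAt.2 fun t₀ => ?_
  refine (Lp.tendsto_Lp_iff_tendsto_eLpNorm'' _ _ _ _).2 ?_
  have hpos' : ∀ᵐ x ∂(π.prod (volume : Measure (EuclideanSpace ℝ (Fin d)))), 0 < x.1 :=
    Measure.quasiMeasurePreserving_fst.ae hpos
  refine tendsto_eLpNorm_of_dominated h0 ht
    (Eventually.of_forall fun t => (measurable_supCARKernel t).aestronglyMeasurable)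
    (measurable_supCARKernel t₀).aestronglyMeasurable (memLp_kernelBound h0 ht hpos hint t₀) ?_ ?_ ?_
  · filter_upwards [Metric.closedBall_mem_nhds t₀ one_pos] with t htt
    filter_upwards [hpos'] with x hx
    exact norm_supCARKernel_le (by simpa [dist_eq_norm] using htt) hx x.2
  · filter_upwards [hpos'] with x hx
    exact norm_supCARKernel_le (by simp) hx x.2
  · refine ae_of_all _ fun x => ?_
    have : Continuous fun t => supCARKernel t x := by unfold supCARKernel; fun_prop
    exact this.tendsto t₀

end Kernel

/-! ### Mixing measures with regularly varying density at zero -/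

section Mixing

variable {l : ℝ → ℝ} {α : ℝ} {π : Measure ℝ}

lemma ae_pos_of_eq_withDensity
    (hπ : π = (volume.restrict (Ioi (0 : ℝ))).withDensity
      (fun r => ENNReal.ofReal (l (1 / r) * r ^ (α - 1)))) : ∀ᵐ r ∂π, 0 < r := by
  rw [hπ]
  exact (withDensity_absolutelyContinuous _ _).ae_le (ae_restrict_mem measurableSet_Ioi)

lemma measurable_mixing_density (hl : IsSlowlyVarying l) :
    Measurable fun r : ℝ => l (1 / r) * r ^ (α - 1) :=
  (hl.measurable.comp (by fun_prop)).mul (by fun_prop)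

lemma setIntegral_mixing (hl : IsSlowlyVarying l) (hl_pos : ∀ x, 0 < x → 0 < l x)
    (hπ : π = (volume.restrict (Ioi (0 : ℝ))).withDensity
      (fun r => ENNReal.ofReal (l (1 / r) * r ^ (α - 1)))) {s : Set ℝ} (hs : MeasurableSet s)
    (G : ℝ → ℂ) :
    ∫ r in s, G r ∂π =
      ∫ r in Ioi 0, s.indicator (fun r => ((l (1 / r) * r ^ (α - 1) : ℝ) : ℂ) * G r) r := by
  rw [hπ, restrict_withDensity hs, integral_withDensity_eq_integral_toReal_smul
    (measurable_mixing_density hl).ennreal_ofReal (by simp), integral_indicator hs,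
    Measure.restrict_restrict hs]
  refine setIntegral_congr_ae (hs.inter measurableSet_Ioi) (ae_of_all _ fun r hr => ?_)
  have h : 0 < l (1 / r) * r ^ (α - 1) :=
    mul_pos (hl_pos _ (one_div_pos.2 hr.2)) (Real.rpow_pos_of_pos hr.2 _)
  rw [ENNReal.toReal_ofReal h.le, Complex.real_smul]

/-- Near zero, `l (1 / r) ≤ C r ^ (-(α - s) / 2)` spends half of the gap between `s` and `α`; away
from zero `r ^ (-s)` is bounded and `π` is finite. -/
lemma integrable_rpow_neg_mixing [IsFiniteMeasure π] (hl : IsSlowlyVarying l)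
    (hl_pos : ∀ x, 0 < x → 0 < l x)
    (hπ : π = (volume.restrict (Ioi (0 : ℝ))).withDensity
      (fun r => ENNReal.ofReal (l (1 / r) * r ^ (α - 1)))) {s : ℝ} (hs : 0 ≤ s) (hsα : s < α) :
    Integrable (fun r : ℝ => r ^ (-s)) π := by
  obtain ⟨X, C, hX, hC, hXC⟩ := hl.exists_le_rpow (δ := (α - s) / 2) (by linarith)
  have hX0 : 0 < X := by linarith
  rw [← integrableOn_univ, ← Iic_union_Ioi (a := 1 / X)]
  refine IntegrableOn.union ?_ ?_
  · have hd : IntegrableOn (fun r : ℝ => C * r ^ ((α - s) / 2 - 1)) (Ioc 0 (1 / X)) := by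
      have := (intervalIntegral.intervalIntegrable_rpow' (a := 0) (b := 1 / X)
        (r := (α - s) / 2 - 1) (by linarith)).const_mul C
      rwa [intervalIntegrable_iff_integrableOn_Ioc_of_le (by positivity)] at this
    rw [IntegrableOn, hπ, restrict_withDensity measurableSet_Iic,
      integrable_withDensity_iff (measurable_mixing_density hl).ennreal_ofReal (by simp),
      Measure.restrict_restrict measurableSet_Iic, inter_comm, Ioi_inter_Iic]
    refine hd.mono' (Measurable.aestronglyMeasurable ?_) ?_
    · exact (by fun_prop : Measurable fun r : ℝ => r ^ (-s)).mul
        (measurable_mixing_density hl).ennreal_ofReal.ennreal_toReal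
    · filter_upwards [ae_restrict_mem measurableSet_Ioc] with r hr
      have hr0 := hr.1
      have hXr : X ≤ 1 / r := by rw [le_div_iff₀ hr0, mul_comm, ← le_div_iff₀ hX0]; exact hr.2
      have h := (hXC _ hXr).2.1
      have h0 := hl_pos (1 / r) (one_div_pos.2 hr0)
      rw [ENNReal.toReal_ofReal (by positivity), Real.norm_of_nonneg (by positivity)]
      calc r ^ (-s) * (l (1 / r) * r ^ (α - 1))
          ≤ r ^ (-s) * (C * (1 / r) ^ ((α - s) / 2) * r ^ (α - 1)) := by gcongr
        _ = C * (r ^ (-s) * r ^ (-((α - s) / 2)) * r ^ (α - 1)) := by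
          rw [one_div, Real.inv_rpow hr0.le, ← Real.rpow_neg hr0.le]; ring
        _ = C * r ^ ((α - s) / 2 - 1) := by
          rw [← Real.rpow_add hr0, ← Real.rpow_add hr0]; ring_nf
  · refine (integrable_const (X ^ s)).mono' (by fun_prop) ?_
    filter_upwards [ae_restrict_mem measurableSet_Ioi] with r hr
    have hr0 : 0 < r := lt_trans (by positivity) hr
    rw [Real.norm_of_nonneg (by positivity), Real.rpow_neg hr0.le, ← Real.inv_rpow hr0.le]
    refine Real.rpow_le_rpow (by positivity) ?_ hs
    rw [inv_le_comm₀ hr0 hX0, ← one_div]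
    exact le_of_lt hr

/-- Rescaled integrals of a regularly varying density at zero converge to integrals of a power. -/
theorem tendsto_mul_integral_mixing [IsFiniteMeasure π] {δ : ℝ} (hδ : 0 < δ) (hα : 0 < α)
    (hl : IsSlowlyVarying l) (hl_pos : ∀ x, 0 < x → 0 < l x)
    (hπ : π = (volume.restrict (Ioi (0 : ℝ))).withDensity
      (fun r => ENNReal.ofReal (l (1 / r) * r ^ (α - 1)))) {g : ℝ → ℝ}
    (hg : IsDeBruijnConjugate (fun x => (l (x ^ (δ / α))) ^ (-(1 / δ))) g)
    {J : ℝ → ℝ → ℂ} {J' : ℝ → ℂ} {a b C : ℝ} (ha₀ : 0 ≤ a) (ha : a < α) (hb : α < b)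
    (hJm : ∀ T, Measurable (J T)) (hJa : ∀ T r, 0 < r → ‖J T r‖ ≤ C * r ^ (-a))
    (hJb : ∀ T r, 0 < r → ‖J T r‖ ≤ C * r ^ (-b))
    (hJ : ∀ r, 0 < r → Tendsto (fun T => J T r) atTop (𝓝 (J' r))) :
    Tendsto (fun T : ℝ => ((T ^ δ : ℝ) : ℂ) * ∫ r, J T ((T * g T) ^ (δ / α) * r) ∂π) atTop
      (𝓝 (∫ r in Ioi 0, ((r ^ (α - 1) : ℝ) : ℂ) * J' r)) := by
  have hC : 0 ≤ C := by simpa using (norm_nonneg _).trans (hJa 0 1 one_pos)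
  set R : ℝ → ℝ := fun T => (T * g T) ^ (δ / α) with hRdef
  have hgp : ∀ᶠ T in atTop, 0 < g T := hg.slowlyVarying.eventually_pos
  have hTg : Tendsto (fun T => T * g T) atTop atTop := by
    simpa using hg.slowlyVarying.tendsto_rpow_mul_atTop (ε := 1) one_pos
  have hR : Tendsto R atTop atTop := (tendsto_rpow_atTop (by positivity)).comp hTg
  -- This is the conjugacy relation `g(T) f(T g(T)) → 1` raised to the power `-δ`.
  have hw : Tendsto (fun T => g T ^ (-δ) * l (R T)) atTop (𝓝 1) := by
    have h := (hg.tendsto_right.rpow_const (p := -δ) (Or.inl one_ne_zero))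
    rw [Real.one_rpow] at h
    refine h.congr' ?_
    filter_upwards [hgp, hR.eventually_gt_atTop 0] with T h1 h2
    have h3 := hl_pos _ h2
    rw [Real.mul_rpow h1.le (Real.rpow_pos_of_pos h3 _).le, ← Real.rpow_mul h3.le]
    congr 1
    rw [show -(1 / δ) * -δ = 1 by field_simp, Real.rpow_one]
  -- Potter's bounds cost a factor `r ^ (±η)`; `η` must fit both between `a` and `α` (integrability
  -- at zero) and between `α` and `b` (at infinity).
  obtain ⟨η, hη, hη1, hη2⟩ : ∃ η, 0 < η ∧ a + η < α ∧ α + η < b :=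
    ⟨min (α - a) (b - α) / 2, by
      have := lt_min (sub_pos.2 ha) (sub_pos.2 hb); linarith, by
      have := lt_min (sub_pos.2 ha) (sub_pos.2 hb)
      have := min_le_left (α - a) (b - α); linarith, by
      have := lt_min (sub_pos.2 ha) (sub_pos.2 hb)
      have := min_le_right (α - a) (b - α); linarith⟩
  obtain ⟨X, hX, hXpos, hXpot⟩ := hl.potter hη
  have hX0 : 0 < X := by linarith
  -- the integrand after rescaling
  set F : ℝ → ℝ → ℂ := fun T r => (Iic (R T / X)).indicator
    (fun r => ((g T ^ (-δ) * l (R T / r) * r ^ (α - 1) : ℝ) : ℂ) * J T r) r with hF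
  have hmain : Tendsto (fun T => ∫ r in Ioi 0, F T r) atTop
      (𝓝 (∫ r in Ioi 0, ((r ^ (α - 1) : ℝ) : ℂ) * J' r)) := by
    set B : ℝ → ℝ := fun r => (r ^ η + r ^ (-η)) * r ^ (α - 1) * min (r ^ (-a)) (r ^ (-b)) with hB
    have hBi : IntegrableOn (fun r => 2 * Real.exp η * C * B r) (Ioi 0) := by
      have key : ∀ ε : ℝ, |ε| ≤ η →
          IntegrableOn (fun r : ℝ => r ^ ε * r ^ (α - 1) * min (r ^ (-a)) (r ^ (-b))) (Ioi 0) := by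
        intro ε hε
        have := abs_le.1 hε
        refine integrableOn_Ioi_of_le_rpow (a := ε + (α - 1) + (-a)) (b := ε + (α - 1) + (-b))
          (A := 1) (B := 1) (Measurable.aestronglyMeasurable (by fun_prop)) (by linarith)
          (by linarith) ?_ ?_
        · intro v hv
          rw [Real.norm_of_nonneg (by positivity), one_mul, Real.rpow_add hv, Real.rpow_add hv]
          gcongr; exact min_le_left _ _
        · intro v hv
          rw [Real.norm_of_nonneg (by positivity), one_mul, Real.rpow_add hv, Real.rpow_add hv]
          gcongr; exact min_le_right _ _
      have h := ((key η (by rw [abs_of_pos hη])).add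
        (key (-η) (by rw [abs_neg, abs_of_pos hη]))).const_mul (2 * Real.exp η * C)
      refine h.congr (ae_of_all _ fun r => ?_)
      simp only [Pi.add_apply, hB]; ring
    refine tendsto_integral_filter_of_dominated_convergence _ ?_ ?_ hBi ?_
    · refine Eventually.of_forall fun T => Measurable.aestronglyMeasurable ?_
      refine Measurable.indicator ?_ measurableSet_Iic
      refine Measurable.mul (Complex.measurable_ofReal.comp ?_) (hJm T)
      exact (measurable_const.mul (hl.measurable.comp (by fun_prop))).mul (by fun_prop)
    · filter_upwards [hgp, hR.eventually_ge_atTop X, hw.eventually (gt_mem_nhds one_lt_two)]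
        with T h1 h2 h3
      filter_upwards [ae_restrict_mem measurableSet_Ioi] with r (hr : 0 < r)
      have hR0 : 0 < R T := by linarith
      have hB0 : 0 ≤ B r := by simp only [hB]; positivity
      by_cases hrX : r ∈ Iic (R T / X)
      · have hXr : X ≤ R T / r := by
          rw [le_div_iff₀ hr, mul_comm, ← le_div_iff₀ hX0]; exact hrX
        have hpot : l (R T / r) ≤ Real.exp η * (r ^ η + r ^ (-η)) * l (R T) := by
          have hlR := hl_pos _ hR0
          rcases le_total (R T) (R T / r) with h | h
          · refine (hXpot _ _ h2 h).1.trans ?_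
            have : R T / r / R T = r⁻¹ := by field_simp
            rw [this, Real.inv_rpow hr.le, ← Real.rpow_neg hr.le]
            gcongr
            have : 0 < r ^ η := by positivity
            linarith
          · refine (hXpot _ _ hXr h).2.trans ?_
            have : R T / (R T / r) = r := by field_simp
            rw [this]
            gcongr
            have : 0 < r ^ (-η) := by positivity
            linarith
        have hlr := hl_pos _ (div_pos hR0 hr)
        have hlR := hl_pos _ hR0
        have hmin : ‖J T r‖ ≤ C * min (r ^ (-a)) (r ^ (-b)) := by
          rw [mul_min_of_nonneg _ _ hC]
          exact le_min (hJa T r hr) (hJb T r hr)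
        simp only [hF]
        rw [indicator_of_mem hrX, norm_mul, Complex.norm_real, Real.norm_of_nonneg (by positivity)]
        calc g T ^ (-δ) * l (R T / r) * r ^ (α - 1) * ‖J T r‖
            ≤ g T ^ (-δ) * (Real.exp η * (r ^ η + r ^ (-η)) * l (R T)) * r ^ (α - 1) *
              (C * min (r ^ (-a)) (r ^ (-b))) := by gcongr
          _ = (g T ^ (-δ) * l (R T)) * (Real.exp η * C * B r) := by simp only [hB]; ring
          _ ≤ 2 * (Real.exp η * C * B r) := by gcongr
          _ = _ := by ring
      · simp only [hF]
        rw [indicator_of_notMem hrX, norm_zero]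
        positivity
    · filter_upwards [ae_restrict_mem measurableSet_Ioi] with r (hr : 0 < r)
      have h1 : Tendsto (fun T => g T ^ (-δ) * l (R T / r)) atTop (𝓝 1) := by
        have h := hw.mul ((hl.tendsto_ratio r⁻¹ (inv_pos.2 hr)).comp hR)
        rw [mul_one] at h
        refine h.congr' ?_
        filter_upwards [hR.eventually_gt_atTop 0] with T hT
        have := hl_pos _ hT
        simp only [Function.comp]
        rw [inv_mul_eq_div]
        field_simp
      have h2 : Tendsto (fun T => ((g T ^ (-δ) * l (R T / r) * r ^ (α - 1) : ℝ) : ℂ) * J T r) atTop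
          (𝓝 (((1 * r ^ (α - 1) : ℝ) : ℂ) * J' r)) :=
        ((Complex.continuous_ofReal.tendsto _).comp (h1.mul_const _)).mul (hJ r hr)
      rw [one_mul] at h2
      refine h2.congr' ?_
      filter_upwards [hR.eventually_ge_atTop (X * r)] with T hT
      simp only [hF]
      rw [indicator_of_mem]
      rw [mem_Iic, le_div_iff₀ hX0, mul_comm]; exact hT
  -- For `r > 1 / X` Potter's bounds do not reach `l (1 / r)`. There the bound by `(R T) ^ (-b)` and
  -- the finiteness of `π` suffice: `T ^ δ (R T) ^ (-b)` tends to zero because `b > α`.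
  have hrem : Tendsto (fun T : ℝ => ((T ^ δ : ℝ) : ℂ) *
      ∫ r in Ioi (1 / X), J T (R T * r) ∂π) atTop (𝓝 0) := by
    have hz : Tendsto (fun T : ℝ => T ^ δ * (C * (R T / X) ^ (-b) * π.real univ)) atTop (𝓝 0) := by
      have h : Tendsto (fun T : ℝ => (T ^ (1 - α / b) * g T) ^ (-(δ / α * b))) atTop (𝓝 0) :=
        (tendsto_rpow_neg_atTop (by have : 0 < b := by linarith
                                    positivity)).comp
          (hg.slowlyVarying.tendsto_rpow_mul_atTop (by
            rw [sub_pos, div_lt_one (by linarith)]; exact hb))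
      have h' := h.mul_const (C * X ^ b * π.real univ)
      rw [zero_mul] at h'
      refine h'.congr' ?_
      filter_upwards [hgp, eventually_gt_atTop 0] with T h1 h2
      have hb0 : b ≠ 0 := by linarith
      have e1 : (T ^ (1 - α / b) * g T) ^ (-(δ / α * b)) = T ^ δ * (R T) ^ (-b) := by
        simp only [hRdef]
        rw [← Real.rpow_mul (by positivity), Real.mul_rpow (by positivity) h1.le,
          Real.mul_rpow h2.le h1.le, ← Real.rpow_mul h2.le, ← mul_assoc, ← Real.rpow_add h2]
        congr 2
        · field_simp; ring
        · ring
      have hR0 : 0 < R T := by simp only [hRdef]; positivity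
      rw [e1, Real.div_rpow hR0.le hX0.le, Real.rpow_neg hX0.le, div_inv_eq_mul]
      ring
    refine squeeze_zero_norm' ?_ hz
    filter_upwards [hR.eventually_gt_atTop 0, eventually_gt_atTop 0] with T hT hT0
    rw [norm_mul, Complex.norm_real, Real.norm_of_nonneg (by positivity)]
    refine mul_le_mul_of_nonneg_left ?_ (by positivity)
    have hle : ‖∫ r in Ioi (1 / X), J T (R T * r) ∂π‖ ≤
        C * (R T / X) ^ (-b) * π.real (Ioi (1 / X)) := by
      refine norm_setIntegral_le_of_norm_le_const (measure_lt_top _ _) fun r hr => ?_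
      have hr' : 1 / X < r := hr
      have hr0 : 0 < r := lt_trans (by positivity) hr'
      refine (hJb T _ (by positivity)).trans ?_
      gcongr C * ?_
      refine Real.rpow_le_rpow_of_nonpos (by positivity) ?_ (by linarith)
      rw [div_eq_mul_one_div]
      gcongr
    refine hle.trans ?_
    have : π.real (Ioi (1 / X)) ≤ π.real univ := measureReal_mono (subset_univ _)
    gcongr
  have hsum := hmain.add hrem
  rw [add_zero] at hsum
  refine hsum.congr' ?_
  filter_upwards [hgp, hR.eventually_gt_atTop 0, eventually_gt_atTop 0] with T h1 h2 hT
  have hint : Integrable (fun r => J T (R T * r)) π := by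
    refine ((integrable_rpow_neg_mixing hl hl_pos hπ ha₀ ha).const_mul (C * R T ^ (-a))).mono'
      ((hJm T).comp (measurable_const_mul _)).aestronglyMeasurable ?_
    filter_upwards [ae_pos_of_eq_withDensity hπ] with r hr
    refine (hJa T _ (by positivity)).trans (le_of_eq ?_)
    rw [Real.mul_rpow h2.le hr.le, mul_assoc]
  have hsplit := integral_add_compl (measurableSet_Iic (a := 1 / X)) hint
  rw [compl_Iic] at hsplit
  rw [← hsplit, mul_add]
  congr 1
  rw [setIntegral_mixing hl hl_pos hπ measurableSet_Iic]
  have hscale := integral_comp_mul_left_Ioi (fun r => F T r) 0 h2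
  rw [mul_zero] at hscale
  have e : ∫ r in Ioi 0, F T r = ((R T : ℝ) : ℂ) * ∫ r in Ioi 0, F T (R T * r) := by
    rw [hscale, Complex.real_smul, ← mul_assoc, ← Complex.ofReal_mul, mul_inv_cancel₀ h2.ne',
      Complex.ofReal_one, one_mul]
  rw [e, ← integral_const_mul, ← integral_const_mul]
  refine setIntegral_congr_fun measurableSet_Ioi fun r (hr : 0 < r) => ?_
  simp only [hF]
  have hmem : R T * r ∈ Iic (R T / X) ↔ r ∈ Iic (1 / X) := by
    rw [mem_Iic, mem_Iic, div_eq_mul_one_div (R T), mul_le_mul_iff_right₀ h2]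
  by_cases hr1 : r ∈ Iic (1 / X)
  · rw [indicator_of_mem (hmem.2 hr1), indicator_of_mem hr1, ← mul_assoc, ← mul_assoc,
      ← Complex.ofReal_mul, ← Complex.ofReal_mul]
    congr 2
    have e1 : R T / (R T * r) = 1 / r := by field_simp
    have e2 : R T * (g T ^ (-δ) * l (1 / r) * (R T * r) ^ (α - 1)) =
        (R T * R T ^ (α - 1)) * g T ^ (-δ) * (l (1 / r) * r ^ (α - 1)) := by
      rw [Real.mul_rpow h2.le hr.le]; ring
    -- The scale `R` is chosen so that `R T ^ α = (T g(T)) ^ δ`: this produces the prefactor `T ^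
    -- δ`, and `g(T) ^ δ` cancels the normalisation of `l`.
    have e3 : R T * R T ^ (α - 1) = T ^ δ * g T ^ δ := by
      rw [← Real.rpow_one_add' h2.le (by linarith)]
      simp only [hRdef]
      rw [← Real.rpow_mul (by positivity), ← Real.mul_rpow hT.le h1.le]
      congr 1
      field_simp
      ring
    rw [e1, e2, e3, Real.rpow_neg h1.le, mul_assoc (T ^ δ), mul_inv_cancel₀ (by positivity), mul_one]
  · rw [indicator_of_notMem (fun h => hr1 (hmem.1 h)), indicator_of_notMem hr1, mul_zero, mul_zero]

end Mixing

/-! ### Stable exponents -/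

section StableExponent

/-- The cumulant function of the stable law with index `γ` and skewness governed by `W`. -/
noncomputable def stableExponent (W : Measure ℝ) (γ y : ℝ) : ℂ :=
  -((|y| ^ γ : ℝ) : ℂ) * stableOmega y γ (∫ x in Iio (0 : ℝ), |x| ^ γ ∂W)
    (∫ x in Ioi (0 : ℝ), |x| ^ γ ∂W)

variable {W : Measure ℝ} {p γ : ℝ}

lemma stableExponent_zero (hγ : γ ≠ 0) : stableExponent W γ 0 = 0 := by
  simp [stableExponent, Real.zero_rpow hγ]

lemma sign_mul_of_pos {a : ℝ} (ha : 0 < a) (y : ℝ) : Real.sign (a * y) = Real.sign y := by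
  rcases lt_trichotomy y 0 with h | h | h
  · rw [Real.sign_of_neg h, Real.sign_of_neg (mul_neg_of_pos_of_neg ha h)]
  · simp [h]
  · rw [Real.sign_of_pos h, Real.sign_of_pos (mul_pos ha h)]

lemma stableExponent_mul {a : ℝ} (ha : 0 < a) (y : ℝ) :
    stableExponent W γ (a * y) = ((a ^ γ : ℝ) : ℂ) * stableExponent W γ y := by
  unfold stableExponent stableOmega
  rw [sign_mul_of_pos ha, abs_mul, abs_of_pos ha, Real.mul_rpow ha.le (abs_nonneg y)]
  push_cast; ring

lemma integral_mul_sign_rpow (hγ₀ : γ ≠ 0) (hγ : Integrable (fun x : ℝ => |x| ^ γ) W) (a b : ℂ) :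
    ∫ x, ((|x| ^ γ : ℝ) : ℂ) * (a + b * (Real.sign x : ℂ)) ∂W =
      ((∫ x in Iio (0 : ℝ), |x| ^ γ ∂W : ℝ) : ℂ) * (a - b) +
        ((∫ x in Ioi (0 : ℝ), |x| ^ γ ∂W : ℝ) : ℂ) * (a + b) := by
  have e : ∀ x : ℝ, ((|x| ^ γ : ℝ) : ℂ) * (a + b * (Real.sign x : ℂ)) =
      (Iio (0 : ℝ)).indicator (fun x => ((|x| ^ γ : ℝ) : ℂ) * (a - b)) x +
        (Ioi (0 : ℝ)).indicator (fun x => ((|x| ^ γ : ℝ) : ℂ) * (a + b)) x := by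
    intro x
    rcases lt_trichotomy x 0 with h | h | h
    · rw [indicator_of_mem (mem_Iio.2 h), indicator_of_notMem (by simpa using h.le),
        Real.sign_of_neg h]
      push_cast; ring
    · simp [h, Real.zero_rpow hγ₀]
    · rw [indicator_of_mem (mem_Ioi.2 h), indicator_of_notMem (by simpa using h.le),
        Real.sign_of_pos h]
      push_cast; ring
  have hi : ∀ s : Set ℝ, MeasurableSet s → ∀ c : ℂ,
      Integrable (s.indicator fun x => ((|x| ^ γ : ℝ) : ℂ) * c) W := fun s hs c =>
    (hγ.ofReal.mul_const c).indicator hs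
  simp_rw [e]
  rw [integral_add (hi _ measurableSet_Iio _) (hi _ measurableSet_Ioi _),
    integral_indicator measurableSet_Iio, integral_indicator measurableSet_Ioi,
    integral_mul_const, integral_mul_const, integral_complex_ofReal, integral_complex_ofReal]

/-- Fubini in `(v, x)`, legitimate because the integrand is dominated by a product of `v ^ (-γ - 1)
min (v ^ p) (v ^ 2)` and a sum of `|x| ^ p` and `|x| ^ 2`, with `p < γ < 2`. The inner integral is
the Gamma integral at `-(y * x)`, and the sign of `x` separates the two half-line moments of `W`. -/
lemma integral_jumpCumulant_mul_rpow [SFinite W] (h1 : 1 ≤ p) (hpγ : p < γ) (h2 : γ < 2)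
    (hp : Integrable (fun x : ℝ => |x| ^ p) W) (hγ : Integrable (fun x : ℝ => |x| ^ γ) W)
    (hp2 : Integrable (fun x : ℝ => |x| ^ (2 : ℝ)) W) (y : ℝ) :
    ∫ v in Ioi (0 : ℝ), jumpCumulant W (-(y * v)) * ((v ^ (-γ - 1) : ℝ) : ℂ) =
      ((γ⁻¹ : ℝ) : ℂ) * stableExponent W γ y := by
  have hγ1 : 1 < γ := by linarith
  have hFub : Integrable (Function.uncurry fun (v x : ℝ) =>
      (Complex.exp (Complex.I * ((-(y * v) : ℝ) : ℂ) * x) - 1 -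
        Complex.I * ((-(y * v) : ℝ) : ℂ) * x) * ((v ^ (-γ - 1) : ℝ) : ℂ))
      ((volume.restrict (Ioi 0)).prod W) := by
    have hh : IntegrableOn (fun v : ℝ => v ^ (-γ - 1) * min (v ^ p) (v ^ (2 : ℝ))) (Ioi 0) := by
      refine integrableOn_Ioi_of_le_rpow (a := -γ - 1 + 2) (b := -γ - 1 + p) (A := 1) (B := 1)
        (Measurable.aestronglyMeasurable (by fun_prop)) (by linarith) (by linarith) ?_ ?_ <;>
      · intro v hv
        rw [Real.norm_of_nonneg (by positivity), one_mul, Real.rpow_add hv]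
        gcongr
        first | exact min_le_left _ _ | exact min_le_right _ _
    have hx : Integrable (fun x : ℝ => 3 * (|y| ^ p * |x| ^ p + |y| ^ (2 : ℝ) * |x| ^ (2 : ℝ))) W :=
      ((hp.const_mul _).add (hp2.const_mul _)).const_mul 3
    refine (Integrable.mul_prod hh hx).mono' (Measurable.aestronglyMeasurable ?_) ?_
    · simp only [Function.uncurry_def]
      fun_prop
    · have hpos : ∀ᵐ z ∂((volume.restrict (Ioi (0 : ℝ))).prod W), 0 < z.1 :=
        Measure.quasiMeasurePreserving_fst.ae (ae_restrict_mem measurableSet_Ioi)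
      filter_upwards [hpos] with z hz
      obtain ⟨v, x⟩ := z
      simp only [Function.uncurry_apply_pair] at hz ⊢
      rw [norm_mul, Complex.norm_real, Real.norm_of_nonneg (by positivity)]
      have b1 := norm_jump_integrand_le (-(y * v)) x h1 (by linarith : p ≤ 2)
      have b2 := norm_jump_integrand_le (-(y * v)) x one_le_two le_rfl
      have e : ∀ q : ℝ, |-(y * v)| ^ q = |y| ^ q * v ^ q := fun q => by
        rw [abs_neg, abs_mul, abs_of_pos hz, Real.mul_rpow (abs_nonneg _) hz.le]
      rw [e] at b1 b2
      set Nm := ‖Complex.exp (Complex.I * ((-(y * v) : ℝ) : ℂ) * x) - 1 -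
        Complex.I * ((-(y * v) : ℝ) : ℂ) * x‖
      have hA : 0 ≤ |y| ^ p * |x| ^ p := by positivity
      have hB : 0 ≤ |y| ^ (2 : ℝ) * |x| ^ (2 : ℝ) := by positivity
      have hvp : 0 < v ^ p := by positivity
      have hv2 : 0 < v ^ (2 : ℝ) := by positivity
      have key : Nm ≤ min (v ^ p) (v ^ (2 : ℝ)) *
          (3 * (|y| ^ p * |x| ^ p + |y| ^ (2 : ℝ) * |x| ^ (2 : ℝ))) := by
        rcases le_total (v ^ p) (v ^ (2 : ℝ)) with h | h
        · rw [min_eq_left h]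
          nlinarith [mul_nonneg hvp.le hB]
        · rw [min_eq_right h]
          nlinarith [mul_nonneg hv2.le hA]
      calc Nm * v ^ (-γ - 1) ≤ (min (v ^ p) (v ^ (2 : ℝ)) *
          (3 * (|y| ^ p * |x| ^ p + |y| ^ (2 : ℝ) * |x| ^ (2 : ℝ)))) * v ^ (-γ - 1) := by gcongr
        _ = _ := by ring
  have hswap := integral_integral_swap hFub
  simp only [jumpCumulant]
  simp_rw [← integral_mul_const]
  rw [hswap]
  have hinner : ∀ x : ℝ, ∫ v in Ioi (0 : ℝ),
      (Complex.exp (Complex.I * ((-(y * v) : ℝ) : ℂ) * x) - 1 -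
        Complex.I * ((-(y * v) : ℝ) : ℂ) * x) * ((v ^ (-γ - 1) : ℝ) : ℂ) =
      ((Real.Gamma (2 - γ) / (γ * (γ - 1)) * |y| ^ γ : ℝ) : ℂ) * (((|x| ^ γ : ℝ) : ℂ) *
        ((Real.cos (Real.pi * γ / 2) : ℝ) + (Complex.I * ((Real.sign y *
          Real.sin (Real.pi * γ / 2) : ℝ) : ℂ)) * (Real.sign x : ℂ))) := by
    intro x
    have h := integral_exp_I_remainder_mul_rpow hγ1 h2 (-(y * x))
    have e : ∀ v : ℝ, Complex.I * ((-(y * v) : ℝ) : ℂ) * x =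
        Complex.I * ((-(y * x) : ℝ) : ℂ) * v := fun v => by push_cast; ring
    have hs : Real.sign (-(y * x)) = -(Real.sign y * Real.sign x) := by
      rw [Real.sign_neg]
      rcases lt_trichotomy x 0 with h | h | h <;> rcases lt_trichotomy y 0 with h' | h' | h' <;>
        simp [h, h', Real.sign_of_neg, Real.sign_of_pos, mul_pos_of_neg_of_neg, mul_neg_of_neg_of_pos,
          mul_neg_of_pos_of_neg]
    simp_rw [e]
    rw [h, hs, abs_neg, abs_mul, Real.mul_rpow (abs_nonneg _) (abs_nonneg _)]
    push_cast; ring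
  simp_rw [hinner]
  rw [integral_const_mul, integral_mul_sign_rpow (by linarith) hγ, stableExponent, stableOmega,
    if_neg hγ1.ne']
  have hne : ((γ : ℝ) : ℂ) ≠ 0 := by exact_mod_cast (by linarith : γ ≠ 0)
  have hne1 : ((γ : ℝ) : ℂ) - 1 ≠ 0 := by
    have : ((γ - 1 : ℝ) : ℂ) ≠ 0 := by exact_mod_cast (by linarith : γ - 1 ≠ 0)
    simpa using this
  have hne2 : 1 - ((γ : ℝ) : ℂ) ≠ 0 := by rw [← neg_sub]; exact neg_ne_zero.2 hne1
  rw [show ((Real.Gamma (2 - γ) / (1 - γ) : ℝ) : ℂ) = -((Real.Gamma (2 - γ) / (γ - 1) : ℝ) : ℂ) by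
    rw [← Complex.ofReal_neg, ← div_neg, neg_sub]]
  push_cast
  field_simp
  ring

/-- Substitute `v = r ^ (-κ)`; the relation `α = γ κ` turns `r ^ (α - 1) dr` into a multiple of `v ^
(-γ - 1) dv`. -/
lemma integral_rpow_mul_jumpCumulant [SFinite W] {α κ : ℝ} (hκ : 0 < κ) (hα : α = γ * κ)
    (h1 : 1 ≤ p) (hpγ : p < γ) (h2 : γ < 2)
    (hp : Integrable (fun x : ℝ => |x| ^ p) W) (hγ : Integrable (fun x : ℝ => |x| ^ γ) W)
    (hp2 : Integrable (fun x : ℝ => |x| ^ (2 : ℝ)) W) (y : ℝ) :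
    ∫ r in Ioi (0 : ℝ), ((r ^ (α - 1) : ℝ) : ℂ) * jumpCumulant W (-(y * r ^ (-κ))) =
      ((α⁻¹ : ℝ) : ℂ) * stableExponent W γ y := by
  have h := integral_comp_rpow_Ioi
    (fun v => jumpCumulant W (-(y * v)) * ((v ^ (-γ - 1) : ℝ) : ℂ)) (neg_ne_zero.2 hκ.ne')
  rw [integral_jumpCumulant_mul_rpow h1 hpγ h2 hp hγ hp2] at h
  have e : ∫ r in Ioi (0 : ℝ), (|-κ| * r ^ (-κ - 1)) •
      (jumpCumulant W (-(y * r ^ (-κ))) * (((r ^ (-κ)) ^ (-γ - 1) : ℝ) : ℂ)) =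
      (κ : ℂ) * ∫ r in Ioi (0 : ℝ), ((r ^ (α - 1) : ℝ) : ℂ) * jumpCumulant W (-(y * r ^ (-κ))) := by
    rw [← integral_const_mul]
    refine setIntegral_congr_fun measurableSet_Ioi fun r (hr : 0 < r) => ?_
    rw [abs_neg, abs_of_pos hκ, ← Real.rpow_mul hr.le, Complex.real_smul,
      show α - 1 = (-κ - 1) + -κ * (-γ - 1) by rw [hα]; ring, Real.rpow_add hr]
    push_cast; ring
  rw [e] at h
  have hne : (κ : ℂ) ≠ 0 := by exact_mod_cast hκ.ne'
  rw [← mul_right_inj' hne, h, hα, mul_inv]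
  push_cast
  field_simp

end StableExponent

/-! ### Exponential smoothing -/

section Smoothing

variable {d : ℕ}

/-- Bounded measurable functions with bounded support. -/
structure IsWindow (φ : EuclideanSpace ℝ (Fin d) → ℝ) (M R : ℝ) : Prop where
  measurable : Measurable φ
  abs_le : ∀ v, |φ v| ≤ M
  eq_zero : ∀ v, R < ‖v‖ → φ v = 0

/-- The average of `φ` around `v` with weight `exp (-‖·‖)` on the scale `1 / N`. -/
noncomputable def smoothing (φ : EuclideanSpace ℝ (Fin d) → ℝ) (N : ℝ)
    (v : EuclideanSpace ℝ (Fin d)) : ℝ :=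
  ∫ w, φ (v + N⁻¹ • w) * Real.exp (-‖w‖)

variable {φ : EuclideanSpace ℝ (Fin d) → ℝ} {M R : ℝ}

lemma IsWindow.nonneg (hφ : IsWindow φ M R) : 0 ≤ M := (abs_nonneg _).trans (hφ.abs_le 0)

lemma IsWindow.abs_le_indicator (hφ : IsWindow φ M R) (v : EuclideanSpace ℝ (Fin d)) :
    |φ v| ≤ (Metric.closedBall 0 R).indicator (fun _ => M) v := by
  by_cases hv : v ∈ Metric.closedBall 0 R
  · rw [indicator_of_mem hv]; exact hφ.abs_le v
  · rw [indicator_of_notMem hv, hφ.eq_zero v (by simpa using hv), abs_zero]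

lemma IsWindow.integrable (hφ : IsWindow φ M R) : Integrable φ := by
  have h : Integrable ((Metric.closedBall (0 : EuclideanSpace ℝ (Fin d)) R).indicator fun _ => M) :=
    (integrable_indicator_iff measurableSet_closedBall).2
      (integrableOn_const measure_closedBall_lt_top.ne)
  exact h.mono' hφ.measurable.aestronglyMeasurable (ae_of_all _ hφ.abs_le_indicator)

lemma measurable_uncurry_smoothing (hφ : Measurable φ) :
    Measurable (Function.uncurry (smoothing φ)) := by
  have h : Measurable fun z : (ℝ × EuclideanSpace ℝ (Fin d)) × EuclideanSpace ℝ (Fin d) =>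
      φ (z.1.2 + z.1.1⁻¹ • z.2) * Real.exp (-‖z.2‖) :=
    (hφ.comp (by fun_prop)).mul (by fun_prop)
  exact h.stronglyMeasurable.integral_prod_right'.measurable

/-- The substitution is `y = T v + r⁻¹ w`, with Jacobian `r ^ (-d)`. -/
lemma integral_comp_inv_smul_mul_exp {T r : ℝ} (hT : 0 < T) (hr : 0 < r)
    (v : EuclideanSpace ℝ (Fin d)) :
    ∫ y, φ (T⁻¹ • y) * Real.exp (-r * ‖y - T • v‖) = (r ^ d)⁻¹ * smoothing φ (r * T) v := by
  have h1 := integral_add_left_eq_self (μ := (volume : Measure (EuclideanSpace ℝ (Fin d))))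
    (fun y => φ (T⁻¹ • y) * Real.exp (-r * ‖y - T • v‖)) (T • v)
  have h2 := Measure.integral_comp_smul (volume : Measure (EuclideanSpace ℝ (Fin d)))
    (fun y => φ (T⁻¹ • (T • v + y)) * Real.exp (-r * ‖T • v + y - T • v‖)) r⁻¹
  rw [finrank_euclideanSpace_fin, abs_of_pos (by positivity), smul_eq_mul, h1] at h2
  have h3 : smoothing φ (r * T) v = ((r⁻¹ ^ d)⁻¹) *
      ∫ y, φ (T⁻¹ • y) * Real.exp (-r * ‖y - T • v‖) := by
    rw [← h2, smoothing]
    refine integral_congr_ae (ae_of_all _ fun w => ?_)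
    simp only [smul_add, smul_smul, add_sub_cancel_left, norm_smul, norm_inv, Real.norm_of_nonneg hr.le]
    rw [inv_mul_cancel₀ hT.ne', one_smul, mul_inv, mul_comm r⁻¹, ← mul_assoc, neg_mul,
      mul_inv_cancel₀ hr.ne', neg_one_mul]
  rw [h3, inv_pow, inv_inv, ← mul_assoc, inv_mul_cancel₀ (by positivity), one_mul]

variable [NeZero d]

lemma abs_smoothing_le (hφ : IsWindow φ M R) (N : ℝ) (v : EuclideanSpace ℝ (Fin d)) :
    |smoothing φ N v| ≤ M * expMass d := by
  rw [← Real.norm_eq_abs, smoothing, expMass, ← integral_const_mul]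
  refine norm_integral_le_of_norm_le (integrable_exp_neg_norm.const_mul M)
    (ae_of_all _ fun w => ?_)
  rw [norm_mul, Real.norm_eq_abs, Real.norm_of_nonneg (Real.exp_pos _).le]
  gcongr
  exact hφ.abs_le _

lemma integrable_smoothing_integrand (hφ : IsWindow φ M R) (N : ℝ) :
    Integrable (fun z : EuclideanSpace ℝ (Fin d) × EuclideanSpace ℝ (Fin d) =>
      φ (z.1 + N⁻¹ • z.2) * Real.exp (-‖z.2‖)) (volume.prod volume) := by
  have hm : AEStronglyMeasurable (fun z : EuclideanSpace ℝ (Fin d) × EuclideanSpace ℝ (Fin d) =>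
      φ (z.1 + N⁻¹ • z.2) * Real.exp (-‖z.2‖)) (volume.prod volume) :=
    ((hφ.measurable.comp (by fun_prop)).mul (by fun_prop)).aestronglyMeasurable
  refine (integrable_prod_iff' hm).2 ⟨ae_of_all _ fun w => ?_, ?_⟩
  · exact (hφ.integrable.comp_add_right (N⁻¹ • w)).mul_const (Real.exp (-‖w‖))
  · refine (integrable_exp_neg_norm.const_mul (∫ v, ‖φ v‖)).congr (ae_of_all _ fun w => ?_)
    simp only [norm_mul, Real.norm_of_nonneg (Real.exp_pos _).le]
    rw [integral_mul_const, integral_add_right_eq_self (fun v => ‖φ v‖)]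

lemma integrable_smoothing (hφ : IsWindow φ M R) (N : ℝ) : Integrable (smoothing φ N) :=
  (integrable_smoothing_integrand hφ N).integral_prod_left

lemma integral_abs_smoothing_le (hφ : IsWindow φ M R) (N : ℝ) :
    ∫ v, |smoothing φ N v| ≤ (∫ v, |φ v|) * expMass d := by
  have hi := integrable_smoothing_integrand hφ N
  calc ∫ v, |smoothing φ N v| ≤ ∫ v, ∫ w, ‖φ (v + N⁻¹ • w) * Real.exp (-‖w‖)‖ :=
        integral_mono (integrable_smoothing hφ N).abs hi.integral_norm_prod_left
          fun v => norm_integral_le_integral_norm (fun w => φ (v + N⁻¹ • w) * Real.exp (-‖w‖))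
    _ = ∫ w, ∫ v, ‖φ (v + N⁻¹ • w) * Real.exp (-‖w‖)‖ := integral_integral_swap hi.norm
    _ = _ := by
      rw [expMass, ← integral_const_mul]
      refine integral_congr_ae (ae_of_all _ fun w => ?_)
      simp only [norm_mul, Real.norm_of_nonneg (Real.exp_pos _).le]
      rw [integral_mul_const, integral_add_right_eq_self (fun v => ‖φ v‖)]
      simp only [Real.norm_eq_abs]

lemma tendsto_smoothing (hφ : IsWindow φ M R) {v : EuclideanSpace ℝ (Fin d)}
    (hv : ContinuousAt φ v) :
    Tendsto (fun N => smoothing φ N v) atTop (𝓝 (φ v * expMass d)) := by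
  rw [expMass, ← integral_const_mul]
  refine tendsto_integral_filter_of_dominated_convergence (fun w => M * Real.exp (-‖w‖))
    (Eventually.of_forall fun N =>
      ((hφ.measurable.comp (by fun_prop)).mul (by fun_prop)).aestronglyMeasurable)
    (Eventually.of_forall fun N => ae_of_all _ fun w => ?_)
    (integrable_exp_neg_norm.const_mul M) (ae_of_all _ fun w => ?_)
  · rw [norm_mul, Real.norm_eq_abs, Real.norm_of_nonneg (Real.exp_pos _).le]
    gcongr
    exact hφ.abs_le _
  · refine Tendsto.mul_const _ (hv.tendsto.comp ?_)
    have h : Tendsto (fun N : ℝ => v + N⁻¹ • w) atTop (𝓝 (v + (0 : ℝ) • w)) :=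
      tendsto_const_nhds.add (tendsto_inv_atTop_zero.smul_const w)
    simpa using h

/-- Where `φ (v + N⁻¹ w)` is nonzero, `‖v‖ ≤ R + ‖w‖`. Half of the weight `exp (-‖w‖)` is traded for
decay in `v`, and the other half keeps the integral finite, uniformly in `N ≥ 1`. -/
lemma abs_smoothing_le_exp (hφ : IsWindow φ M R) {N : ℝ} (hN : 1 ≤ N)
    (v : EuclideanSpace ℝ (Fin d)) :
    |smoothing φ N v| ≤ M * Real.exp (R / 2) *
      (∫ w : EuclideanSpace ℝ (Fin d), Real.exp (-(1 / 2) * ‖w‖)) * Real.exp (-(1 / 2) * ‖v‖) := by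
  have hM := hφ.nonneg
  rw [← Real.norm_eq_abs, smoothing, mul_right_comm, ← integral_const_mul]
  refine norm_integral_le_of_norm_le
    ((integrable_exp_neg_mul_norm (by norm_num)).const_mul _) (ae_of_all _ fun w => ?_)
  rw [norm_mul, Real.norm_eq_abs, Real.norm_of_nonneg (Real.exp_pos _).le]
  rcases le_or_gt ‖v + N⁻¹ • w‖ R with h | h
  · rw [mul_assoc, mul_assoc, ← Real.exp_add, ← Real.exp_add]
    refine mul_le_mul (hφ.abs_le _) (Real.exp_le_exp.2 ?_) (Real.exp_pos _).le hM
    have h1 : ‖N⁻¹ • w‖ ≤ ‖w‖ := by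
      rw [norm_smul, norm_inv, Real.norm_of_nonneg (by linarith)]
      exact mul_le_of_le_one_left (norm_nonneg _) (inv_le_one_of_one_le₀ hN)
    have h2 : ‖v‖ ≤ ‖v + N⁻¹ • w‖ + ‖N⁻¹ • w‖ := by
      simpa using norm_sub_le (v + N⁻¹ • w) (N⁻¹ • w)
    linarith
  · rw [hφ.eq_zero _ h, abs_zero, zero_mul]
    positivity

/-- The integral of a cumulant function along a smoothed window. -/
noncomputable def spatialCumulant (K : ℝ → ℂ) (c : ℝ) (φ : EuclideanSpace ℝ (Fin d) → ℝ) (N : ℝ) :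
    ℂ :=
  ∫ v, K (-(c * smoothing φ N v))

variable {K : ℝ → ℂ} {p C : ℝ}

/-- Split `|smoothing| ^ p` into its `(p - 1)`-th power, bounded by the supremum, and one factor
bounded in `L¹`. Neither bound depends on `N`, so the dominating power of `c` holds at every scale.
-/
lemma norm_spatialCumulant_le (hφ : IsWindow φ M R) (hp : 1 ≤ p) (hC : 0 ≤ C)
    (hK : ∀ s, ‖K s‖ ≤ C * |s| ^ p) {c : ℝ} (hc : 0 ≤ c) (N : ℝ) :
    ‖spatialCumulant K c φ N‖ ≤
      C * ((M * expMass d) ^ (p - 1) * ((∫ v, |φ v|) * expMass d)) * c ^ p := by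
  have h : ∀ v, ‖K (-(c * smoothing φ N v))‖ ≤
      C * c ^ p * (M * expMass d) ^ (p - 1) * |smoothing φ N v| := by
    intro v
    refine (hK _).trans ?_
    rw [abs_neg, abs_mul, abs_of_nonneg hc, Real.mul_rpow hc (abs_nonneg _)]
    have e : |smoothing φ N v| ^ p = |smoothing φ N v| ^ (p - 1) * |smoothing φ N v| := by
      rw [← Real.rpow_add_one' (abs_nonneg _) (by linarith), sub_add_cancel]
    rw [e, ← mul_assoc, ← mul_assoc]
    have hp' : 0 ≤ p - 1 := by linarith
    gcongr
    exact abs_smoothing_le hφ N v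
  refine (norm_integral_le_of_norm_le ((integrable_smoothing hφ N).abs.const_mul _)
    (ae_of_all _ h)).trans ?_
  rw [integral_const_mul]
  have hE := hφ.nonneg
  have hm : 0 ≤ expMass d := expMass_nonneg
  calc C * c ^ p * (M * expMass d) ^ (p - 1) * ∫ v, |smoothing φ N v|
      ≤ C * c ^ p * (M * expMass d) ^ (p - 1) * ((∫ v, |φ v|) * expMass d) := by
        gcongr; exact integral_abs_smoothing_le hφ N
    _ = _ := by ring

lemma tendsto_spatialCumulant (hφ : IsWindow φ M R) (hφc : ∀ᵐ v, ContinuousAt φ v) (hp : 0 < p)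
    (hC : 0 ≤ C) (hKc : Continuous K) (hK : ∀ s, ‖K s‖ ≤ C * |s| ^ p) (c : ℝ) :
    Tendsto (fun N => spatialCumulant K c φ N) atTop
      (𝓝 (∫ v, K (-(c * (φ v * expMass d))))) := by
  set A := M * Real.exp (R / 2) * ∫ w : EuclideanSpace ℝ (Fin d), Real.exp (-(1 / 2) * ‖w‖) with hA
  have hA0 : 0 ≤ A := by
    have := hφ.nonneg
    have : 0 ≤ ∫ w : EuclideanSpace ℝ (Fin d), Real.exp (-(1 / 2) * ‖w‖) :=
      integral_nonneg fun w => (Real.exp_pos _).le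
    positivity
  refine tendsto_integral_filter_of_dominated_convergence
    (fun v => C * (|c| * A) ^ p * Real.exp (-(p / 2) * ‖v‖))
    (Eventually.of_forall fun N => ?_) ?_
    ((integrable_exp_neg_mul_norm (by positivity)).const_mul _) ?_
  · refine (hKc.measurable.comp ?_).aestronglyMeasurable
    exact (((measurable_uncurry_smoothing hφ.measurable).comp
      measurable_prodMk_left).const_mul c).neg
  · filter_upwards [eventually_ge_atTop 1] with N hN
    refine ae_of_all _ fun v => (hK _).trans ?_
    rw [mul_assoc]
    refine mul_le_mul_of_nonneg_left ?_ hC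
    have e : Real.exp (-(p / 2) * ‖v‖) = Real.exp (-(1 / 2) * ‖v‖) ^ p := by
      rw [← Real.exp_mul]; congr 1; ring
    rw [e, ← Real.mul_rpow (by positivity) (Real.exp_pos _).le]
    refine Real.rpow_le_rpow (abs_nonneg _) ?_ hp.le
    rw [abs_neg, abs_mul, mul_assoc]
    exact mul_le_mul_of_nonneg_left (abs_smoothing_le_exp hφ hN v) (abs_nonneg c)
  · filter_upwards [hφc] with v hv
    exact (hKc.tendsto _).comp (((tendsto_smoothing hφ hv).const_mul c).neg)

end Smoothing

/-! ### Asymptotics of the integrated cumulant function -/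

section WindowCumulant

variable {d : ℕ} {φ : EuclideanSpace ℝ (Fin d) → ℝ} {M R : ℝ} {π : Measure ℝ}

lemma integral_window_mul_supCARKernel {T r : ℝ} (hT : 0 < T) (hr : 0 < r)
    (v : EuclideanSpace ℝ (Fin d)) :
    ∫ y, φ (T⁻¹ • y) * supCARKernel y (r, T • v) =
      -(1 / 2 * r ^ (-((d : ℝ) + 1)) * smoothing φ (r * T) v) := by
  have h := integral_comp_inv_smul_mul_exp (φ := φ) hT hr v
  have e : ∀ y, φ (T⁻¹ • y) * supCARKernel y (r, T • v) =
      -(1 / (2 * r)) * (φ (T⁻¹ • y) * Real.exp (-r * ‖y - T • v‖)) := fun y => by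
    simp only [supCARKernel]; ring
  simp_rw [e]
  rw [integral_const_mul, h, neg_add, Real.rpow_add hr, Real.rpow_neg_one, Real.rpow_neg hr.le,
    Real.rpow_natCast]
  field_simp

lemma integral_prod_window [SFinite π] (hpos : ∀ᵐ r ∂π, 0 < r) {K : ℝ → ℂ} {T : ℝ} (hT : 0 < T)
    (a : ℝ) (hi : Integrable (fun x => K (a * ∫ y, φ (T⁻¹ • y) * supCARKernel y x))
      (π.prod volume)) :
    ∫ x, K (a * ∫ y, φ (T⁻¹ • y) * supCARKernel y x) ∂(π.prod volume) =
      ((T ^ (d : ℝ) : ℝ) : ℂ) *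
        ∫ r, spatialCumulant K (a / 2 * r ^ (-((d : ℝ) + 1))) φ (r * T) ∂π := by
  rw [integral_prod _ hi, ← integral_const_mul]
  refine integral_congr_ae ?_
  filter_upwards [hpos] with r hr
  have h := Measure.integral_comp_smul (volume : Measure (EuclideanSpace ℝ (Fin d)))
    (fun u => K (a * ∫ y, φ (T⁻¹ • y) * supCARKernel y (r, u))) T
  rw [finrank_euclideanSpace_fin, abs_of_pos (by positivity), Complex.real_smul] at h
  have hne : (((T ^ d)⁻¹ : ℝ) : ℂ) ≠ 0 := by
    exact_mod_cast (inv_pos.2 (pow_pos hT d)).ne'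
  rw [← mul_right_inj' hne, ← h, spatialCumulant, Real.rpow_natCast, ← mul_assoc,
    ← Complex.ofReal_mul, inv_mul_cancel₀ (by positivity), Complex.ofReal_one, one_mul]
  refine integral_congr_ae (ae_of_all _ fun v => ?_)
  simp only
  rw [integral_window_mul_supCARKernel hT hr]
  congr 1
  ring

lemma measurable_spatialCumulant (hφ : Measurable φ) {K : ℝ → ℂ} (hK : Continuous K)
    {f N : ℝ → ℝ} (hf : Measurable f) (hN : Measurable N) :
    Measurable fun r => spatialCumulant K (f r) φ (N r) := by
  have h : Measurable fun z : ℝ × EuclideanSpace ℝ (Fin d) =>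
      K (-(f z.1 * smoothing φ (N z.1) z.2)) :=
    hK.measurable.comp ((hf.comp measurable_fst).mul ((measurable_uncurry_smoothing hφ).comp
      ((hN.comp measurable_fst).prodMk measurable_snd))).neg
  exact h.stronglyMeasurable.integral_prod_right'.measurable

variable {W : Measure ℝ} {p γ α : ℝ}

/-- Fubini in `(r, v)`, then the one-dimensional formula for each `v`. The bounds of orders `p` and
`2` dominate for small and large `r`, and the bounded support of `φ` handles `v`. -/
lemma integral_rpow_mul_spatial [SFinite W] (hφ : IsWindow φ M R) (hα : α = γ * ((d : ℝ) + 1))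
    (h1 : 1 ≤ p) (hpγ : p < γ) (h2 : γ < 2)
    (hp : Integrable (fun x : ℝ => |x| ^ p) W) (hγ : Integrable (fun x : ℝ => |x| ^ γ) W)
    (hp2 : Integrable (fun x : ℝ => |x| ^ (2 : ℝ)) W) (c : ℝ) :
    ∫ r in Ioi (0 : ℝ), ((r ^ (α - 1) : ℝ) : ℂ) *
        ∫ v, jumpCumulant W (-(c * r ^ (-((d : ℝ) + 1)) * φ v)) =
      ((α⁻¹ : ℝ) : ℂ) * ∫ v, stableExponent W γ (c * φ v) := by
  have hd : (0 : ℝ) ≤ d := Nat.cast_nonneg d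
  have hM := hφ.nonneg
  have hKc := continuous_jumpCumulant h1 (by linarith) hp
  set C₁ := 3 * (∫ x, |x| ^ p ∂W) with hC₁
  set C₂ := 3 * (∫ x, |x| ^ (2 : ℝ) ∂W) with hC₂
  have hC₁0 : 0 ≤ C₁ := mul_nonneg (by norm_num) (integral_nonneg fun x => by positivity)
  have hC₂0 : 0 ≤ C₂ := mul_nonneg (by norm_num) (integral_nonneg fun x => by positivity)
  set A := max (C₁ * (|c| * M) ^ p) (C₂ * (|c| * M) ^ (2 : ℝ)) with hA
  have hA0 : 0 ≤ A := le_max_of_le_left (by positivity)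
  have hFub : Integrable (Function.uncurry fun (r : ℝ) (v : EuclideanSpace ℝ (Fin d)) =>
      ((r ^ (α - 1) : ℝ) : ℂ) * jumpCumulant W (-(c * r ^ (-((d : ℝ) + 1)) * φ v)))
      ((volume.restrict (Ioi 0)).prod volume) := by
    have hh : IntegrableOn (fun r : ℝ => r ^ (α - 1) *
        min (r ^ (-((d : ℝ) + 1) * p)) (r ^ (-((d : ℝ) + 1) * 2))) (Ioi 0) := by
      refine integrableOn_Ioi_of_le_rpow (a := α - 1 + -((d : ℝ) + 1) * p)
        (b := α - 1 + -((d : ℝ) + 1) * 2) (A := 1) (B := 1)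
        (Measurable.aestronglyMeasurable (by fun_prop)) (by rw [hα]; nlinarith)
        (by rw [hα]; nlinarith) ?_ ?_ <;>
      · intro v hv
        rw [Real.norm_of_nonneg (by positivity), one_mul, Real.rpow_add hv]
        gcongr
        first | exact min_le_left _ _ | exact min_le_right _ _
    have hx : Integrable
        ((Metric.closedBall (0 : EuclideanSpace ℝ (Fin d)) R).indicator fun _ => A) :=
      (integrable_indicator_iff measurableSet_closedBall).2
        (integrableOn_const measure_closedBall_lt_top.ne)
    refine (Integrable.mul_prod hh hx).mono' (Measurable.aestronglyMeasurable ?_) ?_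
    · simp only [Function.uncurry_def]
      refine Measurable.mul (by fun_prop) (hKc.measurable.comp ?_)
      exact (Measurable.mul (by fun_prop) (hφ.measurable.comp measurable_snd)).neg
    · have hpos : ∀ᵐ z ∂((volume.restrict (Ioi (0 : ℝ))).prod
          (volume : Measure (EuclideanSpace ℝ (Fin d)))), 0 < z.1 :=
        Measure.quasiMeasurePreserving_fst.ae (ae_restrict_mem measurableSet_Ioi)
      filter_upwards [hpos] with z hz
      obtain ⟨r, v⟩ := z
      simp only [Function.uncurry_apply_pair] at hz ⊢
      rw [norm_mul, Complex.norm_real, Real.norm_of_nonneg (by positivity),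
        mul_assoc (r ^ (α - 1))]
      refine mul_le_mul_of_nonneg_left ?_ (by positivity)
      by_cases hv : v ∈ Metric.closedBall (0 : EuclideanSpace ℝ (Fin d)) R
      · rw [indicator_of_mem hv]
        have e : ∀ q : ℝ, 0 ≤ q → |-(c * r ^ (-((d : ℝ) + 1)) * φ v)| ^ q ≤
            r ^ (-((d : ℝ) + 1) * q) * (|c| * M) ^ q := fun q hq => by
          rw [Real.rpow_mul hz.le, ← Real.mul_rpow (Real.rpow_pos_of_pos hz _).le
            (mul_nonneg (abs_nonneg c) hM)]
          refine Real.rpow_le_rpow (abs_nonneg _) ?_ hq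
          rw [abs_neg, abs_mul, abs_mul, abs_of_pos (Real.rpow_pos_of_pos hz _)]
          calc |c| * r ^ (-((d : ℝ) + 1)) * |φ v| ≤ |c| * r ^ (-((d : ℝ) + 1)) * M := by
                gcongr; exact hφ.abs_le v
            _ = _ := by ring
        rw [min_mul_of_nonneg _ _ hA0]
        refine le_min ?_ ?_
        · refine (norm_jumpCumulant_le h1 (by linarith) hp _).trans ?_
          calc C₁ * |-(c * r ^ (-((d : ℝ) + 1)) * φ v)| ^ p
              ≤ C₁ * (r ^ (-((d : ℝ) + 1) * p) * (|c| * M) ^ p) := by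
                gcongr; exact e p (by linarith)
            _ = r ^ (-((d : ℝ) + 1) * p) * (C₁ * (|c| * M) ^ p) := by ring
            _ ≤ _ := by gcongr; exact le_max_left _ _
        · refine (norm_jumpCumulant_le one_le_two le_rfl hp2 _).trans ?_
          calc C₂ * |-(c * r ^ (-((d : ℝ) + 1)) * φ v)| ^ (2 : ℝ)
              ≤ C₂ * (r ^ (-((d : ℝ) + 1) * 2) * (|c| * M) ^ (2 : ℝ)) := by
                gcongr; exact e 2 (by norm_num)
            _ = r ^ (-((d : ℝ) + 1) * 2) * (C₂ * (|c| * M) ^ (2 : ℝ)) := by ring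
            _ ≤ _ := by gcongr; exact le_max_right _ _
      · rw [indicator_of_notMem hv, hφ.eq_zero v (by simpa using hv), mul_zero, neg_zero,
          jumpCumulant_zero, norm_zero, mul_zero]
  simp_rw [← integral_const_mul]
  rw [integral_integral_swap hFub]
  refine integral_congr_ae (ae_of_all _ fun v => ?_)
  have h := integral_rpow_mul_jumpCumulant (by positivity : (0 : ℝ) < (d : ℝ) + 1) hα h1 hpγ h2 hp hγ
    hp2 (c * φ v)
  simp only
  rw [← h]
  refine setIntegral_congr_fun measurableSet_Ioi fun r _ => ?_
  rw [mul_right_comm]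

variable [NeZero d]

/-- The limit of the cumulant functions of the rescaled integrals of a supCAR field against a
window. -/
theorem tendsto_integral_window_cumulant [SFinite W] [IsFiniteMeasure π] (hφ : IsWindow φ M R)
    (hφc : ∀ᵐ v, ContinuousAt φ v) (hα : α = γ * ((d : ℝ) + 1)) (h1 : 1 ≤ p) (hpγ : p < γ)
    (h2 : γ < 2) (hp : Integrable (fun x : ℝ => |x| ^ p) W)
    (hγ : Integrable (fun x : ℝ => |x| ^ γ) W) (hp2 : Integrable (fun x : ℝ => |x| ^ (2 : ℝ)) W)
    {l : ℝ → ℝ} (hl : IsSlowlyVarying l) (hl_pos : ∀ x, 0 < x → 0 < l x)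
    (hπ : π = (volume.restrict (Ioi (0 : ℝ))).withDensity
      (fun r => ENNReal.ofReal (l (1 / r) * r ^ (α - 1)))) {g : ℝ → ℝ}
    (hg : IsDeBruijnConjugate (fun x => (l (x ^ ((d : ℝ) / α))) ^ (-(1 / (d : ℝ)))) g)
    {c : ℝ} (hc : 0 < c)
    (hi : ∀ᶠ T in atTop, Integrable (fun x => jumpCumulant W
      ((c * ((T * g T) ^ ((d : ℝ) / α)) ^ ((d : ℝ) + 1))⁻¹ *
        ∫ y, φ (T⁻¹ • y) * supCARKernel y x)) (π.prod volume)) :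
    Tendsto (fun T => ∫ x, jumpCumulant W
      ((c * ((T * g T) ^ ((d : ℝ) / α)) ^ ((d : ℝ) + 1))⁻¹ *
        ∫ y, φ (T⁻¹ • y) * supCARKernel y x) ∂(π.prod volume)) atTop
      (𝓝 (((α⁻¹ : ℝ) : ℂ) * ∫ v, stableExponent W γ (expMass d / (2 * c) * φ v))) := by
  have hd : (0 : ℝ) < d := by exact_mod_cast Nat.pos_of_ne_zero (NeZero.ne d)
  have hM := hφ.nonneg
  have hα0 : 0 < α := by rw [hα]; exact mul_pos (by linarith) (by linarith)
  have hdα : (d : ℝ) < α := by rw [hα]; nlinarith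
  have hKc := continuous_jumpCumulant h1 (by linarith) hp
  have hgp : ∀ᶠ T in atTop, 0 < g T := hg.slowlyVarying.eventually_pos
  set Q : ℝ → ℝ := fun T => (T * g T) ^ ((d : ℝ) / α) with hQ
  set K := jumpCumulant W with hK
  set J : ℝ → ℝ → ℂ := fun T r =>
    spatialCumulant K (1 / (2 * c) * r ^ (-((d : ℝ) + 1))) φ (r * (T / Q T)) with hJ
  -- `T / Q T` is the power `d / α` of the inverse of `T ^ (-(α / d - 1)) g(T)`, which tends to zero
  -- because `d < α`. Hence the smoothing scale shrinks for every fixed `r` after rescaling.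
  have hTQ : Tendsto (fun T => T / Q T) atTop atTop := by
    have hε : 0 < α / d - 1 := by rw [sub_pos, one_lt_div hd]; exact hdα
    have hs : Tendsto (fun T => T ^ (-(α / d - 1)) * g T) atTop (𝓝[>] 0) := by
      refine tendsto_nhdsWithin_iff.2 ⟨hg.slowlyVarying.tendsto_rpow_neg_mul hε, ?_⟩
      filter_upwards [hgp, eventually_gt_atTop 0] with T hT1 hT2
      exact mul_pos (Real.rpow_pos_of_pos hT2 _) hT1
    refine ((tendsto_rpow_atTop (y := (d : ℝ) / α) (by positivity)).comp
      hs.inv_tendsto_nhdsGT_zero).congr' ?_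
    filter_upwards [hgp, eventually_gt_atTop 0] with T hT1 hT2
    simp only [Function.comp, Pi.inv_apply, hQ]
    rw [Real.inv_rpow (by positivity), Real.mul_rpow (by positivity) hT1.le,
      Real.mul_rpow hT2.le hT1.le, ← Real.rpow_mul hT2.le, mul_inv, ← Real.rpow_neg hT2.le,
      ← div_div, ← div_eq_mul_inv]
    congr 1
    nth_rewrite 2 [← Real.rpow_one T]
    rw [← Real.rpow_sub hT2]
    congr 1
    field_simp
  -- Used for `q = p` and `q = 2`, giving exponents `(d + 1) p < α < (d + 1) 2` on the two sides of
  -- `α`.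
  have hb : ∀ q : ℝ, 1 ≤ q → q ≤ 2 → Integrable (fun x : ℝ => |x| ^ q) W →
      ∃ C : ℝ, ∀ T r, 0 < r → ‖J T r‖ ≤ C * r ^ (-(((d : ℝ) + 1) * q)) := by
    intro q hq1 hq2 hq
    refine ⟨3 * (∫ x, |x| ^ q ∂W) * ((M * expMass d) ^ (q - 1) * ((∫ v, |φ v|) * expMass d)) *
      (1 / (2 * c)) ^ q, fun T r hr => ?_⟩
    refine (norm_spatialCumulant_le hφ hq1
      (mul_nonneg (by norm_num) (integral_nonneg fun x => by positivity))
      (norm_jumpCumulant_le hq1 hq2 hq) (by positivity) _).trans (le_of_eq ?_)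
    rw [Real.mul_rpow (x := 1 / (2 * c)) (by positivity) (Real.rpow_pos_of_pos hr _).le,
      ← Real.rpow_mul hr.le, neg_mul, ← mul_assoc]
  obtain ⟨C₁, hC₁⟩ := hb p h1 (by linarith) hp
  obtain ⟨C₂, hC₂⟩ := hb 2 one_le_two le_rfl hp2
  have hlim := tendsto_mul_integral_mixing (J := J)
    (J' := fun r => ∫ v, K (-(1 / (2 * c) * r ^ (-((d : ℝ) + 1)) * (φ v * expMass d))))
    (a := ((d : ℝ) + 1) * p) (b := ((d : ℝ) + 1) * 2) (C := max C₁ C₂) hd hα0 hl hl_pos hπ hg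
    (by positivity) (by rw [hα]; nlinarith) (by rw [hα]; nlinarith)
    (fun T => measurable_spatialCumulant hφ.measurable hKc (by fun_prop) (by fun_prop))
    (fun T r hr => (hC₁ T r hr).trans (by gcongr; exact le_max_left _ _))
    (fun T r hr => (hC₂ T r hr).trans (by gcongr; exact le_max_right _ _))
    (fun r hr => (tendsto_spatialCumulant hφ hφc (by linarith : 0 < p)
      (mul_nonneg (by norm_num) (integral_nonneg fun x => by positivity)) hKc
      (norm_jumpCumulant_le h1 (by linarith) hp) _).comp (hTQ.const_mul_atTop hr))
  have hval := integral_rpow_mul_spatial hφ hα h1 hpγ h2 hp hγ hp2 (expMass d / (2 * c))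
  rw [← hval]
  have e1 : ∀ (r : ℝ) (v : EuclideanSpace ℝ (Fin d)),
      -(1 / (2 * c) * r ^ (-((d : ℝ) + 1)) * (φ v * expMass d)) =
      -(expMass d / (2 * c) * r ^ (-((d : ℝ) + 1)) * φ v) := fun r v => by ring
  simp_rw [e1] at hlim
  refine hlim.congr' ?_
  filter_upwards [hi, hgp, eventually_gt_atTop 0] with T hiT hgT hT
  have hQT : 0 < Q T := by simp only [hQ]; positivity
  rw [integral_prod_window (ae_pos_of_eq_withDensity hπ) hT _ hiT]
  congr 1
  refine integral_congr_ae ?_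
  filter_upwards [ae_pos_of_eq_withDensity hπ] with r hr
  change spatialCumulant K (1 / (2 * c) * (Q T * r) ^ (-((d : ℝ) + 1))) φ (Q T * r * (T / Q T)) =
    spatialCumulant K ((c * Q T ^ ((d : ℝ) + 1))⁻¹ / 2 * r ^ (-((d : ℝ) + 1))) φ (r * T)
  congr 1
  · rw [Real.mul_rpow hQT.le hr.le, Real.rpow_neg hQT.le, mul_inv]
    field_simp
  · field_simp

end WindowCumulant

/-! ### Lévy processes and nested sets -/

section Nested

/-- The sum of the entries of `θ` from the index `j` on. -/
noncomputable def tailSum {k : ℕ} (θ : Fin k → ℝ) (j : Fin k) : ℝ := ∑ i, if j ≤ i then θ i else 0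

lemma tailSum_zero {k : ℕ} (θ : Fin (k + 1) → ℝ) : tailSum θ 0 = ∑ i, θ i := by
  simp [tailSum]

lemma tailSum_succ {k : ℕ} (θ : Fin (k + 1) → ℝ) (j : Fin k) :
    tailSum θ j.succ = tailSum (fun i => θ i.succ) j := by
  simp [tailSum, Fin.sum_univ_succ]

/-- Summation by parts: the increment from index `j` to `j + 1` is counted by every endpoint at or
beyond `j + 1`. -/
lemma sum_mul_sub_eq_sum_tailSum {k : ℕ} (θ : Fin k → ℝ) (x : Fin (k + 1) → ℝ) :
    ∑ j, θ j * (x j.succ - x 0) = ∑ j, tailSum θ j * (x j.succ - x j.castSucc) := by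
  induction k with
  | zero => simp
  | succ k ih =>
    have h := ih (fun i => θ i.succ) (fun i => x i.succ)
    have h' : ∑ j : Fin k, tailSum θ j.succ * (x j.succ.succ - x j.succ.castSucc) =
        ∑ i : Fin k, θ i.succ * (x i.succ.succ - x (Fin.succ 0)) := by
      rw [h]
      exact Finset.sum_congr rfl fun j _ => by rw [tailSum_succ, Fin.succ_castSucc]
    have h₀ : x (Fin.castSucc 0) = x 0 := rfl
    rw [Fin.sum_univ_succ, Fin.sum_univ_succ (fun j => tailSum θ j * _), h', tailSum_zero,
      Fin.sum_univ_succ θ, add_mul, add_assoc (θ 0 * _), Finset.sum_mul, ← Finset.sum_add_distrib, h₀]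
    congr 1
    exact Finset.sum_congr rfl fun i _ => by ring

/-- On the shell between consecutive sets exactly the indicators from that index on are active, so
the sum equals `tailSum`. The induction peels off the innermost shell; outside all the sets the
integrand is `Ψ 0 = 0`. -/
lemma integral_nested_sets {E : Type*} [MeasurableSpace E] {μ : Measure E} {Ψ : ℝ → ℂ}
    (h0 : Ψ 0 = 0)
    {k : ℕ} (θ : Fin k → ℝ) (S : Fin (k + 1) → Set E) (hS : ∀ i, MeasurableSet (S i))
    (hSμ : ∀ i, μ (S i) ≠ ∞) (hmono : Monotone S) :
    IntegrableOn (fun v => Ψ (∑ i, (S i.succ).indicator (fun _ => θ i) v)) (S 0)ᶜ μ ∧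
    ∫ v in (S 0)ᶜ, Ψ (∑ i, (S i.succ).indicator (fun _ => θ i) v) ∂μ =
      ∑ j : Fin k, ((μ.real (S j.succ) - μ.real (S j.castSucc) : ℝ) : ℂ) * Ψ (tailSum θ j) := by
  induction k with
  | zero => simp [h0]
  | succ k ih =>
    obtain ⟨ih1, ih2⟩ := ih (fun i => θ i.succ) (fun i => S i.succ) (fun i => hS _) (fun i => hSμ _)
      (fun i j hij => hmono (Fin.succ_le_succ_iff.2 hij))
    set F : E → ℂ := fun v => Ψ (∑ i, (S i.succ).indicator (fun _ => θ i) v) with hF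
    have h01 : S 0 ⊆ S 1 := hmono (Fin.zero_le 1)
    have hsplit : (S 0)ᶜ = (S 1 \ S 0) ∪ (S 1)ᶜ := by
      ext v
      simp only [mem_compl_iff, mem_union, Set.mem_sdiff]
      constructor
      · intro h; by_cases h' : v ∈ S 1 <;> simp [h, h']
      · rintro (h | h)
        · exact h.2
        · exact fun h' => h (h01 h')
    have e1 : EqOn F (fun _ => Ψ (∑ i, θ i)) (S 1 \ S 0) := by
      intro v hv
      simp only [hF]
      congr 1
      refine Finset.sum_congr rfl fun i _ => ?_
      rw [indicator_of_mem]
      exact hmono (by rw [← Fin.succ_zero_eq_one]; exact Fin.succ_le_succ_iff.2 (Fin.zero_le _)) hv.1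
    have e2 : EqOn F (fun v => Ψ (∑ i : Fin k, (S i.succ.succ).indicator (fun _ => θ i.succ) v))
        (S 1)ᶜ := by
      intro v hv
      simp only [hF]
      rw [Fin.sum_univ_succ, indicator_of_notMem (by simpa using hv), zero_add]
    have hm : MeasurableSet (S 1 \ S 0) := (hS _).diff (hS _)
    have hμ : μ (S 1 \ S 0) ≠ ∞ := measure_ne_top_of_subset sdiff_subset (hSμ 1)
    have i1 : IntegrableOn F (S 1 \ S 0) μ :=
      (integrableOn_congr_fun e1 hm).2 (integrableOn_const hμ)
    have i2 : IntegrableOn F (S 1)ᶜ μ := (integrableOn_congr_fun e2 (hS 1).compl).2 ih1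
    refine ⟨by rw [hsplit]; exact i1.union i2, ?_⟩
    rw [hsplit, setIntegral_union (disjoint_compl_right.mono_left sdiff_subset) (hS 1).compl i1 i2,
      setIntegral_congr_fun hm e1, setIntegral_congr_fun (hS 1).compl e2, setIntegral_const,
      Fin.sum_univ_succ (fun j : Fin (k + 1) => (_ : ℂ) * Ψ (tailSum θ j)), tailSum_zero,
      measureReal_sdiff h01 (hS 0) (hSμ 1)]
    refine congrArg₂ _ ?_ ?_
    · rw [Complex.real_smul]; simp
    · refine ih2.trans (Finset.sum_congr rfl fun j _ => ?_)
      rw [tailSum_succ, Fin.succ_castSucc]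

variable {Ω : Type*} [MeasurableSpace Ω] {P : Measure Ω} {L : ℝ≥0 → Ω → ℝ}

/-- After summation by parts the terms are independent increments, with the same coefficients
`tailSum θ j` that appear on the shells of nested sets. -/
lemma SupCAR.IsLevyProcess.charFun_linearCombination (hL : IsLevyProcess P L) {Ψ : ℝ → ℂ}
    (hΨ : ∀ (t : ℝ≥0) (s : ℝ), charFun (P.map (L t)) s = Complex.exp ((t : ℝ) * Ψ s)) {k : ℕ}
    (θ : Fin k → ℝ) (τ : Fin (k + 1) → ℝ≥0) (hτ : Monotone τ) (hτ₀ : τ 0 = 0) :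
    charFun (P.map fun ω => ∑ j, θ j * L (τ j.succ) ω) 1 =
      Complex.exp (∑ j : Fin k,
        (((τ j.succ : ℝ) - (τ j.castSucc : ℝ) : ℝ) : ℂ) * Ψ (tailSum θ j)) := by
  have hae : (fun ω => ∑ j, θ j * L (τ j.succ) ω) =ᵐ[P]
      fun ω => ∑ j : Fin k, tailSum θ j * (L (τ j.succ) ω - L (τ j.castSucc) ω) := by
    filter_upwards [hL.zero] with ω hω
    rw [← sum_mul_sub_eq_sum_tailSum θ fun j => L (τ j) ω]
    simp only [hτ₀, hω, sub_zero]
  have hmeas : ∀ j : Fin k, Measurable fun ω => L (τ j.succ) ω - L (τ j.castSucc) ω := fun j =>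
    (hL.measurable _).sub (hL.measurable _)
  have hind : iIndepFun
      (fun (j : Fin k) ω => tailSum θ j * (L (τ j.succ) ω - L (τ j.castSucc) ω)) P :=
    (hL.indep_increments k τ hτ).comp (fun j x => tailSum θ j * x) fun j => measurable_const_mul _
  rw [Measure.map_congr hae, hind.charFun_map_fun_sum_eq_prod
    (fun j => ((hmeas j).const_mul _).aemeasurable), Finset.prod_apply, Complex.exp_sum]
  refine Finset.prod_congr rfl fun j _ => ?_
  have hle : τ j.castSucc ≤ τ j.succ := hτ (Fin.castSucc_lt_succ).le
  have hst := hL.stationary_increments (τ j.castSucc) (τ j.succ - τ j.castSucc)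
  rw [add_tsub_cancel_of_le hle] at hst
  have hmap : P.map (fun ω => tailSum θ j * (L (τ j.succ) ω - L (τ j.castSucc) ω)) =
      (P.map (L (τ j.succ - τ j.castSucc))).map fun x => tailSum θ j * x := by
    rw [← hst, Measure.map_map (measurable_const_mul _) (hmeas j)]
    rfl
  rw [hmap, charFun_map_mul, mul_one, hΨ, NNReal.coe_sub hle]

end Nested

/-! ### Dilations of a convex window -/

section Dilations

variable {d : ℕ}

/-- The frontier of a convex set is Lebesgue null. This allows the window to be replaced by its
compact closure. -/
lemma Convex.smul_ae_eq_smul_closure {D : Set (EuclideanSpace ℝ (Fin d))} (hD : Convex ℝ D) (r : ℝ) :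
    (r • D : Set (EuclideanSpace ℝ (Fin d))) =ᵐ[volume] (r • closure D : Set _) := by
  rw [← closure_smul₀]
  exact (closure_ae_eq_of_null_frontier ((hD.smul r).addHaar_frontier volume)).symm

lemma Convex.smul_subset_smul {D : Set (EuclideanSpace ℝ (Fin d))} (hD : Convex ℝ D) (h0 : 0 ∈ D)
    {a b : ℝ} (ha : 0 ≤ a) (hab : a ≤ b) : a • D ⊆ b • D := by
  rcases ha.eq_or_lt with h | h
  · rw [← h, zero_smul_set ⟨0, h0⟩]
    exact zero_subset.2 ⟨0, h0, smul_zero _⟩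
  · rintro _ ⟨x, hx, rfl⟩
    have hb : 0 < b := h.trans_le hab
    refine ⟨(a / b) • x, hD.smul_mem_of_zero_mem h0 hx ⟨by positivity, (div_le_one hb).2 hab⟩, ?_⟩
    simp only [smul_smul, mul_div_cancel₀ _ hb.ne']

lemma continuousAt_indicator_const {D : Set (EuclideanSpace ℝ (Fin d))} (c : ℝ)
    {v : EuclideanSpace ℝ (Fin d)} (hv : v ∉ frontier D) :
    ContinuousAt (D.indicator fun _ => c) v := by
  by_cases h : v ∈ interior D
  · refine continuousAt_const.congr (f := fun _ => c) ?_
    filter_upwards [isOpen_interior.mem_nhds h] with w hw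
    rw [indicator_of_mem (interior_subset hw)]
  · have h' : v ∈ (closure D)ᶜ := fun hc => hv ⟨hc, h⟩
    refine continuousAt_const.congr (f := fun _ => (0 : ℝ)) ?_
    filter_upwards [isClosed_closure.isOpen_compl.mem_nhds h'] with w hw
    rw [indicator_of_notMem fun hw' => hw (subset_closure hw')]

lemma ae_continuousAt_sum_indicator {k : ℕ} {S : Fin k → Set (EuclideanSpace ℝ (Fin d))}
    (hS : ∀ i, Convex ℝ (S i)) (θ : Fin k → ℝ) :
    ∀ᵐ v, ContinuousAt (fun v => ∑ i, (S i).indicator (fun _ => θ i) v) v := by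
  have h : ∀ᵐ v, ∀ i, v ∉ frontier (S i) := by
    rw [ae_all_iff]
    exact fun i => measure_eq_zero_iff_ae_notMem.1 ((hS i).addHaar_frontier volume)
  filter_upwards [h] with v hv
  exact tendsto_finsetSum _ fun i _ => continuousAt_indicator_const _ (hv i)

lemma exists_isWindow_sum_indicator {k : ℕ} {S : Fin k → Set (EuclideanSpace ℝ (Fin d))}
    (hS : ∀ i, IsCompact (S i)) (θ : Fin k → ℝ) :
    ∃ M R, IsWindow (fun v => ∑ i, (S i).indicator (fun _ => θ i) v) M R := by
  obtain ⟨R, hR⟩ := (isCompact_iUnion hS).isBounded.subset_closedBall 0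
  refine ⟨∑ i, |θ i|, R, Finset.measurable_sum _ fun i _ =>
    measurable_const.indicator (hS i).measurableSet, fun v => ?_, fun v hv => ?_⟩
  · refine (Finset.abs_sum_le_sum_abs _ _).trans (Finset.sum_le_sum fun i _ => ?_)
    by_cases h : v ∈ S i <;> simp [h]
  · refine Finset.sum_eq_zero fun i _ => indicator_of_notMem (fun h => ?_) _
    have := hR (mem_iUnion_of_mem i h)
    rw [mem_closedBall_zero_iff] at this
    linarith

variable [NeZero d]

lemma measureReal_rpow_smul (D : Set (EuclideanSpace ℝ (Fin d))) {t : ℝ} (ht : 0 ≤ t) :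
    volume.real ((t ^ (1 / (d : ℝ))) • D) = t * volume.real D := by
  rw [measureReal_def, Measure.addHaar_smul, finrank_euclideanSpace_fin, ENNReal.toReal_mul,
    ENNReal.toReal_ofReal (abs_nonneg _), abs_of_nonneg (by positivity), ← Real.rpow_natCast,
    ← Real.rpow_mul ht, one_div, inv_mul_cancel₀ (by simp [NeZero.ne d]), Real.rpow_one,
    measureReal_def]

lemma integral_dilations {D : Set (EuclideanSpace ℝ (Fin d))} (hD : Convex ℝ D) (hDc : IsCompact D)
    (h0 : 0 ∈ D) {Ψ : ℝ → ℂ} (hΨ : Ψ 0 = 0) {k : ℕ} (θ : Fin k → ℝ) (τ : Fin (k + 1) → ℝ≥0)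
    (hτ : Monotone τ) (hτ₀ : τ 0 = 0) :
    ∫ v, Ψ (∑ i : Fin k, (((τ i.succ : ℝ) ^ (1 / (d : ℝ))) • D).indicator (fun _ => θ i) v) =
      (volume.real D : ℂ) * ∑ j : Fin k,
        (((τ j.succ : ℝ) - (τ j.castSucc : ℝ) : ℝ) : ℂ) * Ψ (tailSum θ j) := by
  set S : Fin (k + 1) → Set (EuclideanSpace ℝ (Fin d)) :=
    fun j => ((τ j : ℝ) ^ (1 / (d : ℝ))) • D with hS
  have hSc : ∀ j, IsCompact (S j) := fun j => hDc.smul _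
  have h := (integral_nested_sets (μ := volume) hΨ θ S (fun j => (hSc j).measurableSet)
    (fun j => (hSc j).measure_lt_top.ne) (fun i j hij => hD.smul_subset_smul h0 (by positivity)
      (Real.rpow_le_rpow (by positivity) (hτ hij) (by positivity)))).2
  -- Since `τ 0 = 0`, the innermost dilate is null and the integral over its complement is the full
  -- integral.
  have hnull : ((S 0)ᶜ : Set (EuclideanSpace ℝ (Fin d))) =ᵐ[volume] (univ : Set _) := by
    rw [ae_eq_univ, compl_compl, ← measureReal_eq_zero_iff (hSc 0).measure_lt_top.ne]
    simp only [hS]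
    rw [measureReal_rpow_smul D (by positivity), hτ₀, NNReal.coe_zero, zero_mul]
  rw [setIntegral_congr_set hnull, setIntegral_univ] at h
  rw [h, Finset.mul_sum]
  refine Finset.sum_congr rfl fun j _ => ?_
  simp only [hS]
  rw [measureReal_rpow_smul D (by positivity), measureReal_rpow_smul D (by positivity)]
  push_cast; ring

/-- `c7` is tuned so that `expMass d / (2 * c7) = (α / |D|) ^ (1 / γ)`. By homogeneity of degree `γ`
this contributes `α / |D|`, cancelling both `α⁻¹` and the volume of `D`. -/
lemma integral_stableExponent_dilations {D : Set (EuclideanSpace ℝ (Fin d))} (hD : Convex ℝ D)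
    (hDc : IsCompact D) (h0 : 0 ∈ D) (hDpos : 0 < volume.real D) {W : Measure ℝ} {α γ : ℝ}
    (hα : 0 < α) (hγ : γ = α / ((d : ℝ) + 1)) {k : ℕ} (θ : Fin k → ℝ) (τ : Fin (k + 1) → ℝ≥0)
    (hτ : Monotone τ) (hτ₀ : τ 0 = 0) :
    ((α⁻¹ : ℝ) : ℂ) * ∫ v, stableExponent W γ (expMass d / (2 * c7 d α D) *
      ∑ i : Fin k, (((τ i.succ : ℝ) ^ (1 / (d : ℝ))) • D).indicator (fun _ => θ i) v) =
      ∑ j : Fin k, (((τ j.succ : ℝ) - (τ j.castSucc : ℝ) : ℝ) : ℂ) *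
        stableExponent W γ (tailSum θ j) := by
  have hd : (0 : ℝ) < d := by exact_mod_cast Nat.pos_of_ne_zero (NeZero.ne d)
  have hγ0 : 0 < γ := by rw [hγ]; positivity
  have hG1 : 0 < Real.Gamma d := Real.Gamma_pos_of_pos hd
  have hG2 : 0 < Real.Gamma ((d : ℝ) / 2) := Real.Gamma_pos_of_pos (by positivity)
  have hpi := Real.pi_pos
  have hκ : expMass d / (2 * c7 d α D) = (α / volume.real D) ^ (1 / γ) := by
    rw [expMass_eq, c7, hγ, one_div_div, Real.div_rpow hα.le hDpos.le]
    field_simp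
  have hκ0 : 0 < expMass d / (2 * c7 d α D) := by rw [hκ]; positivity
  simp_rw [stableExponent_mul hκ0]
  rw [integral_const_mul, integral_dilations hD hDc h0 (stableExponent_zero hγ0.ne') θ τ hτ hτ₀, hκ,
    ← Real.rpow_mul (by positivity), one_div_mul_cancel hγ0.ne', Real.rpow_one, ← mul_assoc,
    ← mul_assoc, ← Complex.ofReal_mul, ← Complex.ofReal_mul,
    show α⁻¹ * (α / volume.real D) * volume.real D = 1 by field_simp, Complex.ofReal_one, one_mul]

end Dilations

/-! ### Convergence in distribution through characteristic functions -/

section CharFun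

lemma charFun_map_toLp {Ω : Type*} [MeasurableSpace Ω] {P : Measure Ω} {k : ℕ} {V : Ω → Fin k → ℝ}
    (hV : Measurable V) (θ : EuclideanSpace ℝ (Fin k)) :
    charFun (P.map fun ω => WithLp.toLp 2 (V ω)) θ =
      charFun (P.map fun ω => ∑ i, θ i * V ω i) 1 := by
  have hm : Measurable fun ω => ∑ i, θ i * V ω i := by fun_prop
  rw [charFun_apply, charFun_apply, integral_map (by fun_prop) (by fun_prop),
    integral_map hm.aemeasurable (by fun_prop)]
  refine integral_congr_ae (ae_of_all _ fun ω => ?_)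
  simp [PiLp.inner_apply, mul_comm]

/-- Lévy's continuity theorem combined with the Cramér–Wold reduction. Euclidean space supplies the
inner product, and the continuous map `WithLp.ofLp` brings the convergence back to `Fin k → ℝ`. -/
lemma tendstoInDistribution_of_tendsto_charFun {Ω Ω' : Type*} [MeasurableSpace Ω]
    [MeasurableSpace Ω'] {P : Measure Ω} [IsProbabilityMeasure P] {P' : Measure Ω'}
    [IsProbabilityMeasure P'] {k : ℕ} {l : Filter ℝ} [l.IsCountablyGenerated]
    {Y : ℝ → Ω → Fin k → ℝ} {Z : Ω' → Fin k → ℝ} (hY : ∀ T, Measurable (Y T)) (hZ : Measurable Z)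
    (h : ∀ θ : Fin k → ℝ, Tendsto (fun T => charFun (P.map fun ω => ∑ i, θ i * Y T ω i) 1) l
      (𝓝 (charFun (P'.map fun ω => ∑ i, θ i * Z ω i) 1))) :
    TendstoInDistribution Y l Z (fun _ => P) P' := by
  have hE : TendstoInDistribution (fun T ω => WithLp.toLp 2 (Y T ω)) l
      (fun ω => WithLp.toLp 2 (Z ω)) (fun _ => P) P' := by
    refine ⟨fun T => (by fun_prop : Measurable fun ω => WithLp.toLp 2 (Y T ω)).aemeasurable,
      (by fun_prop : Measurable fun ω => WithLp.toLp 2 (Z ω)).aemeasurable, ?_⟩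
    refine tendsto_of_seq_tendsto fun u hu => ?_
    refine ProbabilityMeasure.tendsto_of_tendsto_charFun fun θ => ?_
    refine (((h θ).comp hu).congr fun n => ?_).trans_eq ?_
    · exact (charFun_map_toLp (hY (u n)) θ).symm
    · exact congrArg _ (charFun_map_toLp hZ θ).symm
  exact hE.continuous_comp (g := WithLp.ofLp) (by fun_prop)

end CharFun

/-! ### Integrated supCAR fields -/

section IntegratedField

lemma measurable_integratedField {Ω : Type*} [MeasurableSpace Ω] {P : Measure Ω} {d : ℕ}
    {π : Measure ℝ} {Λ : Set (ℝ × EuclideanSpace ℝ (Fin d)) → Ω → ℝ}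
    {X : EuclideanSpace ℝ (Fin d) → Ω → ℝ} (hX : IsSupCARField π P Λ X)
    (D : Set (EuclideanSpace ℝ (Fin d)))
    (T : ℝ) : Measurable (integratedField X D T) :=
  hX.measurable_uncurry.stronglyMeasurable.integral_prod_left'.measurable

lemma sum_integral_dilation_supCARKernel {d : ℕ} {D : Set (EuclideanSpace ℝ (Fin d))} (hD : Convex ℝ D)
    (hDb : Bornology.IsBounded D) {k : ℕ} (s θ : Fin k → ℝ) {T : ℝ} (hT : 0 < T) (a : ℝ)
    (x : ℝ × EuclideanSpace ℝ (Fin d)) :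
    ∑ i, θ i * a * ∫ y in (s i * T) • D, supCARKernel y x =
      a * ∫ y, (∑ i, (s i • closure D).indicator (fun _ => θ i) (T⁻¹ • y)) * supCARKernel y x := by
  have hc : Continuous fun y => supCARKernel y x := by unfold supCARKernel; fun_prop
  have hDc : IsCompact (closure D) := hDb.isCompact_closure
  have e : ∀ y, (∑ i, (s i • closure D).indicator (fun _ => θ i) (T⁻¹ • y)) * supCARKernel y x =
      ∑ i, ((s i * T) • closure D).indicator (fun y => θ i * supCARKernel y x) y := by
    intro y
    rw [Finset.sum_mul]
    refine Finset.sum_congr rfl fun i _ => ?_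
    have hmem : T⁻¹ • y ∈ s i • closure D ↔ y ∈ (s i * T) • closure D := by
      rw [mul_comm, mul_smul, mem_smul_set_iff_inv_smul_mem₀ hT.ne']
    by_cases h : y ∈ (s i * T) • closure D
    · rw [indicator_of_mem (hmem.2 h), indicator_of_mem h]
    · rw [indicator_of_notMem (fun h' => h (hmem.1 h')), indicator_of_notMem h, zero_mul]
  simp_rw [e]
  rw [integral_finsetSum _ fun i _ => (integrable_indicator_iff
    (hDc.smul (s i * T)).measurableSet).2 ((hc.const_mul (θ i)).continuousOn.integrableOn_compact
      (hDc.smul _)), Finset.mul_sum]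
  refine Finset.sum_congr rfl fun i _ => ?_
  rw [integral_indicator (hDc.smul (s i * T)).measurableSet, integral_const_mul,
    setIntegral_congr_set (hD.smul_ae_eq_smul_closure (s i * T))]
  ring

variable {α Ω : Type*} [MeasurableSpace α] [MeasurableSpace Ω] {μ : Measure α} {P : Measure Ω}
  [IsProbabilityMeasure P] {K : ℝ → ℂ} {Λ : Set α → Ω → ℝ} {q : ℝ≥0∞} {C : ℝ} [Fact (1 ≤ q)]

lemma SupCAR.IsScatteredRandomMeasure.exists_sum_ae_eq_stochasticIntegral
    (hΛ : IsScatteredRandomMeasure μ P K Λ) (hK : IsCumulantOfOrder K q C) {ι : Type*}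
    (s : Finset ι) {g : ι → α → ℝ} {Z : ι → Ω → ℝ} (hg : ∀ i, MemLp (g i) q μ)
    (hZ : ∀ i, Z i =ᵐ[P] hΛ.stochasticIntegral hK ((hg i).toLp (g i))) (c : ι → ℝ) :
    ∃ h : MemLp (fun x => ∑ i ∈ s, c i * g i x) q μ,
      (fun ω => ∑ i ∈ s, c i * Z i ω) =ᵐ[P] hΛ.stochasticIntegral hK (h.toLp _) := by
  classical
  set I := hΛ.stochasticIntegral hK with hI
  induction s using Finset.induction_on with
  | empty =>
    have h : MemLp (fun x => ∑ i ∈ (∅ : Finset ι), c i * g i x) q μ := by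
      simp
    refine ⟨h, ?_⟩
    have e : h.toLp _ = 0 :=
      (Lp.eq_zero_iff_ae_eq_zero).2 (h.coeFn_toLp.trans (ae_of_all _ fun x => by simp))
    rw [e, map_zero]
    filter_upwards [Lp.coeFn_zero ℝ 1 P] with ω hω
    rw [hω, Finset.sum_empty, Pi.zero_apply]
  | insert a s ha ih =>
    obtain ⟨h, hh⟩ := ih
    have h' : MemLp (fun x => ∑ i ∈ insert a s, c i * g i x) q μ := by
      simp_rw [Finset.sum_insert ha]
      exact ((hg a).const_mul (c a)).add h
    refine ⟨h', ?_⟩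
    have e : h'.toLp _ = c a • (hg a).toLp (g a) + h.toLp _ := by
      rw [← MemLp.toLp_const_smul, ← MemLp.toLp_add]
      exact MemLp.toLp_congr _ _ (ae_of_all _ fun x => by simp [Finset.sum_insert ha])
    rw [e, map_add, map_smul]
    have hZa : Z a =ᵐ[P] I ((hg a).toLp (g a)) := hZ a
    generalize I ((hg a).toLp (g a)) = U at hZa ⊢
    generalize I (h.toLp _) = V at hh ⊢
    filter_upwards [hh, hZa, Lp.coeFn_add (c a • U) V, Lp.coeFn_smul (c a) U] with ω h1 h2 h3 h4
    rw [Finset.sum_insert ha, h3, Pi.add_apply, h4, Pi.smul_apply, smul_eq_mul, ← h2, ← h1]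

variable {d : ℕ} [NeZero d] {π : Measure ℝ} [IsFiniteMeasure π]
  {Λ : Set (ℝ × EuclideanSpace ℝ (Fin d)) → Ω → ℝ} {X : EuclideanSpace ℝ (Fin d) → Ω → ℝ}

lemma SupCAR.IsSupCARField.integral_ae_eq_stochasticIntegral (hX : IsSupCARField π P Λ X)
    (hΛ : IsScatteredRandomMeasure (π.prod volume) P K Λ) (hK : IsCumulantOfOrder K q C)
    (hpos : ∀ᵐ r ∂π, 0 < r) (hint : Integrable (fun r : ℝ => r ^ (-(q.toReal + d))) π)
    {B : Set (EuclideanSpace ℝ (Fin d))} (hB : Bornology.IsBounded B) :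
    (∀ᵐ ω ∂P, IntegrableOn (fun y => X y ω) B) ∧
    ∃ hg : MemLp (fun x => ∫ y in B, supCARKernel y x) q (π.prod volume),
      (fun ω => ∫ y in B, X y ω) =ᵐ[P] hΛ.stochasticIntegral hK (hg.toLp _) :=
  hΛ.stochastic_fubini hK measurable_uncurry_supCARKernel
    (fun y => memLp_supCARKernel hK.ne_zero hK.ne_top hpos hint y)
    (((continuous_toLp_supCARKernel hK.ne_zero hK.ne_top hpos hint).continuousOn.integrableOn_compact
      hB.isCompact_closure).mono_set subset_closure) hX.measurable_uncurry hX.integral_eq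

/-- The linear combination of integrated fields is the stochastic integral of one deterministic
function, whose characteristic function is known. This reduces the theorem to an analytic limit. -/
lemma SupCAR.IsSupCARField.charFun_sum_integral (hX : IsSupCARField π P Λ X)
    (hΛ : IsScatteredRandomMeasure (π.prod volume) P K Λ) (hK : IsCumulantOfOrder K q C)
    (hpos : ∀ᵐ r ∂π, 0 < r) (hint : Integrable (fun r : ℝ => r ^ (-(q.toReal + d))) π)
    {k : ℕ} {B : Fin k → Set (EuclideanSpace ℝ (Fin d))} (hB : ∀ i, Bornology.IsBounded (B i))
    (c : Fin k → ℝ) :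
    Integrable (fun x => K (∑ i, c i * ∫ y in B i, supCARKernel y x)) (π.prod volume) ∧
    charFun (P.map fun ω => ∑ i, c i * ∫ y in B i, X y ω) 1 =
      Complex.exp (∫ x, K (∑ i, c i * ∫ y in B i, supCARKernel y x) ∂(π.prod volume)) := by
  choose hg hgX using fun i => (hX.integral_ae_eq_stochasticIntegral hΛ hK hpos hint (hB i)).2
  obtain ⟨h, hh⟩ := hΛ.exists_sum_ae_eq_stochasticIntegral hK Finset.univ hg hgX c
  have hm : Measurable fun x => ∑ i, c i * ∫ y in B i, supCARKernel y x := by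
    refine Finset.measurable_sum _ fun i _ => Measurable.const_mul ?_ _
    exact measurable_uncurry_supCARKernel.stronglyMeasurable.integral_prod_left'.measurable
  refine ⟨by simpa using hK.integrable h 1, ?_⟩
  rw [Measure.map_congr hh, hΛ.charFun_stochasticIntegral hK hm h]
  simp

end IntegratedField

theorem theorem7
    -- dimension and index
    (d : ℕ) (hd : 1 ≤ d) (α : ℝ) (hα₁ : (d : ℝ) + 1 < α) (hα₂ : α < 2 * (d : ℝ) + 2)
    -- the probability measure on the half-line
    (l : ℝ → ℝ) (hl : IsSlowlyVarying l) (hl_pos : ∀ x, 0 < x → 0 < l x)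
    (hl_bdd : ∀ C : Set ℝ, IsCompact C → C ⊆ Ioi 0 → ∃ M : ℝ, ∀ x ∈ C, l x ≤ M)
    (π : Measure ℝ) [IsProbabilityMeasure π]
    (hπ : π = (volume.restrict (Ioi (0 : ℝ))).withDensity
      (fun r => ENNReal.ofReal (l (1 / r) * r ^ (α - 1))))
    -- the Lévy measure
    (W : Measure ℝ) (hW : IsLevyMeasure W) (hW₂ : ∫⁻ x, ENNReal.ofReal (x ^ 2) ∂W < ∞)
    (β : ℝ) (hβ : blumenthalGetoorIndex W = β) (hβ₀ : 0 < β) (hβ₁ : β < α / ((d : ℝ) + 1))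
    (cp cm : ℝ) (hcp : 0 < cp) (hcm : 0 < cm)
    (hW_pos : (fun x : ℝ => W.real (Ici x)) ~[𝓝[>] 0] (fun x : ℝ => cp * x ^ (-β)))
    (hW_neg : (fun x : ℝ => W.real (Iic (-x))) ~[𝓝[>] 0] (fun x : ℝ => cm * x ^ (-β)))
    -- the observation window
    (Δ : Set (EuclideanSpace ℝ (Fin d))) (hΔ_convex : Convex ℝ Δ)
    (hΔ_bdd : Bornology.IsBounded Δ) (hΔ_zero : 0 ∈ interior Δ)
    -- the random measure and the supCAR field
    {Ω : Type*} [MeasurableSpace Ω] (P : Measure Ω) [IsProbabilityMeasure P]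
    (Λ : Set (ℝ × EuclideanSpace ℝ (Fin d)) → Ω → ℝ)
    (hΛ : IsScatteredRandomMeasure (π.prod volume) P (jumpCumulant W) Λ)
    (X : EuclideanSpace ℝ (Fin d) → Ω → ℝ) (hX : IsSupCARField π P Λ X)
    -- the de Bruijn conjugate
    (lsharp : ℝ → ℝ)
    (hlsharp : IsDeBruijnConjugate
      (fun x => (l (x ^ ((d : ℝ) / α))) ^ (-(1 / (d : ℝ)))) lsharp)
    -- the limit process
    {Ω' : Type*} [MeasurableSpace Ω'] (P' : Measure Ω') [IsProbabilityMeasure P']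
    (L : ℝ≥0 → Ω' → ℝ) (hL : IsLevyProcess P' L)
    (hL_stable : ∀ (t : ℝ≥0) (s : ℝ), charFun (P'.map (L t)) s =
      Complex.exp (-(((t : ℝ) * |s| ^ (α / ((d : ℝ) + 1)) : ℝ) : ℂ) *
        stableOmega s (α / ((d : ℝ) + 1))
          (∫ y in Iio (0 : ℝ), |y| ^ (α / ((d : ℝ) + 1)) ∂W)
          (∫ y in Ioi (0 : ℝ), |y| ^ (α / ((d : ℝ) + 1)) ∂W))) :
    -- the integrated field is well defined
    (∀ T : ℝ, 0 ≤ T → ∀ᵐ ω ∂P, IntegrableOn (fun y => X y ω) (T • Δ)) ∧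
    -- the moments in the skewness constants are finite
    IntegrableOn (fun y : ℝ => |y| ^ (α / ((d : ℝ) + 1))) (Iio 0) W ∧
    IntegrableOn (fun y : ℝ => |y| ^ (α / ((d : ℝ) + 1))) (Ioi 0) W ∧
    -- convergence of all finite-dimensional distributions
    ∀ (k : ℕ) (t : Fin k → ℝ≥0), (∀ i, t i ≤ 1) →
      TendstoInDistribution
        (fun (T : ℝ) (ω : Ω) (i : Fin k) =>
          (c7 d α Δ * T ^ ((d : ℝ) * ((d : ℝ) + 1) / α) *
              lsharp T ^ ((d : ℝ) * ((d : ℝ) + 1) / α))⁻¹ *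
            integratedField X Δ ((t i : ℝ) ^ (1 / (d : ℝ)) * T) ω)
        atTop (fun ω i => L (t i) ω) (fun _ => P) P' := by
  have : NeZero d := ⟨by omega⟩
  have hd0 : (0 : ℝ) < d := by exact_mod_cast hd
  have hα0 : 0 < α := by linarith
  set γ := α / ((d : ℝ) + 1) with hγ
  have hαγ : α = γ * ((d : ℝ) + 1) := by rw [hγ]; field_simp
  have hγ1 : 1 < γ := by rw [hγ, one_lt_div (by positivity)]; exact hα₁
  have hγ2 : γ < 2 := by rw [hγ, div_lt_iff₀ (by positivity)]; linarith
  -- `p > 1` is needed for the moment bound, `p` above the index for the finiteness of `∫ |x| ^ p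
  -- dW`, and `p < γ` for domination at small `r`.
  obtain ⟨p, hp1, hpγ⟩ := exists_between (max_lt hγ1 hβ₁)
  rw [max_lt_iff, ← hβ] at hp1
  rw [← hβ] at hβ₀ hβ₁
  have hp := integrable_rpow_of_blumenthalGetoorIndex_lt hW₂ hβ₀ hp1.2 (by linarith)
  have hγi := integrable_rpow_of_blumenthalGetoorIndex_lt hW₂ hβ₀ hβ₁ hγ2.le
  have hp2 := integrable_rpow_of_blumenthalGetoorIndex_lt hW₂ hβ₀ (hβ₁.trans hγ2) le_rfl
  have : SigmaFinite W := sigmaFinite_of_lintegral_sq_lt_top hW.zero hW₂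
  have hq : (ENNReal.ofReal p).toReal = p := ENNReal.toReal_ofReal (by linarith)
  have : Fact (1 ≤ ENNReal.ofReal p) := ⟨ENNReal.one_le_ofReal.2 hp1.1.le⟩
  have hK : IsCumulantOfOrder (jumpCumulant W) (ENNReal.ofReal p) (3 * ∫ x, |x| ^ p ∂W) :=
    { one_lt := by rw [hq]; exact hp1.1
      nonneg := mul_nonneg (by norm_num) (integral_nonneg fun x => by positivity)
      continuous := continuous_jumpCumulant hp1.1.le (by linarith) hp
      re_nonpos := re_jumpCumulant_nonpos hp1.1.le (by linarith) hp
      norm_le := by rw [hq]; exact norm_jumpCumulant_le hp1.1.le (by linarith) hp }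
  have hpos := ae_pos_of_eq_withDensity hπ
  have hint : Integrable (fun r : ℝ => r ^ (-((ENNReal.ofReal p).toReal + d))) π := by
    -- The kernels lie in `L^p` because `p + d < γ + d ≤ γ (d + 1) = α`.
    refine integrable_rpow_neg_mixing hl hl_pos hπ (by positivity) ?_
    rw [hq, hαγ]; nlinarith
  refine ⟨fun T _ => (hX.integral_ae_eq_stochasticIntegral hΛ hK hpos hint (hΔ_bdd.smul₀ T)).1,
    hγi.integrableOn, hγi.integrableOn, fun k t _ => ?_⟩
  -- the closed window
  have h0Δ : (0 : EuclideanSpace ℝ (Fin d)) ∈ closure Δ :=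
    subset_closure (interior_subset hΔ_zero)
  have hΔc : IsCompact (closure Δ) := hΔ_bdd.isCompact_closure
  have hΔv : volume.real (closure Δ) = volume.real Δ :=
    measureReal_congr (closure_ae_eq_of_null_frontier (hΔ_convex.addHaar_frontier volume))
  have hΔpos : 0 < volume.real (closure Δ) := by
    refine ENNReal.toReal_pos (ne_of_gt ?_) hΔc.measure_lt_top.ne
    exact (isOpen_interior.measure_pos volume ⟨0, hΔ_zero⟩).trans_le
      (measure_mono (interior_subset.trans subset_closure))
  have hc7 : c7 d α (closure Δ) = c7 d α Δ := by rw [c7, c7, hΔv]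
  have hc7pos : 0 < c7 d α Δ := by
    rw [← hc7, c7]
    have := Real.pi_pos
    have := Real.Gamma_pos_of_pos hd0
    have := Real.Gamma_pos_of_pos (half_pos hd0)
    positivity
  set n : ℝ → ℝ := fun T => c7 d α Δ * T ^ ((d : ℝ) * ((d : ℝ) + 1) / α) *
    lsharp T ^ ((d : ℝ) * ((d : ℝ) + 1) / α) with hn
  -- Only eventual: splitting the power of `T * lsharp T` uses positivity of `lsharp`.
  have hn_eq : ∀ᶠ T in atTop, n T =
      c7 d α Δ * ((T * lsharp T) ^ ((d : ℝ) / α)) ^ ((d : ℝ) + 1) := by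
    filter_upwards [hlsharp.slowlyVarying.eventually_pos, eventually_gt_atTop 0] with T h1 h2
    simp only [hn]
    rw [← Real.rpow_mul (by positivity), Real.mul_rpow h2.le h1.le, mul_assoc,
      div_mul_eq_mul_div]
  have hchar : ∀ (θ : Fin k → ℝ) (τ : Fin (k + 1) → ℝ≥0), Monotone τ → τ 0 = 0 →
      Tendsto (fun T => charFun (P.map fun ω => ∑ j, θ j * ((n T)⁻¹ *
        integratedField X Δ ((τ j.succ : ℝ) ^ (1 / (d : ℝ)) * T) ω)) 1) atTop
        (𝓝 (charFun (P'.map fun ω => ∑ j, θ j * L (τ j.succ) ω) 1)) := by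
    intro θ τ hτ hτ₀
    rw [hL.charFun_linearCombination (Ψ := stableExponent W γ) (fun t s => by
        rw [hL_stable, stableExponent]; congr 1; push_cast; ring) θ τ hτ hτ₀,
      ← integral_stableExponent_dilations hΔ_convex.closure hΔc h0Δ hΔpos hα0 hγ θ τ hτ hτ₀, hc7]
    set s : Fin k → ℝ := fun j => (τ j.succ : ℝ) ^ (1 / (d : ℝ)) with hs
    set φ : EuclideanSpace ℝ (Fin d) → ℝ :=
      fun v => ∑ i, (s i • closure Δ).indicator (fun _ => θ i) v with hφ
    obtain ⟨M, R, hφw⟩ := exists_isWindow_sum_indicator (S := fun i => s i • closure Δ)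
      (fun i => hΔc.smul (s i)) θ
    have hφc := ae_continuousAt_sum_indicator (S := fun i => s i • closure Δ)
      (fun i => hΔ_convex.closure.smul (s i)) θ
    have hmain : ∀ T : ℝ, 0 < T →
        Integrable (fun x => jumpCumulant W ((n T)⁻¹ * ∫ y, φ (T⁻¹ • y) * supCARKernel y x))
          (π.prod volume) ∧
        charFun (P.map fun ω => ∑ j, θ j * ((n T)⁻¹ * integratedField X Δ (s j * T) ω)) 1 =
          Complex.exp (∫ x, jumpCumulant W ((n T)⁻¹ * ∫ y, φ (T⁻¹ • y) * supCARKernel y x)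
            ∂(π.prod volume)) := by
      intro T hT
      have h := hX.charFun_sum_integral hΛ hK hpos hint (B := fun i => (s i * T) • Δ)
        (fun i => hΔ_bdd.smul₀ _) (fun i => θ i * (n T)⁻¹)
      simp_rw [sum_integral_dilation_supCARKernel hΔ_convex hΔ_bdd s θ hT (n T)⁻¹] at h
      refine ⟨h.1, ?_⟩
      rw [← h.2]
      simp only [integratedField, mul_assoc]
    have hlim := tendsto_integral_window_cumulant hφw hφc hαγ hp1.1.le hpγ hγ2 hp hγi hp2 hl hl_pos
      hπ hlsharp hc7pos (by
        filter_upwards [hn_eq, eventually_gt_atTop 0] with T h1 h2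
        rw [← h1]; exact (hmain T h2).1)
    refine ((Complex.continuous_exp.tendsto _).comp hlim).congr' ?_
    filter_upwards [hn_eq, eventually_gt_atTop 0] with T h1 h2
    rw [(hmain T h2).2, h1]
    rfl
  refine tendstoInDistribution_of_tendsto_charFun
    (fun T => measurable_pi_lambda _ fun i => (measurable_integratedField hX Δ _).const_mul _)
    (measurable_pi_lambda _ fun i => hL.measurable _) fun θ => ?_
  -- reduction to increasing times
  set σ := Tuple.sort t with hσ
  -- Time `0` is prepended as the base point of the increments; summing over the sorted times
  -- changes neither linear combination.
  have h := hchar (θ ∘ σ) (Fin.cons 0 (t ∘ σ)) (by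
    intro i j
    refine Fin.cases (fun _ => by simp)
      (fun i => Fin.cases (fun h => by simp at h) (fun j h => ?_) j) i
    simp only [Fin.cons_succ]
    exact Tuple.monotone_sort t (Fin.succ_le_succ_iff.1 h)) rfl
  simp only [Fin.cons_succ, Function.comp_apply] at h
  have e1 : ∀ (T : ℝ) (ω : Ω), ∑ j, θ (σ j) * ((n T)⁻¹ *
      integratedField X Δ ((t (σ j) : ℝ) ^ (1 / (d : ℝ)) * T) ω) =
      ∑ j, θ j * ((n T)⁻¹ * integratedField X Δ ((t j : ℝ) ^ (1 / (d : ℝ)) * T) ω) := fun T ω =>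
    Equiv.sum_comp σ fun j => θ j * ((n T)⁻¹ *
      integratedField X Δ ((t j : ℝ) ^ (1 / (d : ℝ)) * T) ω)
  have e2 : ∀ ω : Ω', ∑ j, θ (σ j) * L (t (σ j)) ω = ∑ j, θ j * L (t j) ω := fun ω =>
    Equiv.sum_comp σ fun j => θ j * L (t j) ω
  simp_rw [e1, e2] at h
  exact h
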